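/- The following is a theorem of homotopy type theory, i.e. a closed term of the corresponding type is derivable, for every universe $\mathcal U$ of the hierarchy: for every type $A:\mathcal U$, if $A$ is a set, then the type $N(A)$ is a set. Here homotopy type theory is intensional Martin-Löf type theory with cumulative universes $\mathcal U_0:\mathcal U_1:\cdots$, $\Pi$-types (with $\beta$ and $\eta$), $\Sigma$-types, $\mathbf 0$, $\mathbf 1$, $+$, $\mathbb N$, lists, identity types, function extensionality, univalence, propositional truncation, and the higher inductive type $N(A)$ below. A type $X$ is a set if $p=q$ for all $x,y:X$ and $p,q:x=y$; it is a $1$-type if all its equality types $x=y$ are sets. Write $L:=\mathsf{List}(A+A)$, let $xy$ be the concatenation of $x,y:L$, regard $a:A+A$ as a one-element list, and let $a\mapsto\bar a$ be the involution of $A+A$ that exchanges the two summands. Then $N(A)$ is the higher inductive type with the constructors $$\begin{aligned} \eta &: L\to N(A),\\ \tau &: (x:L)(a:A+A)(y:L)\to \eta(xa\bar a y)=\eta(xy),\\ \mathsf{sw} &: (x:L)(a:A+A)(y:L)(b:A+A)(z:L)\to\\ &\qquad \tau(x,a,yb\bar bz)\cdot\tau(xy,b,z)=\tau(xa\bar ay,b,z)\cdot\tau(x,a,yz),\\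 \mathsf{ov} &: (x:L)(a:A+A)(y:L)\to\tau(x,a,ay)=\tau(xa,\bar a,y),\\ \mathsf{tr} &: N(A)\text{ is a }1\text{-type}, \end{aligned}$$ where in $\mathsf{sw}$ and $\mathsf{ov}$ the canonical equalities $(xy)z=x(yz)$ and $\bar{\bar a}=a$ are left implicit. Its induction principle computes judgmentally on $\eta$ and up to an equality on $\tau$. -/

import Mathlib

/-
Homotopy type theory, as a formal system.

Mathlib has no homotopy type theory, and the equality of Lean itself satisfies uniqueness of
identity proofs, so that "is a set" would be empty if it were read in Lean.  The type theory is
therefore defined here as an object: raw terms with de Bruijn indices, and derivable judgments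
  Γ ctx,   Γ ⊢ a : A,   Γ ⊢ a ≡ b : A
with cumulative Russell universes, dependent functions (with β and η), dependent pairs, the
empty type, the unit type, binary sums, natural numbers, lists, identity types, function
extensionality, univalence, propositional truncation, and the higher inductive type N(A).
Function types, universes and variables have their own rules; everything else is given by
constants with closed types and by computation rules, which are closed judgmental equalities.
For brevity some functions are also constants, with a judgmental equality that defines them.
-/

namespace HoTT

/-! ## Raw terms -/

/-- Names of the functions that are introduced below by a defining equation. -/
inductive Defined : Type
  | symm | concat | ap | transport | apd | apdAlong | concatOver
  | bar | barBar | append | assoc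

/-- The constants: type formers, constructors, eliminators (`…Ind`), the two axioms, and the
defined functions.  Apart from univalence, which names a universe, they carry no universe
level. -/
inductive Const : Type
  | sigma | pair | sigmaInd
  | empty | emptyInd
  | unit | star | unitInd
  | sum | inl | inr | sumInd
  | nat | zero | succ | natInd
  | list | nil | cons | listInd
  | id | refl | idInd
  | funext
  | univalence (i : ℕ)
  | trunc | truncMk | truncEq | truncInd
  | N | eta | tau | sw | ov | tr | NInd | NIndTau
  | defined (d : Defined)

/-- Raw terms; a variable is a de Bruijn index, and `pi A B` and `lam A b` bind the variable
`0` in `B` and in `b`. -/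
inductive Tm : Type
  | var (n : ℕ)
  | univ (i : ℕ)
  | pi (A B : Tm)
  | lam (A b : Tm)
  | app (f a : Tm)
  | const (c : Const)

namespace Tm

/-- Extend a renaming under a binder. -/
def upRen (ρ : ℕ → ℕ) : ℕ → ℕ
  | 0 => 0
  | n + 1 => ρ n + 1

/-- Renaming of variables. -/
def rename : (ℕ → ℕ) → Tm → Tm
  | ρ, var n => var (ρ n)
  | _, univ i => univ i
  | ρ, pi A B => pi (rename ρ A) (rename (upRen ρ) B)
  | ρ, lam A b => lam (rename ρ A) (rename (upRen ρ) b)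
  | ρ, app f a => app (rename ρ f) (rename ρ a)
  | _, const c => const c

/-- Weakening by one variable. -/
def wk (t : Tm) : Tm := rename Nat.succ t

/-- Extend a substitution under a binder. -/
def upSub (σ : ℕ → Tm) : ℕ → Tm
  | 0 => var 0
  | n + 1 => wk (σ n)

/-- Simultaneous (capture-avoiding) substitution. -/
def subst : (ℕ → Tm) → Tm → Tm
  | σ, var n => σ n
  | _, univ i => univ i
  | σ, pi A B => pi (subst σ A) (subst (upSub σ) B)
  | σ, lam A b => lam (subst σ A) (subst (upSub σ) b)
  | σ, app f a => app (subst σ f) (subst σ a)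
  | _, const c => const c

/-- The substitution that sends the variable `0` to `a` and lowers the others by one. -/
def single (a : Tm) : ℕ → Tm
  | 0 => a
  | n + 1 => var n

/-- `inst b a` is `b[a / 0]`. -/
def inst (b a : Tm) : Tm := subst (single a) b

end Tm

/-! ## Writing terms with named variables

`Exp` is a device for writing down de Bruijn terms: an expression is a term for every number
of variables in scope, so that it can be placed under further binders without an explicit
weakening, and the binders `Pi`, `Lam` take Lean functions. -/

/-- A term as a function of the number of variables in scope. -/
structure Exp : Type where
  /-- The term in a context of the given length. -/
  toTm : ℕ → Tm

/-- The variable that is bound at depth `n`. -/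
def Exp.bound (n : ℕ) : Exp := ⟨fun m => Tm.var (m - (n + 1))⟩

/-- The dependent function type `(x : A) → B x`. -/
def Pi (A : Exp) (B : Exp → Exp) : Exp :=
  ⟨fun n => Tm.pi (A.toTm n) ((B (Exp.bound n)).toTm (n + 1))⟩

/-- The function `λ (x : A), b x`. -/
def Lam (A : Exp) (b : Exp → Exp) : Exp :=
  ⟨fun n => Tm.lam (A.toTm n) ((b (Exp.bound n)).toTm (n + 1))⟩

/-- Application. -/
def App (f a : Exp) : Exp := ⟨fun n => Tm.app (f.toTm n) (a.toTm n)⟩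

/-- Application is written as juxtaposition. -/
instance : CoeFun Exp (fun _ => Exp → Exp) := ⟨App⟩

/-- The non-dependent function type. -/
def Arrow (A B : Exp) : Exp := Pi A fun _ => B

infixr:25 " ⇒ " => Arrow

/-- The universe `U i`. -/
def U (i : ℕ) : Exp := ⟨fun _ => Tm.univ i⟩

/-- A constant. -/
def K (c : Const) : Exp := ⟨fun _ => Tm.const c⟩

/-- The term in the empty context. -/
def Exp.closed (e : Exp) : Tm := e.toTm 0

/-! ## Abbreviations in the type theory -/

/-- The dependent pair type `Σ (x : A), B x`. -/
def Sig (A : Exp) (B : Exp → Exp) : Exp := K .sigma A (Lam A B)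

/-- The product `A × B`. -/
def ProdType (A B : Exp) : Exp := Sig A fun _ => B

/-- The identity type `x =_A y`. -/
def Id (A x y : Exp) : Exp := K .id A x y

/-- Reflexivity. -/
def reflAt (A x : Exp) : Exp := K .refl A x

/-- A defined function. -/
def D (d : Defined) : Exp := K (.defined d)

/-- For `p : x = y` in `A`, the inverse `y = x`. -/
def symm (A x y p : Exp) : Exp := D .symm A x y p

/-- For `p : x = y` and `q : y = z` in `A`, the composite `x = z`. -/
def concat (A x y z p q : Exp) : Exp := D .concat A x y z p q

/-- For `f : A → B` and `p : x = y` in `A`, the equality `f x = f y`. -/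
def ap (A B f x y p : Exp) : Exp := D .ap A B f x y p

/-- For `P : A → U`, `p : x = y` in `A` and `u : P x`, the transported element of `P y`. -/
def transport (A P x y p u : Exp) : Exp := D .transport A P x y p u

/-- For `P : A → U`, `p : x = y` in `A`, `u : P x` and `v : P y`, the type of equalities
between `u` and `v` over `p`. -/
def IdOver (A P x y p u v : Exp) : Exp := Id (P y) (transport A P x y p u) v

/-- For a dependent function `f : (x : A) → P x` and `p : x = y`, the equality between `f x`
and `f y` over `p`. -/
def apd (A P f x y p : Exp) : Exp := D .apd A P f x y p

/-- For `f : A → B`, `P : B → U`, `e : (x : A) → P (f x)` and `p : x = y` in `A`, the equality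
between `e x` and `e y` over `ap f p`. -/
def apdAlong (A B f P e x y p : Exp) : Exp := D .apdAlong A B f P e x y p

/-- The composite, over `concat p q`, of an equality `r` between `u` and `v` over `p : x = y`
and an equality `s` between `v` and `w` over `q : y = z`. -/
def concatOver (A P x y z p q u v w r s : Exp) : Exp :=
  D .concatOver A P x y z p q u v w r s

/-- `A` is a proposition. -/
def isProp (A : Exp) : Exp := Pi A fun x => Pi A fun y => Id A x y

/-- `A` is a set: all equality types of `A` are propositions. -/
def isSet (A : Exp) : Exp := Pi A fun x => Pi A fun y => isProp (Id A x y)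

/-- `A` is a 1-type: all equality types of `A` are sets. -/
def isOneType (A : Exp) : Exp := Pi A fun x => Pi A fun y => isSet (Id A x y)

/-- `f : A → B` is an equivalence: it has a right inverse and a left inverse. -/
def isEquiv (A B f : Exp) : Exp :=
  ProdType (Sig (B ⇒ A) fun g => Pi B fun y => Id B (f (g y)) y)
    (Sig (B ⇒ A) fun h => Pi A fun x => Id A (h (f x)) x)

/-- The type of equivalences between `A` and `B`. -/
def EquivType (A B : Exp) : Exp := Sig (A ⇒ B) fun f => isEquiv A B f

/-- The identity function on `A`. -/
def idFun (A : Exp) : Exp := Lam A fun x => x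

/-- The identity function on `A` as an equivalence. -/
def idEquiv (A : Exp) : Exp :=
  let inverse : Exp := K .pair (A ⇒ A) (Lam (A ⇒ A) fun g => Pi A fun x => Id A (g x) x)
    (idFun A) (Lam A fun x => reflAt A x)
  K .pair (A ⇒ A) (Lam (A ⇒ A) fun f => isEquiv A A f) (idFun A)
    (K .pair (Sig (A ⇒ A) fun g => Pi A fun x => Id A (g x) x)
      (Lam (Sig (A ⇒ A) fun g => Pi A fun x => Id A (g x) x) fun _ =>
        Sig (A ⇒ A) fun h => Pi A fun x => Id A (h x) x)
      inverse inverse)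

/-- For types `A B : U i`, the canonical function from `A = B` to equivalences. -/
def idToEquiv (i : ℕ) (A B : Exp) : Exp :=
  Lam (Id (U i) A B) fun p =>
    K .idInd (U i) A (Lam (U i) fun B => Lam (Id (U i) A B) fun _ => EquivType A B) (idEquiv A) B p

/-- For `f g : (x : A) → B x`, the canonical function from `f = g` to pointwise equality. -/
def happly (A B f g : Exp) : Exp :=
  Lam (Id (Pi A fun x => B x) f g) fun p =>
    K .idInd (Pi A fun x => B x) f
      (Lam (Pi A fun x => B x) fun g => Lam (Id (Pi A fun x => B x) f g) fun _ =>
        Pi A fun x => Id (B x) (f x) (g x))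
      (Lam A fun x => reflAt (B x) (f x)) g p

/-! ## Lists of signed elements -/

/-- `A + A`, the elements of `A` with a sign. -/
def Signed (A : Exp) : Exp := K .sum A A

/-- Change of sign. -/
def bar (A a : Exp) : Exp := D .bar A a

/-- The equality `bar (bar a) = a`. -/
def barBar (A a : Exp) : Exp := D .barBar A a

/-- Lists of signed elements of `A`. -/
def LS (A : Exp) : Exp := K .list (Signed A)

/-- The empty list. -/
def nil (A : Exp) : Exp := K .nil (Signed A)

/-- The list with first element `a` and remainder `x`. -/
def cons (A a x : Exp) : Exp := K .cons (Signed A) a x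

/-- Concatenation of lists. -/
def append (A x y : Exp) : Exp := D .append A x y

/-- The list `a, bar a, y`. -/
def redex (A a y : Exp) : Exp := cons A a (cons A (bar A a) y)

/-- The canonical equality `(x ++ y) ++ z = x ++ (y ++ z)`. -/
def assoc (A x y z : Exp) : Exp := D .assoc A x y z

/-- The inverse of `assoc`. -/
def assocInv (A x y z : Exp) : Exp :=
  symm (LS A) (append A (append A x y) z) (append A x (append A y z)) (assoc A x y z)

/-! ## The composites of equalities in the constructors `sw` and `ov` of `N(A)` -/

/-- The type `N(A)`. -/
def NA (A : Exp) : Exp := K .N A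

/-- The point `η(x)` of `N(A)`. -/
def eta (A x : Exp) : Exp := K .eta A x

/-- Composites of equalities in `N(A)`: instances of `τ`, images under `η` of an equality `e`
of lists from `x` to `y`, and compositions. -/
inductive PathExp : Type
  | tau (x a y : Exp)
  | list (x y e : Exp)
  | comp (p q : PathExp)

namespace PathExp

/-- The list at which the composite starts. -/
def src (A : Exp) : PathExp → Exp
  | tau x a y => append A x (redex A a y)
  | list x _ _ => x
  | comp p _ => src A p

/-- The list at which the composite ends. -/
def tgt (A : Exp) : PathExp → Exp
  | tau x _ y => append A x y
  | list _ y _ => y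
  | comp _ q => tgt A q

/-- The composite, as an equality `η(src) = η(tgt)`. -/
def path (A : Exp) : PathExp → Exp
  | tau x a y => K .tau A x a y
  | list x y e => ap (LS A) (NA A) (K .eta A) x y e
  | comp p q => concat (NA A) (eta A (src A p)) (eta A (tgt A p)) (eta A (tgt A q))
      (path A p) (path A q)

/-- For a family `P : N(A) → U`, a function `e : (x : LS A) → P (η x)` and `t` that gives
equalities between the values of `e` over the `τ`, the corresponding composite of equalities
over `path`. -/
def pathOver (A P e t : Exp) : PathExp → Exp
  | tau x a y => t x a y
  | list x y r => apdAlong (LS A) (NA A) (K .eta A) P e x y r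
  | comp p q => concatOver (NA A) P
      (eta A (src A p)) (eta A (tgt A p)) (eta A (tgt A q)) (path A p) (path A q)
      (e (src A p)) (e (tgt A p)) (e (tgt A q)) (pathOver A P e t p) (pathOver A P e t q)

/-- The type of equalities `p = q`, for composites with the same ends. -/
def EqPath (A : Exp) (p q : PathExp) : Exp :=
  Id (Id (NA A) (eta A (src A p)) (eta A (tgt A p))) (path A p) (path A q)

/-- The type of equalities between `pathOver p` and `pathOver q` over `h : path p = path q`. -/
def EqPathOver (A P e t : Exp) (p q : PathExp) (h : Exp) : Exp :=
  IdOver (Id (NA A) (eta A (src A p)) (eta A (tgt A p)))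
    (Lam (Id (NA A) (eta A (src A p)) (eta A (tgt A p))) fun r =>
      IdOver (NA A) P (eta A (src A p)) (eta A (tgt A p)) r (e (src A p)) (e (tgt A p)))
    (path A p) (path A q) h (pathOver A P e t p) (pathOver A P e t q)

end PathExp

open PathExp in
/-- Reduce `a` first, then `b`: with concatenation treated as strictly associative this is
`τ(x, a, y b b⁻ z)` followed by `τ(x y, b, z)`. -/
def swLeft (A x a y b z : Exp) : PathExp :=
  comp (tau x a (append A y (redex A b z)))
  (comp (list (append A x (append A y (redex A b z))) (append A (append A x y) (redex A b z))
      (assocInv A x y (redex A b z)))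
    (tau (append A x y) b z))

open PathExp in
/-- Reduce `b` first, then `a`: with concatenation treated as strictly associative this is
`τ(x a a⁻ y, b, z)` followed by `τ(x, a, y z)`. -/
def swRight (A x a y b z : Exp) : PathExp :=
  comp (list (append A x (append A (redex A a y) (redex A b z)))
      (append A (append A x (redex A a y)) (redex A b z))
      (assocInv A x (redex A a y) (redex A b z)))
  (comp (tau (append A x (redex A a y)) b z)
  (comp (list (append A (append A x (redex A a y)) z) (append A x (append A (redex A a y) z))
      (assoc A x (redex A a y) z))
  (comp (tau x a (append A y z))
    (list (append A x (append A y z)) (append A (append A x y) z) (assocInv A x y z)))))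

open PathExp in
/-- In `x a a⁻ a y`, reduce `a a⁻`: this is `τ(x, a, a y)`. -/
def ovLeft (A x a y : Exp) : PathExp := tau x a (cons A a y)

open PathExp in
/-- In `x a a⁻ a y`, reduce `a⁻ a`: with concatenation treated as strictly associative and
change of sign as strictly involutive this is `τ(x a, a⁻, y)`. -/
def ovRight (A x a y : Exp) : PathExp :=
  let single : Exp := cons A a (nil A)
  let c : Exp := bar A (bar A a)
  comp (list (append A x (redex A a (cons A a y))) (append A x (redex A a (cons A c y)))
      (ap (Signed A) (LS A) (Lam (Signed A) fun b => append A x (redex A a (cons A b y))) a c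
        (symm (Signed A) c a (barBar A a))))
  (comp (list (append A x (append A single (redex A (bar A a) y)))
      (append A (append A x single) (redex A (bar A a) y))
      (assocInv A x single (redex A (bar A a) y)))
  (comp (tau (append A x single) (bar A a) y)
    (list (append A (append A x single) y) (append A x (append A single y))
      (assoc A x single y))))

/-! ## The methods of the induction principle of `N(A)`, for a family `P : N(A) → U` -/

/-- The type of methods for `η`. -/
def methodEta (A P : Exp) : Exp := Pi (LS A) fun x => P (eta A x)

/-- The type of equalities over `τ(x, a, y)` between values of the method `e` for `η`. -/
def OverTau (A P e x a y : Exp) : Exp :=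
  IdOver (NA A) P (eta A (append A x (redex A a y))) (eta A (append A x y)) (K .tau A x a y)
    (e (append A x (redex A a y))) (e (append A x y))

/-- The type of methods for `τ`. -/
def methodTau (A P e : Exp) : Exp :=
  Pi (LS A) fun x => Pi (Signed A) fun a => Pi (LS A) fun y => OverTau A P e x a y

/-- The type of methods for `sw`. -/
def methodSw (A P e t : Exp) : Exp :=
  Pi (LS A) fun x => Pi (Signed A) fun a => Pi (LS A) fun y =>
    Pi (Signed A) fun b => Pi (LS A) fun z =>
      PathExp.EqPathOver A P e t (swLeft A x a y b z) (swRight A x a y b z) (K .sw A x a y b z)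

/-- The type of methods for `ov`. -/
def methodOv (A P e t : Exp) : Exp :=
  Pi (LS A) fun x => Pi (Signed A) fun a => Pi (LS A) fun y =>
    PathExp.EqPathOver A P e t (ovLeft A x a y) (ovRight A x a y) (K .ov A x a y)

/-- For `tr`: all `P n` are 1-types. -/
def methodTr (A P : Exp) : Exp := Pi (NA A) fun n => isOneType (P n)

/-! ## Defining equations -/

/-- The premise of a rule in front of its two sides and their type: the rule `l ≡ r : T` with
a parameter of type `A`, as an equality of functions of the parameter. -/
def Abs (A : Exp) (b : Exp → Exp × Exp × Exp) : Exp × Exp × Exp :=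
  (Lam A fun x => (b x).1, Lam A fun x => (b x).2.1, Pi A fun x => (b x).2.2)

/-- The defining equation of a defined function: the left side, the right side, and their
common type.  All parameters are abstracted, so that these are closed terms. -/
def Defined.rule (i j : ℕ) : Defined → Exp × Exp × Exp
  | .symm => Abs (U i) fun A => Abs A fun x => Abs A fun y => Abs (Id A x y) fun p =>
      (HoTT.symm A x y p,
       K .idInd A x (Lam A fun y => Lam (Id A x y) fun _ => Id A y x) (reflAt A x) y p,
       Id A y x)
  | .concat => Abs (U i) fun A => Abs A fun x => Abs A fun y => Abs A fun z =>
      Abs (Id A x y) fun p => Abs (Id A y z) fun q =>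
      (HoTT.concat A x y z p q,
       K .idInd A y (Lam A fun z => Lam (Id A y z) fun _ => Id A x z) p z q,
       Id A x z)
  | .ap => Abs (U i) fun A => Abs (U i) fun B => Abs (A ⇒ B) fun f =>
      Abs A fun x => Abs A fun y => Abs (Id A x y) fun p =>
      (HoTT.ap A B f x y p,
       K .idInd A x (Lam A fun y => Lam (Id A x y) fun _ => Id B (f x) (f y))
         (reflAt B (f x)) y p,
       Id B (f x) (f y))
  | .transport => Abs (U i) fun A => Abs (A ⇒ U j) fun P =>
      Abs A fun x => Abs A fun y => Abs (Id A x y) fun p => Abs (P x) fun u =>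
      (HoTT.transport A P x y p u,
       K .idInd A x (Lam A fun y => Lam (Id A x y) fun _ => P y) u y p,
       P y)
  | .apd => Abs (U i) fun A => Abs (A ⇒ U j) fun P => Abs (Pi A fun x => P x) fun f =>
      Abs A fun x => Abs A fun y => Abs (Id A x y) fun p =>
      (HoTT.apd A P f x y p,
       K .idInd A x (Lam A fun y => Lam (Id A x y) fun p => IdOver A P x y p (f x) (f y))
         (reflAt (P x) (f x)) y p,
       IdOver A P x y p (f x) (f y))
  | .apdAlong => Abs (U i) fun A => Abs (U i) fun B => Abs (A ⇒ B) fun f =>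
      Abs (B ⇒ U j) fun P => Abs (Pi A fun x => P (f x)) fun e =>
      Abs A fun x => Abs A fun y => Abs (Id A x y) fun p =>
      (HoTT.apdAlong A B f P e x y p,
       K .idInd A x
         (Lam A fun y => Lam (Id A x y) fun p =>
           IdOver B P (f x) (f y) (HoTT.ap A B f x y p) (e x) (e y))
         (reflAt (P (f x)) (e x)) y p,
       IdOver B P (f x) (f y) (HoTT.ap A B f x y p) (e x) (e y))
  | .concatOver => Abs (U i) fun A => Abs (A ⇒ U j) fun P =>
      Abs A fun x => Abs A fun y => Abs A fun z =>
      Abs (Id A x y) fun p => Abs (Id A y z) fun q =>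
      Abs (P x) fun u => Abs (P y) fun v => Abs (P z) fun w =>
      Abs (IdOver A P x y p u v) fun r => Abs (IdOver A P y z q v w) fun s =>
      (HoTT.concatOver A P x y z p q u v w r s,
       K .idInd A y
         (Lam A fun z => Lam (Id A y z) fun q =>
           Pi (P z) fun w => IdOver A P y z q v w ⇒
             IdOver A P x z (HoTT.concat A x y z p q) u w)
         (Lam (P y) fun w => Lam (Id (P y) v w) fun s =>
           HoTT.concat (P y) (HoTT.transport A P x y p u) v w r s)
         z q w s,
       IdOver A P x z (HoTT.concat A x y z p q) u w)
  | .bar => Abs (U i) fun A => Abs (Signed A) fun a =>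
      (HoTT.bar A a,
       K .sumInd A A (Lam (Signed A) fun _ => Signed A)
         (Lam A fun x => K .inr A A x) (Lam A fun x => K .inl A A x) a,
       Signed A)
  | .barBar => Abs (U i) fun A => Abs (Signed A) fun a =>
      (HoTT.barBar A a,
       K .sumInd A A (Lam (Signed A) fun a => Id (Signed A) (HoTT.bar A (HoTT.bar A a)) a)
         (Lam A fun x => reflAt (Signed A) (K .inl A A x))
         (Lam A fun x => reflAt (Signed A) (K .inr A A x)) a,
       Id (Signed A) (HoTT.bar A (HoTT.bar A a)) a)
  | .append => Abs (U i) fun A => Abs (LS A) fun x => Abs (LS A) fun y =>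
      (HoTT.append A x y,
       K .listInd (Signed A) (Lam (LS A) fun _ => LS A) y
         (Lam (Signed A) fun a => Lam (LS A) fun _ => Lam (LS A) fun r => cons A a r) x,
       LS A)
  | .assoc => Abs (U i) fun A => Abs (LS A) fun x => Abs (LS A) fun y => Abs (LS A) fun z =>
      (HoTT.assoc A x y z,
       K .listInd (Signed A)
         (Lam (LS A) fun x => Id (LS A) (HoTT.append A (HoTT.append A x y) z)
           (HoTT.append A x (HoTT.append A y z)))
         (reflAt (LS A) (HoTT.append A y z))
         (Lam (Signed A) fun a => Lam (LS A) fun x =>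
           Lam (Id (LS A) (HoTT.append A (HoTT.append A x y) z)
             (HoTT.append A x (HoTT.append A y z))) fun r =>
             HoTT.ap (LS A) (LS A) (Lam (LS A) fun l => cons A a l)
               (HoTT.append A (HoTT.append A x y) z)
               (HoTT.append A x (HoTT.append A y z)) r)
         x,
       Id (LS A) (HoTT.append A (HoTT.append A x y) z)
         (HoTT.append A x (HoTT.append A y z)))

/-! ## The types of the constants -/

/-- The type of a constant.  The level `i` is that of the types that a type former is applied
to, and `j` is that of the family into which an eliminator eliminates; a constant has the
types for all `i` and `j`. -/
def Const.type (i j : ℕ) : Const → Exp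
  | sigma => Pi (U i) fun A => (A ⇒ U i) ⇒ U i
  | pair => Pi (U i) fun A => Pi (A ⇒ U i) fun B => Pi A fun a => B a ⇒ K .sigma A B
  | sigmaInd => Pi (U i) fun A => Pi (A ⇒ U i) fun B => Pi (K .sigma A B ⇒ U j) fun P =>
      (Pi A fun a => Pi (B a) fun b => P (K .pair A B a b)) ⇒ Pi (K .sigma A B) fun w => P w
  | empty => U i
  | emptyInd => Pi (K .empty ⇒ U j) fun P => Pi (K .empty) fun x => P x
  | unit => U i
  | star => K .unit
  | unitInd => Pi (K .unit ⇒ U j) fun P => P (K .star) ⇒ Pi (K .unit) fun x => P x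
  | sum => U i ⇒ U i ⇒ U i
  | inl => Pi (U i) fun A => Pi (U i) fun B => A ⇒ K .sum A B
  | inr => Pi (U i) fun A => Pi (U i) fun B => B ⇒ K .sum A B
  | sumInd => Pi (U i) fun A => Pi (U i) fun B => Pi (K .sum A B ⇒ U j) fun P =>
      (Pi A fun a => P (K .inl A B a)) ⇒ (Pi B fun b => P (K .inr A B b)) ⇒
        Pi (K .sum A B) fun x => P x
  | nat => U i
  | zero => K .nat
  | succ => K .nat ⇒ K .nat
  | natInd => Pi (K .nat ⇒ U j) fun P => P (K .zero) ⇒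
      (Pi (K .nat) fun n => P n ⇒ P (K .succ n)) ⇒ Pi (K .nat) fun n => P n
  | list => U i ⇒ U i
  | nil => Pi (U i) fun A => K .list A
  | cons => Pi (U i) fun A => A ⇒ K .list A ⇒ K .list A
  | listInd => Pi (U i) fun A => Pi (K .list A ⇒ U j) fun P => P (K .nil A) ⇒
      (Pi A fun a => Pi (K .list A) fun x => P x ⇒ P (K .cons A a x)) ⇒
        Pi (K .list A) fun x => P x
  | id => Pi (U i) fun A => A ⇒ A ⇒ U i
  | refl => Pi (U i) fun A => Pi A fun x => Id A x x
  | idInd => Pi (U i) fun A => Pi A fun x => Pi (Pi A fun y => Id A x y ⇒ U j) fun P =>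
      P x (reflAt A x) ⇒ Pi A fun y => Pi (Id A x y) fun p => P y p
  | funext => Pi (U i) fun A => Pi (A ⇒ U i) fun B =>
      Pi (Pi A fun x => B x) fun f => Pi (Pi A fun x => B x) fun g =>
        isEquiv (Id (Pi A fun x => B x) f g) (Pi A fun x => Id (B x) (f x) (g x))
          (happly A B f g)
  | univalence k => Pi (U k) fun A => Pi (U k) fun B =>
      isEquiv (Id (U k) A B) (EquivType A B) (idToEquiv k A B)
  | trunc => U i ⇒ U i
  | truncMk => Pi (U i) fun A => A ⇒ K .trunc A
  | truncEq => Pi (U i) fun A => isProp (K .trunc A)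
  | truncInd => Pi (U i) fun A => Pi (K .trunc A ⇒ U j) fun P =>
      (Pi (K .trunc A) fun x => isProp (P x)) ⇒ (Pi A fun a => P (K .truncMk A a)) ⇒
        Pi (K .trunc A) fun x => P x
  | N => U i ⇒ U i
  | eta => Pi (U i) fun A => LS A ⇒ NA A
  | tau => Pi (U i) fun A => Pi (LS A) fun x => Pi (Signed A) fun a => Pi (LS A) fun y =>
      Id (NA A) (HoTT.eta A (append A x (redex A a y))) (HoTT.eta A (append A x y))
  | sw => Pi (U i) fun A => Pi (LS A) fun x => Pi (Signed A) fun a => Pi (LS A) fun y =>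
      Pi (Signed A) fun b => Pi (LS A) fun z =>
        PathExp.EqPath A (swLeft A x a y b z) (swRight A x a y b z)
  | ov => Pi (U i) fun A => Pi (LS A) fun x => Pi (Signed A) fun a => Pi (LS A) fun y =>
      PathExp.EqPath A (ovLeft A x a y) (ovRight A x a y)
  | tr => Pi (U i) fun A => isOneType (NA A)
  | NInd => Pi (U i) fun A => Pi (NA A ⇒ U j) fun P =>
      Pi (methodEta A P) fun e => Pi (methodTau A P e) fun t =>
      methodSw A P e t ⇒ methodOv A P e t ⇒ methodTr A P ⇒ Pi (NA A) fun n => P n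
  | NIndTau => Pi (U i) fun A => Pi (NA A ⇒ U j) fun P =>
      Pi (methodEta A P) fun e => Pi (methodTau A P e) fun t =>
      Pi (methodSw A P e t) fun s => Pi (methodOv A P e t) fun o => Pi (methodTr A P) fun h =>
      Pi (LS A) fun x => Pi (Signed A) fun a => Pi (LS A) fun y =>
        Id (OverTau A P e x a y)
          (apd (NA A) P (K .NInd A P e t s o h) (HoTT.eta A (append A x (redex A a y)))
            (HoTT.eta A (append A x y)) (K .tau A x a y))
          (t x a y)
  | defined d => (d.rule i j).2.2

/-! ## Computation rules -/

/-- The names of the computation rules. -/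
inductive Comp : Type
  | sigma | unit | inl | inr | zero | succ | nil | cons | refl | trunc | eta
  | defined (d : Defined)

/-- A computation rule: the left side, the right side, and their common type, with all
parameters abstracted. -/
def Comp.rule (i j : ℕ) : Comp → Exp × Exp × Exp
  | sigma => Abs (U i) fun A => Abs (A ⇒ U i) fun B => Abs (K .sigma A B ⇒ U j) fun P =>
      Abs (Pi A fun a => Pi (B a) fun b => P (K .pair A B a b)) fun f =>
      Abs A fun a => Abs (B a) fun b =>
        (K .sigmaInd A B P f (K .pair A B a b), f a b, P (K .pair A B a b))
  | unit => Abs (K .unit ⇒ U j) fun P => Abs (P (K .star)) fun c =>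
      (K .unitInd P c (K .star), c, P (K .star))
  | inl => Abs (U i) fun A => Abs (U i) fun B => Abs (K .sum A B ⇒ U j) fun P =>
      Abs (Pi A fun a => P (K .inl A B a)) fun f =>
      Abs (Pi B fun b => P (K .inr A B b)) fun g => Abs A fun a =>
        (K .sumInd A B P f g (K .inl A B a), f a, P (K .inl A B a))
  | inr => Abs (U i) fun A => Abs (U i) fun B => Abs (K .sum A B ⇒ U j) fun P =>
      Abs (Pi A fun a => P (K .inl A B a)) fun f =>
      Abs (Pi B fun b => P (K .inr A B b)) fun g => Abs B fun b =>
        (K .sumInd A B P f g (K .inr A B b), g b, P (K .inr A B b))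
  | zero => Abs (K .nat ⇒ U j) fun P => Abs (P (K .zero)) fun c =>
      Abs (Pi (K .nat) fun n => P n ⇒ P (K .succ n)) fun f =>
        (K .natInd P c f (K .zero), c, P (K .zero))
  | succ => Abs (K .nat ⇒ U j) fun P => Abs (P (K .zero)) fun c =>
      Abs (Pi (K .nat) fun n => P n ⇒ P (K .succ n)) fun f => Abs (K .nat) fun n =>
        (K .natInd P c f (K .succ n), f n (K .natInd P c f n), P (K .succ n))
  | nil => Abs (U i) fun A => Abs (K .list A ⇒ U j) fun P => Abs (P (K .nil A)) fun c =>
      Abs (Pi A fun a => Pi (K .list A) fun x => P x ⇒ P (K .cons A a x)) fun f =>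
        (K .listInd A P c f (K .nil A), c, P (K .nil A))
  | cons => Abs (U i) fun A => Abs (K .list A ⇒ U j) fun P => Abs (P (K .nil A)) fun c =>
      Abs (Pi A fun a => Pi (K .list A) fun x => P x ⇒ P (K .cons A a x)) fun f =>
      Abs A fun a => Abs (K .list A) fun x =>
        (K .listInd A P c f (K .cons A a x), f a x (K .listInd A P c f x), P (K .cons A a x))
  | refl => Abs (U i) fun A => Abs A fun x => Abs (Pi A fun y => Id A x y ⇒ U j) fun P =>
      Abs (P x (reflAt A x)) fun d => (K .idInd A x P d x (reflAt A x), d, P x (reflAt A x))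
  | trunc => Abs (U i) fun A => Abs (K .trunc A ⇒ U j) fun P =>
      Abs (Pi (K .trunc A) fun x => isProp (P x)) fun h =>
      Abs (Pi A fun a => P (K .truncMk A a)) fun f => Abs A fun a =>
        (K .truncInd A P h f (K .truncMk A a), f a, P (K .truncMk A a))
  | eta => Abs (U i) fun A => Abs (NA A ⇒ U j) fun P =>
      Abs (methodEta A P) fun e => Abs (methodTau A P e) fun t =>
      Abs (methodSw A P e t) fun s => Abs (methodOv A P e t) fun o =>
      Abs (methodTr A P) fun h => Abs (LS A) fun x =>
        (K .NInd A P e t s o h (HoTT.eta A x), e x, P (HoTT.eta A x))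
  | defined d => d.rule i j

/-! ## Judgments and derivability -/

/-- Contexts; the type of the variable `0` comes first, and each type may use the variables
that follow it in the list. -/
abbrev Ctx : Type := List Tm

/-- The variable with the given index has the given type in the context. -/
inductive Lookup : Ctx → ℕ → Tm → Prop
  | zero (Γ : Ctx) (A : Tm) : Lookup (A :: Γ) 0 A.wk
  | succ (Γ : Ctx) (n : ℕ) (A B : Tm) : Lookup Γ n A → Lookup (B :: Γ) (n + 1) A.wk

/-- Judgments: `Γ ctx`, `Γ ⊢ a : A` and `Γ ⊢ a ≡ b : A`. -/
inductive Judgment : Type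
  | ctx (Γ : Ctx)
  | typ (Γ : Ctx) (a A : Tm)
  | eq (Γ : Ctx) (a b A : Tm)

open Judgment in
/-- Derivable judgments. -/
inductive Derivable : Judgment → Prop
  | ctxNil : Derivable (ctx [])
  | ctxCons (Γ : Ctx) (A : Tm) (i : ℕ) :
      Derivable (typ Γ A (.univ i)) → Derivable (ctx (A :: Γ))
  | var (Γ : Ctx) (n : ℕ) (A : Tm) :
      Derivable (ctx Γ) → Lookup Γ n A → Derivable (typ Γ (.var n) A)
  | const (Γ : Ctx) (c : Const) (i j : ℕ) :
      Derivable (ctx Γ) → Derivable (typ Γ (.const c) (c.type i j).closed)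
  | univ (Γ : Ctx) (i : ℕ) :
      Derivable (ctx Γ) → Derivable (typ Γ (.univ i) (.univ (i + 1)))
  | cumul (Γ : Ctx) (A : Tm) (i : ℕ) :
      Derivable (typ Γ A (.univ i)) → Derivable (typ Γ A (.univ (i + 1)))
  | pi (Γ : Ctx) (A B : Tm) (i : ℕ) :
      Derivable (typ Γ A (.univ i)) → Derivable (typ (A :: Γ) B (.univ i)) →
      Derivable (typ Γ (.pi A B) (.univ i))
  | lam (Γ : Ctx) (A B b : Tm) :
      Derivable (typ (A :: Γ) b B) → Derivable (typ Γ (.lam A b) (.pi A B))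
  | app (Γ : Ctx) (A B f a : Tm) :
      Derivable (typ Γ f (.pi A B)) → Derivable (typ Γ a A) →
      Derivable (typ Γ (.app f a) (B.inst a))
  | conv (Γ : Ctx) (a A B : Tm) (i : ℕ) :
      Derivable (typ Γ a A) → Derivable (eq Γ A B (.univ i)) → Derivable (typ Γ a B)
  | eqRefl (Γ : Ctx) (a A : Tm) : Derivable (typ Γ a A) → Derivable (eq Γ a a A)
  | eqSymm (Γ : Ctx) (a b A : Tm) : Derivable (eq Γ a b A) → Derivable (eq Γ b a A)
  | eqTrans (Γ : Ctx) (a b c A : Tm) :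
      Derivable (eq Γ a b A) → Derivable (eq Γ b c A) → Derivable (eq Γ a c A)
  | eqConv (Γ : Ctx) (a b A B : Tm) (i : ℕ) :
      Derivable (eq Γ a b A) → Derivable (eq Γ A B (.univ i)) → Derivable (eq Γ a b B)
  | eqCumul (Γ : Ctx) (A B : Tm) (i : ℕ) :
      Derivable (eq Γ A B (.univ i)) → Derivable (eq Γ A B (.univ (i + 1)))
  | eqPi (Γ : Ctx) (A A' B B' : Tm) (i : ℕ) :
      Derivable (eq Γ A A' (.univ i)) → Derivable (eq (A :: Γ) B B' (.univ i)) →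
      Derivable (eq Γ (.pi A B) (.pi A' B') (.univ i))
  | eqLam (Γ : Ctx) (A A' B b b' : Tm) (i : ℕ) :
      Derivable (eq Γ A A' (.univ i)) → Derivable (eq (A :: Γ) b b' B) →
      Derivable (eq Γ (.lam A b) (.lam A' b') (.pi A B))
  | eqApp (Γ : Ctx) (A B f f' a a' : Tm) :
      Derivable (eq Γ f f' (.pi A B)) → Derivable (eq Γ a a' A) →
      Derivable (eq Γ (.app f a) (.app f' a') (B.inst a))
  | beta (Γ : Ctx) (A B b a : Tm) :
      Derivable (typ (A :: Γ) b B) → Derivable (typ Γ a A) →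
      Derivable (eq Γ (.app (.lam A b) a) (b.inst a) (B.inst a))
  | eta (Γ : Ctx) (A B f : Tm) :
      Derivable (typ Γ f (.pi A B)) →
      Derivable (eq Γ f (.lam A (.app f.wk (.var 0))) (.pi A B))
  | comp (Γ : Ctx) (c : Comp) (i j : ℕ) :
      Derivable (ctx Γ) →
      Derivable (eq Γ (c.rule i j).1.closed (c.rule i j).2.1.closed (c.rule i j).2.2.closed)

/-- The closed expression `T` denotes a type that is inhabited in the empty context, that is,
`T` is a theorem of homotopy type theory. -/
def IsTheorem (T : Exp) : Prop := ∃ t : Tm, Derivable (.typ [] t T.closed)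

end HoTT

/-! Contracting `a ā` inside a list is a rewriting step, and `N(A)` is the quotient of the lists by
these steps. Fix a point `B` of `N(A)` and rewrite pairs `(v, p)` of a list `v` and a path `p : η(v)
= B`: the pair `(x a ā y, τ · q)` is rewritten to `(x y, q)`. A list is thereby reduced together
with the path that the reduction induces.

The constructors `sw` and `ov` say that this rewriting of pairs has the diamond property. Two
redexes of one list coincide, share one letter, or are disjoint. In the first two cases both
contractions give the same list with the same path, by cancellation and by `ov`. In the third case
they have a common contraction, by `sw`. Equalities of lists enter through `ap η`; since `A` is a
set, so is the type of lists, and the choice of these equalities does not matter (`localDiamond`).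
The diamond property gives confluence (`confluence`). Contraction shortens a list by two, so
induction on lists is available (`listWf`) and shows that reductions from one pair `(u, k)` to pairs
over the same list `t` induce the same path from `t` (`unique`).

Consequently, a path `p : η(y) = η(x)` for which `(x, refl)` and `(y, p)` have a common reduct is
determined by `x` and `y` (`joinEq`). The type `E(y)` of such paths, with the common reduct
truncated, is therefore a proposition. It is invariant under `τ` in `y`, so by univalence for
propositions it extends to a family `D` on `N(A)` (`NRel`), and the paths extend to `D(m) → m =
η(x)` because `N(A)` is a 1-type (`NDesc`). As `D(η(x))` is inhabited, `η(x) = m` is a retract of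
the proposition `D(m)` (`isPropIdAt`). Induction on the other endpoint shows that `N(A)` is a set
(`isSetN`). Only the judgmental computation on `η` is used, not the computation on `τ`.

A derivation in the formal system is obtained by reflection. A type checker with normalization runs
in the kernel, and `check_sound` turns its success into derivability. Its soundness presupposes that
the types of the constants are types and that the rules used for reduction are derivable; both are
established by the checker itself, in stages, each using only what earlier stages have validated.
Proved statements become variables of a context that is realized by closed proofs (`Theory.cons`),
so later proofs cite them without unfolding them. The proof is carried out for types in `U 0`;
adding a constant to all levels preserves derivability (`Derivable.raise`) and gives every universe.
-/

namespace HoTT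

/-! ## Renaming and substitution -/

namespace Tm

theorem upRen_comp (ρ ρ' : ℕ → ℕ) : upRen ρ' ∘ upRen ρ = upRen (ρ' ∘ ρ) := by
  funext n; cases n <;> rfl

theorem rename_rename (t : Tm) (ρ ρ' : ℕ → ℕ) :
    (t.rename ρ).rename ρ' = t.rename (ρ' ∘ ρ) := by
  induction t generalizing ρ ρ' <;> simp_all [rename, upRen_comp]

theorem upSub_comp_upRen (ρ : ℕ → ℕ) (σ : ℕ → Tm) : upSub σ ∘ upRen ρ = upSub (σ ∘ ρ) := by
  funext n; cases n <;> rfl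

theorem subst_rename (t : Tm) (ρ : ℕ → ℕ) (σ : ℕ → Tm) :
    (t.rename ρ).subst σ = t.subst (σ ∘ ρ) := by
  induction t generalizing ρ σ <;> simp_all [rename, subst, upSub_comp_upRen]

theorem rename_comp_upSub (σ : ℕ → Tm) (ρ : ℕ → ℕ) :
    rename (upRen ρ) ∘ upSub σ = upSub (rename ρ ∘ σ) := by
  funext n
  cases n with
  | zero => rfl
  | succ n => simp [upSub, wk, rename_rename]; rfl

theorem rename_subst (t : Tm) (σ : ℕ → Tm) (ρ : ℕ → ℕ) :
    (t.subst σ).rename ρ = t.subst (rename ρ ∘ σ) := by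
  induction t generalizing ρ σ <;> simp_all [rename, subst, rename_comp_upSub]

theorem subst_comp_upSub (σ τ : ℕ → Tm) :
    subst (upSub τ) ∘ upSub σ = upSub (subst τ ∘ σ) := by
  funext n
  cases n with
  | zero => rfl
  | succ n => simp [upSub, wk, rename_subst, subst_rename]; rfl

theorem subst_subst (t : Tm) (σ τ : ℕ → Tm) :
    (t.subst σ).subst τ = t.subst (subst τ ∘ σ) := by
  induction t generalizing σ τ <;> simp_all [subst, subst_comp_upSub]

theorem upSub_var : upSub var = var := by
  funext n; cases n <;> rfl

@[simp] theorem subst_var (t : Tm) : t.subst var = t := by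
  induction t <;> simp_all [subst, upSub_var]

theorem upSub_var_comp (ρ : ℕ → ℕ) : upSub (var ∘ ρ) = var ∘ upRen ρ := by
  funext n; cases n <;> rfl

theorem rename_eq_subst (t : Tm) (ρ : ℕ → ℕ) : t.rename ρ = t.subst (var ∘ ρ) := by
  induction t generalizing ρ <;> simp_all [subst, rename, upSub_var_comp]

theorem inst_rename (B a : Tm) (ρ : ℕ → ℕ) :
    (B.inst a).rename ρ = (B.rename (upRen ρ)).inst (a.rename ρ) := by
  simp only [inst, rename_subst, subst_rename]
  congr 1; funext n; cases n <;> rfl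

theorem inst_subst (B a : Tm) (σ : ℕ → Tm) :
    (B.inst a).subst σ = (B.subst (upSub σ)).inst (a.subst σ) := by
  simp only [inst, subst_subst]
  congr 1; funext n
  cases n with
  | zero => rfl
  | succ n =>
    simp only [Function.comp_apply, single, upSub, wk, subst_rename, subst]
    exact (subst_var _).symm

theorem wk_rename (A : Tm) (ρ : ℕ → ℕ) : A.wk.rename (upRen ρ) = (A.rename ρ).wk := by
  simp only [wk, rename_rename]; rfl

theorem wk_subst (A : Tm) (σ : ℕ → Tm) : A.wk.subst (upSub σ) = (A.subst σ).wk := by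
  simp only [wk, rename_subst, subst_rename]; rfl

@[simp] theorem wk_inst (A a : Tm) : A.wk.inst a = A := by
  simp only [wk, inst, subst_rename]
  exact subst_var A

/-- All variables of the term are below the given bound. -/
def closedAt : ℕ → Tm → Bool
  | k, var n => Nat.blt n k
  | _, univ _ => true
  | k, pi A B => closedAt k A && closedAt (k + 1) B
  | k, lam A b => closedAt k A && closedAt (k + 1) b
  | k, app f a => closedAt k f && closedAt k a
  | _, const _ => true

theorem subst_of_closedAt (t : Tm) (k : ℕ) (h : t.closedAt k = true) (σ : ℕ → Tm)
    (hσ : ∀ n < k, σ n = var n) : t.subst σ = t := by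
  have up : ∀ (k : ℕ) (σ : ℕ → Tm), (∀ n < k, σ n = var n) → ∀ n < k + 1, upSub σ n = var n := by
    intro k σ hσ n hn
    cases n with
    | zero => rfl
    | succ n => simp only [upSub, hσ n (by omega)]; rfl
  induction t generalizing k σ with
  | var n => exact hσ n (by simpa [closedAt, Nat.blt_eq] using h)
  | univ i => rfl
  | const c => rfl
  | pi A B ihA ihB | lam A B ihA ihB =>
    simp only [closedAt, Bool.and_eq_true] at h
    simp only [subst, ihA k h.1 σ hσ, ihB (k + 1) h.2 _ (up k σ hσ)]
  | app f a ihf iha =>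
    simp only [closedAt, Bool.and_eq_true] at h
    simp only [subst, ihf k h.1 σ hσ, iha k h.2 σ hσ]

theorem subst_closed {t : Tm} (h : t.closedAt 0 = true) (σ : ℕ → Tm) : t.subst σ = t :=
  subst_of_closedAt t 0 h σ (by simp)

theorem rename_closed {t : Tm} (h : t.closedAt 0 = true) (ρ : ℕ → ℕ) : t.rename ρ = t := by
  rw [rename_eq_subst, subst_closed h]

end Tm

theorem Const.type_closed (c : Const) (i j : ℕ) : (c.type i j).closed.closedAt 0 = true := by
  cases c with
  | defined d => cases d <;> rfl
  | _ => rfl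

theorem Comp.rule_closed (c : Comp) (i j : ℕ) :
    (c.rule i j).1.closed.closedAt 0 = true ∧ (c.rule i j).2.1.closed.closedAt 0 = true ∧
      (c.rule i j).2.2.closed.closedAt 0 = true := by
  cases c with
  | defined d => cases d <;> exact ⟨rfl, rfl, rfl⟩
  | _ => exact ⟨rfl, rfl, rfl⟩

/-! ## Admissible rules -/

/-- `Γ ⊢ a : A`. -/
abbrev Typ (Γ : Ctx) (a A : Tm) : Prop := Derivable (.typ Γ a A)

/-- `Γ ⊢ a ≡ b : A`. -/
abbrev Eqv (Γ : Ctx) (a b A : Tm) : Prop := Derivable (.eq Γ a b A)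

/-- `Γ ctx`. -/
abbrev Wf (Γ : Ctx) : Prop := Derivable (.ctx Γ)

/-- A substitution of variables by variables that respects the types. -/
def IsRenaming (Γ Δ : Ctx) (ρ : ℕ → ℕ) : Prop :=
  ∀ n A, Lookup Γ n A → Lookup Δ (ρ n) (A.rename ρ)

theorem IsRenaming.up {Γ Δ : Ctx} {ρ : ℕ → ℕ} (h : IsRenaming Γ Δ ρ) (A : Tm) :
    IsRenaming (A :: Γ) (A.rename ρ :: Δ) (Tm.upRen ρ) := by
  intro n B hB
  cases hB with
  | zero => rw [Tm.wk_rename]; exact .zero _ _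
  | succ _ n B _ hB => rw [Tm.wk_rename]; exact .succ _ _ _ _ (h _ _ hB)

/-- Every type in the context remains a type under renamings. -/
def RenamesCtx : Ctx → Prop
  | [] => True
  | A :: Γ => (∃ i, ∀ Δ ρ, Wf Δ → IsRenaming Γ Δ ρ → Typ Δ (A.rename ρ) (.univ i)) ∧ RenamesCtx Γ

/-- The judgment is stable under renaming, and so are the types in its context. -/
def Renames : Judgment → Prop
  | .ctx Γ => RenamesCtx Γ
  | .typ Γ a A => RenamesCtx Γ ∧
      ∀ Δ ρ, Wf Δ → IsRenaming Γ Δ ρ → Typ Δ (a.rename ρ) (A.rename ρ)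
  | .eq Γ a b A => RenamesCtx Γ ∧
      ∀ Δ ρ, Wf Δ → IsRenaming Γ Δ ρ → Eqv Δ (a.rename ρ) (b.rename ρ) (A.rename ρ)

/-- Rules such as `lam` and `beta` extend the context by `A` without a premise that `A` is a type,
whereas the renamed context must be well formed again. The induction therefore carries along that
the types of the context stay types. -/
theorem Derivable.renames {J : Judgment} (h : Derivable J) : Renames J := by
  induction h with
  | ctxNil => trivial
  | ctxCons Γ A i _ ih => exact ⟨⟨i, ih.2⟩, ih.1⟩
  | var Γ n A _ hn ih => exact ⟨ih, fun Δ ρ hΔ hρ => .var _ _ _ hΔ (hρ _ _ hn)⟩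
  | const Γ c i j _ ih =>
    refine ⟨ih, fun Δ ρ hΔ hρ => ?_⟩
    rw [Tm.rename_closed (c.type_closed i j)]
    exact .const _ _ _ _ hΔ
  | univ Γ i _ ih => exact ⟨ih, fun Δ ρ hΔ _ => .univ _ _ hΔ⟩
  | cumul Γ A i _ ih => exact ⟨ih.1, fun Δ ρ hΔ hρ => .cumul _ _ _ (ih.2 Δ ρ hΔ hρ)⟩
  | pi Γ A B i _ _ ihA ihB =>
    refine ⟨ihA.1, fun Δ ρ hΔ hρ => ?_⟩
    have hA := ihA.2 Δ ρ hΔ hρ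
    exact .pi _ _ _ _ hA (ihB.2 _ _ (.ctxCons _ _ _ hA) (hρ.up A))
  | lam Γ A B b _ ih =>
    obtain ⟨⟨⟨i, hA⟩, hΓ⟩, ih⟩ := ih
    exact ⟨hΓ, fun Δ ρ hΔ hρ =>
      .lam _ _ _ _ (ih _ _ (.ctxCons _ _ _ (hA Δ ρ hΔ hρ)) (hρ.up A))⟩
  | app Γ A B f a _ _ ihf iha =>
    refine ⟨ihf.1, fun Δ ρ hΔ hρ => ?_⟩
    rw [Tm.inst_rename]
    exact .app _ _ _ _ _ (ihf.2 Δ ρ hΔ hρ) (iha.2 Δ ρ hΔ hρ)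
  | conv Γ a A B i _ _ iha ihe =>
    exact ⟨iha.1, fun Δ ρ hΔ hρ => .conv _ _ _ _ i (iha.2 Δ ρ hΔ hρ) (ihe.2 Δ ρ hΔ hρ)⟩
  | eqRefl Γ a A _ ih => exact ⟨ih.1, fun Δ ρ hΔ hρ => .eqRefl _ _ _ (ih.2 Δ ρ hΔ hρ)⟩
  | eqSymm Γ a b A _ ih => exact ⟨ih.1, fun Δ ρ hΔ hρ => .eqSymm _ _ _ _ (ih.2 Δ ρ hΔ hρ)⟩
  | eqTrans Γ a b c A _ _ ih ih' =>
    exact ⟨ih.1, fun Δ ρ hΔ hρ => .eqTrans _ _ _ _ _ (ih.2 Δ ρ hΔ hρ) (ih'.2 Δ ρ hΔ hρ)⟩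
  | eqConv Γ a b A B i _ _ ih ih' =>
    exact ⟨ih.1, fun Δ ρ hΔ hρ => .eqConv _ _ _ _ _ i (ih.2 Δ ρ hΔ hρ) (ih'.2 Δ ρ hΔ hρ)⟩
  | eqCumul Γ A B i _ ih => exact ⟨ih.1, fun Δ ρ hΔ hρ => .eqCumul _ _ _ _ (ih.2 Δ ρ hΔ hρ)⟩
  | eqPi Γ A A' B B' i _ _ ihA ihB =>
    obtain ⟨⟨⟨k, hA⟩, hΓ⟩, ihB⟩ := ihB
    exact ⟨hΓ, fun Δ ρ hΔ hρ => .eqPi _ _ _ _ _ _ (ihA.2 Δ ρ hΔ hρ)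
      (ihB _ _ (.ctxCons _ _ _ (hA Δ ρ hΔ hρ)) (hρ.up A))⟩
  | eqLam Γ A A' B b b' i _ _ ihA ihB =>
    obtain ⟨⟨⟨k, hA⟩, hΓ⟩, ihB⟩ := ihB
    exact ⟨hΓ, fun Δ ρ hΔ hρ => .eqLam _ _ _ _ _ _ i (ihA.2 Δ ρ hΔ hρ)
      (ihB _ _ (.ctxCons _ _ _ (hA Δ ρ hΔ hρ)) (hρ.up A))⟩
  | eqApp Γ A B f f' a a' _ _ ihf iha =>
    refine ⟨ihf.1, fun Δ ρ hΔ hρ => ?_⟩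
    rw [Tm.inst_rename]
    exact .eqApp _ _ _ _ _ _ _ (ihf.2 Δ ρ hΔ hρ) (iha.2 Δ ρ hΔ hρ)
  | beta Γ A B b a _ _ ihb iha =>
    obtain ⟨⟨⟨k, hA⟩, hΓ⟩, ihb⟩ := ihb
    refine ⟨hΓ, fun Δ ρ hΔ hρ => ?_⟩
    rw [Tm.inst_rename, Tm.inst_rename]
    exact .beta _ _ _ _ _ (ihb _ _ (.ctxCons _ _ _ (hA Δ ρ hΔ hρ)) (hρ.up A)) (iha.2 Δ ρ hΔ hρ)
  | eta Γ A B f _ ih =>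
    refine ⟨ih.1, fun Δ ρ hΔ hρ => ?_⟩
    have := Derivable.eta _ _ _ _ (ih.2 Δ ρ hΔ hρ)
    simpa only [Tm.rename, Tm.wk_rename, Tm.upRen] using this
  | comp Γ c i j _ ih =>
    refine ⟨ih, fun Δ ρ hΔ _ => ?_⟩
    obtain ⟨h1, h2, h3⟩ := c.rule_closed i j
    rw [Tm.rename_closed h1, Tm.rename_closed h2, Tm.rename_closed h3]
    exact .comp _ _ _ _ hΔ

theorem IsRenaming.succ (Γ : Ctx) (A : Tm) : IsRenaming Γ (A :: Γ) Nat.succ :=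
  fun _ _ h => .succ _ _ _ _ h

theorem Typ.weaken {Γ : Ctx} {a A B : Tm} (h : Typ Γ a A) (hB : Wf (B :: Γ)) :
    Typ (B :: Γ) a.wk A.wk :=
  h.renames.2 _ _ hB (.succ Γ B)

/-- A substitution that respects the types. -/
def IsSubst (Γ Δ : Ctx) (σ : ℕ → Tm) : Prop :=
  ∀ n A, Lookup Γ n A → Typ Δ (σ n) (A.subst σ)

theorem IsSubst.up {Γ Δ : Ctx} {σ : ℕ → Tm} (h : IsSubst Γ Δ σ) {A : Tm}
    (hA : Wf (A.subst σ :: Δ)) : IsSubst (A :: Γ) (A.subst σ :: Δ) (Tm.upSub σ) := by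
  intro n B hB
  cases hB with
  | zero => rw [Tm.wk_subst]; exact .var _ _ _ hA (.zero _ _)
  | succ _ n B _ hB => rw [Tm.wk_subst]; exact (h _ _ hB).weaken hA

/-- Every type in the context remains a type under substitutions. -/
def SubstsCtx : Ctx → Prop
  | [] => True
  | A :: Γ => (∃ i, ∀ Δ σ, Wf Δ → IsSubst Γ Δ σ → Typ Δ (A.subst σ) (.univ i)) ∧ SubstsCtx Γ

/-- The judgment is stable under substitution, and so are the types in its context. -/
def Substs : Judgment → Prop
  | .ctx Γ => SubstsCtx Γ
  | .typ Γ a A => SubstsCtx Γ ∧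
      ∀ Δ σ, Wf Δ → IsSubst Γ Δ σ → Typ Δ (a.subst σ) (A.subst σ)
  | .eq Γ a b A => SubstsCtx Γ ∧
      ∀ Δ σ, Wf Δ → IsSubst Γ Δ σ → Eqv Δ (a.subst σ) (b.subst σ) (A.subst σ)

/-- The same strengthened induction as for renamings. Renaming has to be settled before it, because
a substitution that passes under a binder has its entries weakened. -/
theorem Derivable.substs {J : Judgment} (h : Derivable J) : Substs J := by
  induction h with
  | ctxNil => trivial
  | ctxCons Γ A i _ ih => exact ⟨⟨i, ih.2⟩, ih.1⟩
  | var Γ n A _ hn ih => exact ⟨ih, fun Δ σ hΔ hσ => hσ _ _ hn⟩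
  | const Γ c i j _ ih =>
    refine ⟨ih, fun Δ σ hΔ hσ => ?_⟩
    rw [Tm.subst_closed (c.type_closed i j)]
    exact .const _ _ _ _ hΔ
  | univ Γ i _ ih => exact ⟨ih, fun Δ σ hΔ _ => .univ _ _ hΔ⟩
  | cumul Γ A i _ ih => exact ⟨ih.1, fun Δ σ hΔ hσ => .cumul _ _ _ (ih.2 Δ σ hΔ hσ)⟩
  | pi Γ A B i _ _ ihA ihB =>
    refine ⟨ihA.1, fun Δ σ hΔ hσ => ?_⟩
    have hA := ihA.2 Δ σ hΔ hσ
    have hW : Wf (A.subst σ :: Δ) := .ctxCons _ _ _ hA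
    exact .pi _ _ _ _ hA (ihB.2 _ _ hW (hσ.up hW))
  | lam Γ A B b _ ih =>
    obtain ⟨⟨⟨i, hA⟩, hΓ⟩, ih⟩ := ih
    refine ⟨hΓ, fun Δ σ hΔ hσ => ?_⟩
    have hW : Wf (A.subst σ :: Δ) := .ctxCons _ _ _ (hA Δ σ hΔ hσ)
    exact .lam _ _ _ _ (ih _ _ hW (hσ.up hW))
  | app Γ A B f a _ _ ihf iha =>
    refine ⟨ihf.1, fun Δ σ hΔ hσ => ?_⟩
    rw [Tm.inst_subst]
    exact .app _ _ _ _ _ (ihf.2 Δ σ hΔ hσ) (iha.2 Δ σ hΔ hσ)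
  | conv Γ a A B i _ _ iha ihe =>
    exact ⟨iha.1, fun Δ σ hΔ hσ => .conv _ _ _ _ i (iha.2 Δ σ hΔ hσ) (ihe.2 Δ σ hΔ hσ)⟩
  | eqRefl Γ a A _ ih => exact ⟨ih.1, fun Δ σ hΔ hσ => .eqRefl _ _ _ (ih.2 Δ σ hΔ hσ)⟩
  | eqSymm Γ a b A _ ih => exact ⟨ih.1, fun Δ σ hΔ hσ => .eqSymm _ _ _ _ (ih.2 Δ σ hΔ hσ)⟩
  | eqTrans Γ a b c A _ _ ih ih' =>
    exact ⟨ih.1, fun Δ σ hΔ hσ => .eqTrans _ _ _ _ _ (ih.2 Δ σ hΔ hσ) (ih'.2 Δ σ hΔ hσ)⟩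
  | eqConv Γ a b A B i _ _ ih ih' =>
    exact ⟨ih.1, fun Δ σ hΔ hσ => .eqConv _ _ _ _ _ i (ih.2 Δ σ hΔ hσ) (ih'.2 Δ σ hΔ hσ)⟩
  | eqCumul Γ A B i _ ih => exact ⟨ih.1, fun Δ σ hΔ hσ => .eqCumul _ _ _ _ (ih.2 Δ σ hΔ hσ)⟩
  | eqPi Γ A A' B B' i _ _ ihA ihB =>
    obtain ⟨⟨⟨k, hA⟩, hΓ⟩, ihB⟩ := ihB
    refine ⟨hΓ, fun Δ σ hΔ hσ => ?_⟩
    have hW : Wf (A.subst σ :: Δ) := .ctxCons _ _ _ (hA Δ σ hΔ hσ)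
    exact .eqPi _ _ _ _ _ _ (ihA.2 Δ σ hΔ hσ) (ihB _ _ hW (hσ.up hW))
  | eqLam Γ A A' B b b' i _ _ ihA ihB =>
    obtain ⟨⟨⟨k, hA⟩, hΓ⟩, ihB⟩ := ihB
    refine ⟨hΓ, fun Δ σ hΔ hσ => ?_⟩
    have hW : Wf (A.subst σ :: Δ) := .ctxCons _ _ _ (hA Δ σ hΔ hσ)
    exact .eqLam _ _ _ _ _ _ i (ihA.2 Δ σ hΔ hσ) (ihB _ _ hW (hσ.up hW))
  | eqApp Γ A B f f' a a' _ _ ihf iha =>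
    refine ⟨ihf.1, fun Δ σ hΔ hσ => ?_⟩
    rw [Tm.inst_subst]
    exact .eqApp _ _ _ _ _ _ _ (ihf.2 Δ σ hΔ hσ) (iha.2 Δ σ hΔ hσ)
  | beta Γ A B b a _ _ ihb iha =>
    obtain ⟨⟨⟨k, hA⟩, hΓ⟩, ihb⟩ := ihb
    refine ⟨hΓ, fun Δ σ hΔ hσ => ?_⟩
    have hW : Wf (A.subst σ :: Δ) := .ctxCons _ _ _ (hA Δ σ hΔ hσ)
    rw [Tm.inst_subst, Tm.inst_subst]
    exact .beta _ _ _ _ _ (ihb _ _ hW (hσ.up hW)) (iha.2 Δ σ hΔ hσ)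
  | eta Γ A B f _ ih =>
    refine ⟨ih.1, fun Δ σ hΔ hσ => ?_⟩
    have := Derivable.eta _ _ _ _ (ih.2 Δ σ hΔ hσ)
    simpa only [Tm.subst, Tm.wk_subst, Tm.upSub] using this
  | comp Γ c i j _ ih =>
    refine ⟨ih, fun Δ σ hΔ _ => ?_⟩
    obtain ⟨h1, h2, h3⟩ := c.rule_closed i j
    rw [Tm.subst_closed h1, Tm.subst_closed h2, Tm.subst_closed h3]
    exact .comp _ _ _ _ hΔ

theorem Typ.subst {Γ Δ : Ctx} {a A : Tm} {σ : ℕ → Tm} (h : Typ Γ a A) (hΔ : Wf Δ)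
    (hσ : IsSubst Γ Δ σ) : Typ Δ (a.subst σ) (A.subst σ) :=
  h.substs.2 _ _ hΔ hσ

theorem Eqv.subst {Γ Δ : Ctx} {a b A : Tm} {σ : ℕ → Tm} (h : Eqv Γ a b A) (hΔ : Wf Δ)
    (hσ : IsSubst Γ Δ σ) : Eqv Δ (a.subst σ) (b.subst σ) (A.subst σ) :=
  h.substs.2 _ _ hΔ hσ

/-- The context of a judgment. -/
def Judgment.context : Judgment → Ctx
  | .ctx Γ => Γ
  | .typ Γ _ _ => Γ
  | .eq Γ _ _ _ => Γ

/-- All final segments of the context are derivable. -/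
def WfTails : Ctx → Prop
  | [] => True
  | _ :: Γ => Wf Γ ∧ WfTails Γ

/-- The conclusion of `lam` lives in the tail of the context of its premise, so the induction has to
know about all tails. -/
theorem Derivable.wf_tails {J : Judgment} (h : Derivable J) :
    Wf J.context ∧ WfTails J.context := by
  induction h with
  | ctxNil => exact ⟨.ctxNil, trivial⟩
  | ctxCons Γ A i h ih => exact ⟨.ctxCons _ _ _ h, ih⟩
  | lam _ _ _ _ _ ih => exact ih.2
  | _ => assumption

theorem Derivable.wf {J : Judgment} (h : Derivable J) : Wf J.context := h.wf_tails.1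

theorem Wf.tail {A : Tm} {Γ : Ctx} (h : Wf (A :: Γ)) : Wf Γ := h.wf_tails.2.1

theorem Wf.head {A : Tm} {Γ : Ctx} (h : Wf (A :: Γ)) : ∃ i, Typ Γ A (.univ i) := by
  cases h with
  | ctxCons _ _ i h => exact ⟨i, h⟩

theorem Typ.wf {Γ : Ctx} {a A : Tm} (h : Typ Γ a A) : Wf Γ := Derivable.wf h

theorem Typ.cons_wf {Γ : Ctx} {A : Tm} {i : ℕ} (h : Typ Γ A (.univ i)) : Wf (A :: Γ) :=
  .ctxCons _ _ _ h

theorem IsSubst.single {Γ : Ctx} {a A : Tm} (h : Typ Γ a A) :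
    IsSubst (A :: Γ) Γ (Tm.single a) := by
  intro n B hB
  cases hB with
  | zero =>
    rw [← Tm.inst, Tm.wk_inst]
    exact h
  | succ _ n B _ hB =>
    rw [← Tm.inst, Tm.wk_inst]
    exact .var _ _ _ h.wf hB

theorem Typ.inst {Γ : Ctx} {a A b B : Tm} (hb : Typ (A :: Γ) b B) (ha : Typ Γ a A) :
    Typ Γ (b.inst a) (B.inst a) :=
  hb.subst ha.wf (.single ha)

/-- There is no rule that substitutes equal terms into a type. Both instances are β-expanded to
applications of `λ (x : A), B`, for which `eqApp` is available. -/
theorem Eqv.inst_arg {Γ : Ctx} {a a' A B : Tm} {i : ℕ} (hB : Typ (A :: Γ) B (.univ i))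
    (ha : Typ Γ a A) (ha' : Typ Γ a' A) (h : Eqv Γ a a' A) :
    Eqv Γ (B.inst a) (B.inst a') (.univ i) :=
  .eqTrans _ _ _ _ _ (.eqSymm _ _ _ _ (.beta _ _ _ _ _ hB ha))
    (.eqTrans _ _ _ _ _
      (.eqApp _ _ _ _ _ _ _ (.eqRefl _ _ _ (.lam _ _ _ _ hB)) h)
      (.beta _ _ _ _ _ hB ha'))

/-- The identity substitution is well typed between contexts whose first types are judgmentally
equal, since the variable `0` can be converted. -/
theorem IsSubst.conv_head {Γ : Ctx} {A A' : Tm} {i : ℕ} (hA : Typ Γ A' (.univ i))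
    (h : Eqv Γ A' A (.univ i)) : IsSubst (A :: Γ) (A' :: Γ) Tm.var := by
  intro n B hB
  rw [Tm.subst_var]
  cases hB with
  | zero =>
    exact .conv _ _ _ _ i (.var _ _ _ hA.cons_wf (.zero _ _))
      (h.renames.2 _ _ hA.cons_wf (.succ Γ A'))
  | succ _ n B _ hB => exact .var _ _ _ hA.cons_wf (.succ _ _ _ _ hB)

theorem Typ.conv_head {Γ : Ctx} {A A' b B : Tm} {i : ℕ} (hb : Typ (A :: Γ) b B)
    (hA : Typ Γ A' (.univ i)) (h : Eqv Γ A' A (.univ i)) : Typ (A' :: Γ) b B := by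
  simpa using hb.subst hA.cons_wf (.conv_head hA h)

theorem Eqv.conv_head {Γ : Ctx} {A A' b b' B : Tm} {i : ℕ} (hb : Eqv (A :: Γ) b b' B)
    (hA : Typ Γ A' (.univ i)) (h : Eqv Γ A' A (.univ i)) : Eqv (A' :: Γ) b b' B := by
  simpa using hb.subst hA.cons_wf (.conv_head hA h)

/-- Only `pi`, `cumul` and `conv` conclude a typing of a function type, and the last two leave the
term unchanged. Injectivity of function types is not needed. -/
theorem Typ.pi_inv {Γ : Ctx} {A B T : Tm} (h : Typ Γ (.pi A B) T) :
    ∃ i, Typ Γ A (.univ i) ∧ Typ (A :: Γ) B (.univ i) := by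
  have key : ∀ J, Derivable J → ∀ T, J = .typ Γ (.pi A B) T →
      ∃ i, Typ Γ A (.univ i) ∧ Typ (A :: Γ) B (.univ i) := by
    intro J h
    induction h with
    | pi Γ A B i hA hB => intro T hJ; cases hJ; exact ⟨i, hA, hB⟩
    | cumul Γ A i _ ih => intro T hJ; cases hJ; exact ih _ rfl
    | conv Γ a A B i _ _ ih => intro T hJ; cases hJ; exact ih _ rfl
    | _ => intro T hJ; cases hJ
  exact key _ h _ rfl

theorem Typ.cumul_le {Γ : Ctx} {A : Tm} {i j : ℕ} (h : Typ Γ A (.univ i)) (hij : i ≤ j) :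
    Typ Γ A (.univ j) := by
  induction hij with
  | refl => exact h
  | step _ ih => exact .cumul _ _ _ ih

theorem Eqv.cumul_le {Γ : Ctx} {A B : Tm} {i j : ℕ} (h : Eqv Γ A B (.univ i)) (hij : i ≤ j) :
    Eqv Γ A B (.univ j) := by
  induction hij with
  | refl => exact h
  | step _ ih => exact .eqCumul _ _ _ _ ih

/-! ## Raising universe levels -/

/-- Add `k` to the level of a constant. -/
def Const.raise (k : ℕ) : Const → Const
  | .univalence i => .univalence (i + k)
  | c => c

/-- Add `k` to all universe levels. -/
def Tm.raise (k : ℕ) : Tm → Tm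
  | var n => var n
  | univ i => univ (i + k)
  | pi A B => pi (raise k A) (raise k B)
  | lam A b => lam (raise k A) (raise k b)
  | app f a => app (raise k f) (raise k a)
  | const c => const (c.raise k)

theorem Tm.raise_rename (k : ℕ) (t : Tm) (ρ : ℕ → ℕ) :
    (t.rename ρ).raise k = (t.raise k).rename ρ := by
  induction t generalizing ρ <;> simp_all [rename, raise]

theorem Tm.raise_subst (k : ℕ) (t : Tm) (σ : ℕ → Tm) :
    (t.subst σ).raise k = (t.raise k).subst (raise k ∘ σ) := by
  have up : ∀ σ : ℕ → Tm, raise k ∘ upSub σ = upSub (raise k ∘ σ) := by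
    intro σ
    funext n
    cases n with
    | zero => rfl
    | succ n => exact raise_rename k _ _
  induction t generalizing σ <;> simp_all [subst, raise]

theorem Tm.raise_inst (k : ℕ) (b a : Tm) :
    (b.inst a).raise k = (b.raise k).inst (a.raise k) := by
  rw [inst, raise_subst, inst]
  congr 1; funext n; cases n <;> rfl

theorem Const.raise_type (k : ℕ) (c : Const) (i j : ℕ) :
    (c.type i j).closed.raise k = ((c.raise k).type (i + k) (j + k)).closed := by
  cases c with
  | defined d => cases d <;> rfl
  | _ => rfl

theorem Comp.raise_rule (k : ℕ) (c : Comp) (i j : ℕ) :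
    (c.rule i j).1.closed.raise k = (c.rule (i + k) (j + k)).1.closed ∧
    (c.rule i j).2.1.closed.raise k = (c.rule (i + k) (j + k)).2.1.closed ∧
    (c.rule i j).2.2.closed.raise k = (c.rule (i + k) (j + k)).2.2.closed := by
  cases c with
  | defined d => cases d <;> exact ⟨rfl, rfl, rfl⟩
  | _ => exact ⟨rfl, rfl, rfl⟩

theorem Lookup.raise (k : ℕ) {Γ : Ctx} {n : ℕ} {A : Tm} (h : Lookup Γ n A) :
    Lookup (Γ.map (Tm.raise k)) n (A.raise k) := by
  induction h with
  | zero Γ A => rw [Tm.wk, Tm.raise_rename]; exact .zero _ _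
  | succ Γ n A B _ ih => rw [Tm.wk, Tm.raise_rename]; exact .succ _ _ _ _ ih

/-- Add `k` to all universe levels. -/
def Judgment.raise (k : ℕ) : Judgment → Judgment
  | .ctx Γ => .ctx (Γ.map (Tm.raise k))
  | .typ Γ a A => .typ (Γ.map (Tm.raise k)) (a.raise k) (A.raise k)
  | .eq Γ a b A => .eq (Γ.map (Tm.raise k)) (a.raise k) (b.raise k) (A.raise k)

/-- All rules are uniform in the levels: raising the type of a constant or a computation rule gives
the same type or rule at raised levels. This reduces the theorem to the universe `U 0`. -/
theorem Derivable.raise (k : ℕ) {J : Judgment} (h : Derivable J) : Derivable (J.raise k) := by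
  induction h with
  | ctxNil => exact .ctxNil
  | ctxCons Γ A i _ ih => exact .ctxCons _ _ _ ih
  | var Γ n A _ hn ih => exact .var _ _ _ ih (hn.raise k)
  | const Γ c i j _ ih =>
    simp only [Judgment.raise, Const.raise_type]
    exact .const _ _ _ _ ih
  | univ Γ i _ ih =>
    simp only [Judgment.raise, Tm.raise, Nat.add_right_comm i 1 k]
    exact .univ _ _ ih
  | cumul Γ A i _ ih =>
    simp only [Judgment.raise, Tm.raise, Nat.add_right_comm i 1 k]
    exact .cumul _ _ _ ih
  | pi Γ A B i _ _ ihA ihB => exact .pi _ _ _ _ ihA ihB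
  | lam Γ A B b _ ih => exact .lam _ _ _ _ ih
  | app Γ A B f a _ _ ihf iha =>
    simp only [Judgment.raise, Tm.raise_inst]
    exact .app _ _ _ _ _ ihf iha
  | conv Γ a A B i _ _ iha ihe => exact .conv _ _ _ _ _ iha ihe
  | eqRefl Γ a A _ ih => exact .eqRefl _ _ _ ih
  | eqSymm Γ a b A _ ih => exact .eqSymm _ _ _ _ ih
  | eqTrans Γ a b c A _ _ ih ih' => exact .eqTrans _ _ _ _ _ ih ih'
  | eqConv Γ a b A B i _ _ ih ih' => exact .eqConv _ _ _ _ _ _ ih ih'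
  | eqCumul Γ A B i _ ih =>
    simp only [Judgment.raise, Tm.raise, Nat.add_right_comm i 1 k]
    exact .eqCumul _ _ _ _ ih
  | eqPi Γ A A' B B' i _ _ ihA ihB => exact .eqPi _ _ _ _ _ _ ihA ihB
  | eqLam Γ A A' B b b' i _ _ ihA ihB => exact .eqLam _ _ _ _ _ _ _ ihA ihB
  | eqApp Γ A B f f' a a' _ _ ihf iha =>
    simp only [Judgment.raise, Tm.raise_inst]
    exact .eqApp _ _ _ _ _ _ _ ihf iha
  | beta Γ A B b a _ _ ihb iha =>
    simp only [Judgment.raise, Tm.raise_inst]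
    exact .beta _ _ _ _ _ ihb iha
  | eta Γ A B f _ ih =>
    simp only [Judgment.raise, Tm.raise, Tm.wk, Tm.raise_rename]
    exact .eta _ _ _ _ ih
  | comp Γ c i j _ ih =>
    obtain ⟨h1, h2, h3⟩ := c.raise_rule k i j
    simp only [Judgment.raise, h1, h2, h3]
    exact .comp _ _ _ _ ih

end HoTT

namespace HoTT

/-! ## Executable operations on terms -/

namespace Tm

/-- Add `d` to the variables from `c` on. -/
def lift (d : ℕ) : Tm → ℕ → Tm
  | var n, c => var (cond (Nat.blt n c) n (Nat.add n d))
  | univ i, _ => univ i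
  | pi A B, c => pi (lift d A c) (lift d B c.succ)
  | lam A b, c => lam (lift d A c) (lift d b c.succ)
  | app f a, c => app (lift d f c) (lift d a c)
  | const k, _ => const k

theorem lift_eq_rename (d : ℕ) (t : Tm) (c : ℕ) :
    t.lift d c = t.rename (fun n => cond (Nat.blt n c) n (Nat.add n d)) := by
  have up : ∀ c, upRen (fun n => cond (Nat.blt n c) n (Nat.add n d)) =
      fun n => cond (Nat.blt n c.succ) n (Nat.add n d) := by
    intro c
    funext n
    cases n with
    | zero => simp [upRen, Nat.blt, Nat.ble]
    | succ n =>
      simp only [upRen, show Nat.blt (n + 1) c.succ = Nat.blt n c from rfl]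
      cases Nat.blt n c with
      | true => rfl
      | false => exact Nat.add_right_comm n d 1
  induction t generalizing c <;> simp_all [lift, rename]

/-- The entry of a list, lifted by `d`; beyond the list, a variable. -/
def entry (d : ℕ) : List Tm → ℕ → Tm
  | [], n => var (Nat.add n d)
  | a :: σ, n => n.casesOn (cond (Nat.beq d 0) a (lift d a 0)) (fun n => entry d σ n)

/-- Replace the first variables from `d` on by the entries of a list. -/
def substL (σ : List Tm) : Tm → ℕ → Tm
  | var n, d => cond (Nat.blt n d) (var n) (entry d σ (Nat.sub n d))
  | univ i, _ => univ i
  | pi A B, d => pi (substL σ A d) (substL σ B d.succ)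
  | lam A b, d => lam (substL σ A d) (substL σ b d.succ)
  | app f a, d => app (substL σ f d) (substL σ a d)
  | const k, _ => const k

/-- The substitution given by a list. -/
def ofList : List Tm → ℕ → Tm
  | [], n => var n
  | a :: _, 0 => a
  | _ :: σ, n + 1 => ofList σ n

/-- A substitution under `d` binders. -/
def upSubs (σ : ℕ → Tm) : ℕ → ℕ → Tm
  | 0 => σ
  | d + 1 => upSub (upSubs σ d)

theorem lift_zero (t : Tm) (c : ℕ) : t.lift 0 c = t := by
  rw [lift_eq_rename, rename_eq_subst]
  conv_rhs => rw [← subst_var t]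
  congr 1; funext n
  simp only [Function.comp]
  cases Nat.blt n c <;> rfl

theorem lift_zero_right (t : Tm) (d : ℕ) : t.lift d 0 = t.rename (fun n => n + d) := by
  rw [lift_eq_rename]; rfl

theorem entry_eq (d : ℕ) (σ : List Tm) (n : ℕ) :
    entry d σ n = (ofList σ n).rename (fun n => n + d) := by
  induction σ generalizing n with
  | nil => rfl
  | cons a σ ih =>
    cases n with
    | zero =>
      simp only [entry, ofList]
      cases h : Nat.beq d 0 with
      | false => exact lift_zero_right a d
      | true =>
        rw [Nat.eq_of_beq_eq_true h]
        exact ((lift_zero_right a 0).symm.trans (lift_zero a 0)).symm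
    | succ n => exact ih n

theorem upSubs_apply (σ : ℕ → Tm) (d n : ℕ) :
    upSubs σ d n = cond (Nat.blt n d) (var n) ((σ (n - d)).rename (fun n => n + d)) := by
  induction d generalizing n with
  | zero =>
    rw [show Nat.blt n 0 = false by simp [Nat.blt, Nat.ble]]
    simp only [cond_false, upSubs, rename_eq_subst]
    exact (subst_var (σ n)).symm
  | succ d ih =>
    cases n with
    | zero => rfl
    | succ n =>
      rw [upSubs, upSub, ih, show Nat.blt (n + 1) (d + 1) = Nat.blt n d from rfl,
        Nat.add_sub_add_right]
      cases Nat.blt n d with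
      | true => rfl
      | false => simp only [cond_false, wk, rename_rename]; rfl

/-- Connects the operation that the kernel evaluates, which counts binders, with the simultaneous
substitution for which the admissible rules are proved. -/
theorem substL_eq (σ : List Tm) (t : Tm) (d : ℕ) :
    t.substL σ d = t.subst (upSubs (ofList σ) d) := by
  induction t generalizing d with
  | var n =>
    rw [substL, entry_eq, subst, upSubs_apply]; rfl
  | _ => simp_all [substL, subst, upSubs]

/-- Simultaneous replacement of the first variables by the entries of a list. -/
def close (T : Tm) : List Tm → Tm
  | [] => T
  | a :: σ => T.substL (a :: σ) 0

theorem ofList_nil : ofList [] = var := rfl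

theorem close_eq (T : Tm) (σ : List Tm) : T.close σ = T.subst (ofList σ) := by
  cases σ with
  | nil => rw [ofList_nil, subst_var]; rfl
  | cons a σ => exact substL_eq _ _ _

theorem ofList_single (a : Tm) : ofList [a] = single a := by
  funext n; rcases n with _ | n <;> rfl

theorem substL_single (b a : Tm) : b.close [a] = b.inst a := by
  rw [close_eq, ofList_single, inst]

/-- The checker keeps types in the form `T[σ]` and, at an application, only puts the argument in
front of `σ`. This identity shows that doing so agrees with instantiating the codomain. -/
theorem subst_cons (B : Tm) (a : Tm) (σ : List Tm) :
    B.subst (ofList (a :: σ)) = (B.subst (upSub (ofList σ))).inst a := by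
  rw [inst, subst_subst]
  congr 1; funext n
  cases n with
  | zero => rfl
  | succ n => exact (wk_inst _ _).symm

end Tm

/-- An injective numbering of the constants, in which the constants in the type of a constant
come before it. -/
def Const.code : Const → ℕ
  | id => 0 | refl => 1 | idInd => 2 | sigma => 3 | pair => 4 | sigmaInd => 5 | empty => 6
   | emptyInd => 7 | unit => 8 | star => 9 | unitInd => 10 | sum => 11 | inl => 12 | inr => 13
   | sumInd => 14 | nat => 15 | zero => 16 | succ => 17 | natInd => 18 | list => 19 | nil => 20
   | cons => 21 | listInd => 22 | funext => 23 | trunc => 24 | truncMk => 25 | truncEq => 26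
   | truncInd => 27
  | defined d => match d with
    | .symm => 28 | .concat => 29 | .ap => 30 | .transport => 31 | .apd => 32 | .apdAlong => 33
     | .concatOver => 34 | .bar => 35 | .barBar => 36 | .append => 37 | .assoc => 38
  | N => 39 | eta => 40 | tau => 41 | tr => 42 | sw => 43 | ov => 44 | NInd => 45
   | univalence i => Nat.add (Nat.mul 2 i) 46 | NIndTau => 47

/-- The inverse of `Const.code`. -/
def Const.decode : ℕ → Const
  | 0 => .id | 1 => .refl | 2 => .idInd | 3 => .sigma | 4 => .pair | 5 => .sigmaInd
   | 6 => .empty | 7 => .emptyInd | 8 => .unit | 9 => .star | 10 => .unitInd | 11 => .sum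
   | 12 => .inl | 13 => .inr | 14 => .sumInd | 15 => .nat | 16 => .zero | 17 => .succ
   | 18 => .natInd | 19 => .list | 20 => .nil | 21 => .cons | 22 => .listInd | 23 => .funext
   | 24 => .trunc | 25 => .truncMk | 26 => .truncEq | 27 => .truncInd | 28 => .defined .symm
   | 29 => .defined .concat | 30 => .defined .ap | 31 => .defined .transport
   | 32 => .defined .apd | 33 => .defined .apdAlong | 34 => .defined .concatOver
   | 35 => .defined .bar | 36 => .defined .barBar | 37 => .defined .append
   | 38 => .defined .assoc | 39 => .N | 40 => .eta | 41 => .tau | 42 => .tr | 43 => .sw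
   | 44 => .ov | 45 => .NInd | 47 => .NIndTau | n => .univalence ((n - 46) / 2)

theorem Const.decode_code (c : Const) : decode c.code = c := by
  cases c with
  | defined d => cases d <;> rfl
  | univalence i =>
    change decode (2 * i + 46) = univalence i
    cases i with
    | zero => rfl
    | succ i =>
      -- At a positive level the code is at least `48` and even, so it misses the literal patterns
      -- of `decode`, among them the odd code `47`.
      rw [show 2 * (i + 1) + 46 = 2 * i + 48 by omega]
      change univalence ((2 * i + 48 - 46) / 2) = _
      congr 1; omega
  | _ => rfl

theorem Const.code_inj {c c' : Const} (h : c.code = c'.code) : c = c' := by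
  rw [← decode_code c, h, decode_code]

namespace Tm

/-- Equality test. -/
def beq : Tm → Tm → Bool
  | var n, var m => Nat.beq n m
  | univ n, univ m => Nat.beq n m
  | pi A B, pi A' B' => cond (beq A A') (beq B B') false
  | lam A B, lam A' B' => cond (beq A A') (beq B B') false
  | app A B, app A' B' => cond (beq A A') (beq B B') false
  | const c, const c' => Nat.beq c.code c'.code
  | _, _ => false

theorem eq_of_beq {t u : Tm} (h : t.beq u = true) : t = u := by
  induction t generalizing u with
  | var n => cases u <;> simp_all [beq]
  | univ n => cases u <;> simp_all [beq]
  | const c =>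
    cases u with
    | const c' => rw [Const.code_inj (Nat.eq_of_beq_eq_true h)]
    | _ => simp [beq] at h
  | pi A B ihA ihB | lam A B ihA ihB | app A B ihA ihB =>
    cases u <;> simp only [beq, Bool.cond_false_right, Bool.and_eq_true, reduceCtorEq] at h
    rw [ihA h.1, ihB h.2]

/-- `A` is `B`, or both are universes and the level of `A` is at most that of `B`. -/
def le : Tm → Tm → Bool
  | univ i, univ j => Nat.ble i j
  | A, B => beq A B

/-- The head of an application. -/
def head : Tm → Tm
  | app f _ => head f
  | t => t

/-- The arguments of an application, in front of the given list. -/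
def args : Tm → List Tm → List Tm
  | app f a, l => args f (a :: l)
  | _, l => l

/-- Whether the head of the term is a constructor. -/
def isCanonical : Tm → Bool
  | app f _ => isCanonical f
  | const c => match c with
    | .refl | .nil | .cons | .zero | .succ | .inl | .inr | .pair | .star | .truncMk | .eta => true
    | _ => false
  | _ => false

end Tm

/-- The position of the argument on which the computation rules of a constant depend. -/
def Const.major : Const → Option ℕ
  | sigmaInd | listInd | truncInd => some 4
  | sumInd | idInd => some 5
  | natInd => some 3
  | unitInd => some 2
  | NInd => some 7
  | defined d => match d with
    | .symm => some 3
    | .concat | .ap => some 5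
    | .transport => some 4
    | .append | .bar => some 1
    | _ => none
  | _ => none

/-- Whether the argument at the given position has a constructor as head. -/
def canonicalAt : List Tm → ℕ → Bool
  | [], _ => false
  | a :: l, n => n.casesOn a.isCanonical (fun n => canonicalAt l n)

/-- Whether the application of the term to the given arguments is free of redexes. -/
def Tm.isNormal : Tm → List Tm → Bool
  | var _, _ => true
  | univ _, _ => true
  | pi A B, _ => cond (A.isNormal []) (B.isNormal []) false
  | lam A b, l => match l with
    | [] => cond (A.isNormal []) (b.isNormal []) false
    | _ :: _ => false
  | app f a, l => cond (f.isNormal (a :: l)) (a.isNormal []) false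
  | const c, l => match c.major with
    | none => true
    | some n => not (canonicalAt l n)

/-! ## Levels -/

/-- The positions of the type arguments of a constant, in the form `n ↦ n < c.types`, and the
position of the motive. -/
def Const.motive : Const → ℕ × Option ℕ
  | sigma | pair | funext => (2, none)
  | sum | inl | inr => (2, none)
  | sigmaInd | sumInd => (2, some 2)
  | unitInd | natInd | emptyInd => (0, some 0)
  | listInd | truncInd => (1, some 1)
  | idInd => (1, some 2)
  | defined d => match d with
    | .transport | .apd | .concatOver => (1, some 1)
    | .apdAlong => (2, some 3)
    | .ap => (2, none)
    | _ => (1, none)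
  | _ => (1, none)

/-- Whether a constant is a type former. -/
def Const.isFormer : Const → Bool
  | sigma | sum | list | id | trunc | N | nat | empty | unit => true
  | _ => false

/-- The entry of a context. -/
def ctxGet : Ctx → ℕ → Option Tm
  | [], _ => none
  | A :: Γ, n => n.casesOn (some A) (fun n => ctxGet Γ n)

namespace Tm

/-- Whether the term is a λ-abstraction. -/
def isLam : Tm → Bool
  | lam _ _ => true
  | _ => false

/-- The number of arguments of an application. -/
def arity : Tm → ℕ
  | app f _ => (arity f).succ
  | _ => 0

/-- The level of the universe in which a function with this type takes its values. -/
def codomainLevel : Tm → ℕ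
  | pi _ B => codomainLevel B
  | univ i => i
  | _ => 0

/-- The level of a type or of a family of types. -/
def level : Tm → Ctx → ℕ
  | var n, Γ => match ctxGet Γ n with
    | some A => A.codomainLevel
    | none => 0
  | univ i, _ => i.succ
  | pi A B, Γ => Nat.max (level A Γ) (level B (A :: Γ))
  | lam A b, Γ => level b (A :: Γ)
  | app f a, Γ => match f.head with
    | const c => cond c.isFormer
        (cond (Nat.blt f.arity c.motive.1) (Nat.max (level f Γ) (level a Γ)) (level f Γ))
        (match c.motive.2 with
          | none => 0
          | some n => cond (Nat.beq f.arity n) (Nat.pred (level a Γ)) (level f Γ))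
    | _ => level f Γ
  | const _, _ => 0

end Tm

/-- The maximal level of the first `n` types or families in a list. -/
def maxLevel (Γ : Ctx) : List Tm → ℕ → ℕ
  | [], _ => 0
  | a :: l, n => n.casesOn 0 (fun n => Nat.max (a.level Γ) (maxLevel Γ l n))

/-- The level of the entry of a list, if it is a neutral family of types. -/
def levelAt (Γ : Ctx) : List Tm → ℕ → ℕ
  | [], _ => 1
  | a :: l, n => n.casesOn (match a with
    | .lam _ _ => 1
    | .const _ => 1
    | .pi _ _ => 1
    | _ => a.level Γ) (fun n => levelAt Γ l n)

/-- The levels of a constant that its arguments suggest. -/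
def Const.levels (c : Const) (Γ : Ctx) (l : List Tm) : ℕ × ℕ :=
  (cond c.isFormer (maxLevel Γ l c.motive.1)
    (cond (Nat.beq c.motive.1 2) (levelAt Γ l 1) 1), match c.motive.2 with
    | none => 1
    | some n => levelAt Γ l n)

/-- Whether the levels are at most one, and equal to one where they matter little. -/
def Const.allows (c : Const) (i j : ℕ) : Bool :=
  cond (cond (cond c.isFormer true (Nat.beq c.motive.1 2)) (Nat.ble i 1) (Nat.beq i 1))
    (cond c.motive.2.isSome (Nat.ble j 1) (Nat.beq j 1)) false

/-- The type of a constant at given levels, if the code of the constant is below `n` and the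
levels are allowed. -/
def Const.typeBelow (n : ℕ) (c : Const) : ℕ × ℕ → Option Tm
  | (i, j) => cond (Nat.blt c.code n)
      (cond (c.allows i j) (some (c.type i j).closed) none) none

/-! ## The checker -/

/-- A judgmental equality in a context of parameters. -/
structure Rule : Type where
  /-- The parameters. -/
  tel : Ctx
  /-- The left side. -/
  lhs : Tm
  /-- The right side. -/
  rhs : Tm
  /-- The common type of the sides. -/
  ty : Tm

/-- The equality is derivable. -/
def Rule.Valid (r : Rule) : Prop :=
  Eqv r.tel r.lhs r.rhs r.ty ∧ ∃ k, Typ r.tel r.ty (.univ k)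

/-- A choice of a rule, with values of its parameters, for a constant and its arguments. -/
abbrev Strategy : Type := Ctx → Const → List Tm → Option (Rule × List Tm)

/-- A partial function that takes a term, and possibly a type to check it against, to a normal
form and the type. -/
abbrev Normalizer : Type := Ctx → Tm → Option Tm → Option (Tm × Tm)

section Checker

variable (m : ℕ) (strat : Strategy) (N : Normalizer)

/-- The normal form of a type. -/
def normTy (Γ : Ctx) (T : Tm) : Option Tm :=
  cond (T.isNormal []) (some T)
    (match N Γ T none with
      | some (T', .univ _) => some T'
      | _ => none)

/-- Check the entries of a list against a context of parameters. -/
def checkSubst (Γ : Ctx) : List Tm → Ctx → Bool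
  | [], [] => true
  | a :: σ, A :: Δ => cond (checkSubst Γ σ Δ)
      (match normTy N Γ (A.close σ) with
        | some A' => (N Γ a (some A')).isSome
        | none => false)
      false
  | _, _ => false

/-- Contract a redex of the normal type `T`. -/
def contract (Γ : Ctx) (s T : Tm) : Option Tm :=
  match s with
  | .app (.lam A b) a =>
    match N Γ A none with
    | some (_, .univ _) =>
      match N (A :: Γ) b none, N Γ a (some A) with
      | some (_, B), some _ =>
        match normTy N Γ (B.close [a]) with
        | some B' => cond (B'.le T)
            (match N Γ (b.close [a]) (some T) with
              | some (t, _) => some t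
              | none => none)
            none
        | none => none
      | _, _ => none
    | _ => none
  | _ =>
    match s.head with
    | .const c =>
      match strat Γ c (s.args []) with
      | some (r, σ) =>
        cond ((r.lhs.close σ).beq s)
          (cond (checkSubst N Γ σ r.tel)
            (match normTy N Γ (r.ty.close σ) with
              | some T' => cond (T'.le T)
                  (match N Γ (r.rhs.close σ) (some T) with
                    | some (t, _) => some t
                    | none => none)
                  none
              | none => none)
            none)
          none
      | none => none
    | _ => none

/-- Whether the term may be a redex. -/
def mayContract (s : Tm) : Bool :=
  match s.head with
  | .lam _ _ => true
  | .const c => match c.major with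
    | none => false
    | some n => canonicalAt (s.args []) n
  | _ => false

/-- The contractum of a term of type `T[σ]`, or the term itself. -/
def reduce (Γ : Ctx) (s T : Tm) (σ : List Tm) : Tm :=
  cond (mayContract s)
    (match normTy N Γ (T.close σ) with
      | some T' => (contract strat N Γ s T').getD s
      | none => s)
    s

/-- Compare the type `T[σ]` of a term with the type that the term is expected to have. -/
def finish (Γ : Ctx) (E : Option Tm) (t T : Tm) (σ : List Tm) : Option (Tm × Tm × List Tm) :=
  match E with
  | none => some (t, T, σ)
  | some E => cond ((T.close σ).le E) (some (t, E, []))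
    (match normTy N Γ (T.close σ) with
      | some T' => cond (T'.le E) (some (t, E, [])) none
      | none => none)

/-- Whether the normal forms of two types agree. -/
def leNormal (Γ : Ctx) (T A : Tm) : Bool :=
  match normTy N Γ T, normTy N Γ A with
  | some T', some A' => T'.le A'
  | _, _ => false

/-- Compute a level and a normal form of a type from the result of `check`. -/
def asType (Γ : Ctx) : Option (Tm × Tm × List Tm) → Option (Tm × ℕ)
  | some (A, T, σ) => match normTy N Γ (T.close σ) with
    | some (.univ i) => some (A, i)
    | _ => none
  | none => none

/-- A function type with the value `T[σ]`. -/
def asPi (Γ : Ctx) (T : Tm) (σ : List Tm) : Option (Tm × Tm × List Tm) :=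
  match T with
  | .pi A B => some (A, B, σ)
  | _ => match normTy N Γ (T.close σ) with
    | some (.pi A B) => some (A, B, [])
    | _ => none

/-- For a term `t` in the context `Γ` that is to be applied to the terms `l`, compute a normal
form and the type, in the form `T[σ]`; or check the term against a type.  The term may use the
constants with a code below `m`. -/
def check : Tm → Ctx → Option Tm → List Tm → Option (Tm × Tm × List Tm)
  | .var n, Γ, E, _ => match ctxGet Γ n with
    | some A => finish N Γ E (.var n) (A.lift n.succ 0) []
    | none => none
  | .univ i, Γ, E, _ => finish N Γ E (.univ i) (.univ i.succ) []
  | .const c, Γ, E, l => match c.typeBelow m (c.levels Γ l) with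
    | some T => finish N Γ E (.const c) T []
    | none => none
  | .pi A B, Γ, E, _ => match asType N Γ (check A Γ none []) with
    | some (A', i) => match asType N (A' :: Γ) (check B (A' :: Γ) none []) with
      | some (B', j) => finish N Γ E (.pi A' B') (.univ (Nat.max i j)) []
      | none => none
    | none => none
  | .lam A b, Γ, E, _ =>
    match E with
    | none => match asType N Γ (check A Γ none []) with
      | some (A', _) => match check b (A' :: Γ) none [] with
        | some (b', B, σ) => match normTy N (A' :: Γ) (B.close σ) with
          | some B' => some (.lam A' b', .pi A' B', [])
          | none => none
        | none => none
      | none => none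
    | some (.pi A₁ B₁) => cond (cond (A.beq A₁) true
          (match asType N Γ (check A Γ none []) with
            | some (A', _) => A'.beq A₁
            | none => false))
        (match check b (A₁ :: Γ) (some B₁) [] with
          | some (b', _, _) => some (.lam A₁ b', .pi A₁ B₁, [])
          | none => none)
        none
    | some _ => none
  | .app f a, Γ, E, l => match check f Γ none (a :: l) with
    | some (f', T, σ) => match asPi N Γ T σ with
      | some (A, B, σ) => cond a.isLam
        (match normTy N Γ (A.close σ) with
          | some A' => match check a Γ (some A') [] with
            | some (a', _, _) =>
              finish N Γ E (reduce strat N Γ (.app f' a') B (a' :: σ)) B (a' :: σ)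
            | none => none
          | none => none)
        (match check a Γ none [] with
          | some (a', T, τ) =>
            cond (cond ((T.close τ).le (A.close σ)) true (leNormal N Γ (T.close τ) (A.close σ)))
              (finish N Γ E (reduce strat N Γ (.app f' a') B (a' :: σ)) B (a' :: σ)) none
          | none => none)
      | none => none
    | none => none

/-- The normalizer that uses `N` for the contraction of redexes. -/
def normStep : Normalizer := fun Γ t E =>
  match check m strat N t Γ E [] with
  | some (t', T, σ) => match E with
    | some E => some (t', E)
    | none => match normTy N Γ (T.close σ) with
      | some T' => some (t', T')
      | none => none
  | none => none

end Checker

/-- The normalizer that contracts redexes up to a given depth. -/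
def norm (m : ℕ) (strat : Strategy) : ℕ → Normalizer
  | 0 => fun _ _ _ => none
  | n + 1 => normStep m strat (norm m strat n)

/-! ## Soundness of the checker -/

/-- The terms `t` and `t'` are equal and have the type `T`. -/
structure Normalizes (Γ : Ctx) (t t' T : Tm) : Prop where
  left : Typ Γ t T
  right : Typ Γ t' T
  eqv : Eqv Γ t t' T
  type : ∃ k, Typ Γ T (.univ k)

/-- An optional type is derivable. -/
def Expects (Γ : Ctx) (E : Option Tm) : Prop := ∀ A, E = some A → ∃ k, Typ Γ A (.univ k)

theorem Expects.none {Γ : Ctx} : Expects Γ none := fun _ h => nomatch h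

theorem Expects.some {Γ : Ctx} {A : Tm} {k : ℕ} (h : Typ Γ A (.univ k)) : Expects Γ (some A) := by
  intro B hB; cases hB; exact ⟨k, h⟩

/-- The results of a normalizer are correct. -/
def Normalizer.Sound (N : Normalizer) : Prop :=
  ∀ Γ t E t' T, Wf Γ → Expects Γ E → N Γ t E = some (t', T) →
    Normalizes Γ t t' T ∧ ∀ A, E = some A → T = A

/-- All rules that a strategy chooses are derivable. -/
def Strategy.Sound (strat : Strategy) : Prop :=
  ∀ Γ c l r σ, strat Γ c l = some (r, σ) → r.Valid

theorem Normalizes.conv {Γ : Ctx} {t t' T T' : Tm} {k i : ℕ} (h : Normalizes Γ t t' T)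
    (hT : Typ Γ T' (.univ k)) (e : Eqv Γ T T' (.univ i)) : Normalizes Γ t t' T' :=
  ⟨.conv _ _ _ _ i h.left e, .conv _ _ _ _ i h.right e, .eqConv _ _ _ _ _ i h.eqv e, k, hT⟩

theorem Eqv.le {Γ : Ctx} {a b A B : Tm} (h : Eqv Γ a b A) (hAB : A.le B = true) : Eqv Γ a b B := by
  unfold Tm.le at hAB
  split at hAB
  · exact h.cumul_le (Nat.le_of_ble_eq_true hAB)
  · exact Tm.eq_of_beq hAB ▸ h

theorem Typ.le {Γ : Ctx} {a A B : Tm} (h : Typ Γ a A) (hAB : A.le B = true) : Typ Γ a B := by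
  unfold Tm.le at hAB
  split at hAB
  · exact h.cumul_le (Nat.le_of_ble_eq_true hAB)
  · exact Tm.eq_of_beq hAB ▸ h

theorem Normalizes.le {Γ : Ctx} {t t' A B : Tm} {k : ℕ} (h : Normalizes Γ t t' A)
    (hB : Typ Γ B (.univ k)) (hAB : A.le B = true) : Normalizes Γ t t' B :=
  ⟨h.left.le hAB, h.right.le hAB, h.eqv.le hAB, k, hB⟩

section

variable {m : ℕ} {strat : Strategy} {N : Normalizer}

/-- Nothing about `isNormal` has to be proved: a type that it declares normal is returned unchanged
and is equal to itself. -/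
theorem normTy_sound (hN : N.Sound) {Γ : Ctx} {T T' : Tm} {k : ℕ} (hT : Typ Γ T (.univ k))
    (h : normTy N Γ T = some T') : ∃ i, Typ Γ T' (.univ i) ∧ Eqv Γ T T' (.univ i) := by
  unfold normTy at h
  cases hn : T.isNormal [] with
  | true =>
    rw [hn] at h
    cases h
    exact ⟨k, hT, .eqRefl _ _ _ hT⟩
  | false =>
    rw [hn, cond_false] at h
    split at h
    · rename_i T'' i hT'
      cases h
      obtain ⟨h, -⟩ := hN _ _ _ _ _ hT.wf .none hT'
      exact ⟨i, h.right, h.eqv⟩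
    · cases h

theorem Normalizes.normTy (hN : N.Sound) {Γ : Ctx} {t t' T T' : Tm} (h : Normalizes Γ t t' T)
    (hT : normTy N Γ T = some T') : Normalizes Γ t t' T' := by
  obtain ⟨k, hk⟩ := h.type
  obtain ⟨i, hi, e⟩ := normTy_sound hN hk hT
  exact h.conv hi e

theorem IsSubst.cons {Γ Δ : Ctx} {σ : List Tm} {a A : Tm} (h : IsSubst Δ Γ (Tm.ofList σ))
    (ha : Typ Γ a (A.subst (Tm.ofList σ))) : IsSubst (A :: Δ) Γ (Tm.ofList (a :: σ)) := by
  have hwk : ∀ B : Tm, B.wk.subst (Tm.ofList (a :: σ)) = B.subst (Tm.ofList σ) :=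
    fun B => Tm.subst_rename B Nat.succ _
  intro n B hB
  cases hB with
  | zero => rw [hwk]; exact ha
  | succ _ n B _ hB => rw [hwk]; exact h n B hB

theorem checkSubst_sound (hN : N.Sound) {Γ : Ctx} (hΓ : Wf Γ) {σ : List Tm} {Δ : Ctx}
    (hΔ : Wf Δ) (h : checkSubst N Γ σ Δ = true) : IsSubst Δ Γ (Tm.ofList σ) := by
  induction σ generalizing Δ with
  | nil =>
    cases Δ with
    | nil => intro n A hA; cases hA
    | cons A Δ => cases h
  | cons a σ ih =>
    cases Δ with
    | nil => cases h
    | cons A Δ =>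
      simp only [checkSubst, Bool.cond_false_right, Bool.and_eq_true] at h
      obtain ⟨h, ha⟩ := h
      have hσ := ih hΔ.tail h
      obtain ⟨i, hA⟩ := hΔ.head
      have hA' := hA.subst hΓ hσ
      refine hσ.cons ?_
      split at ha
      · rename_i A' hn
        rw [Tm.close_eq] at hn
        obtain ⟨k, hk, e⟩ := normTy_sound hN hA' hn
        obtain ⟨⟨t', T⟩, ht⟩ := Option.isSome_iff_exists.mp ha
        obtain ⟨h1, h2⟩ := hN _ _ _ _ _ hΓ (.some hk) ht
        cases h2 _ rfl
        exact .conv _ _ _ _ _ h1.left (.eqSymm _ _ _ _ e)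
      · cases ha

/-- The parts of a β-redex are typed afresh. Extracting their types from a typing of the redex would
require injectivity of function types. A redex of a constant is compared with the instantiated left
side of a rule whose parameters have been checked. -/
theorem contract_sound (hN : N.Sound) (hs : strat.Sound) {Γ : Ctx} {s T t : Tm} {k : ℕ}
    (hΓ : Wf Γ) (hT : Typ Γ T (.univ k)) (h : contract strat N Γ s T = some t) :
    Typ Γ t T ∧ Eqv Γ s t T := by
  unfold contract at h
  split at h
  · rename_i A b a
    split at h
    · rename_i A' i hA
      obtain ⟨hA, -⟩ := hN _ _ _ _ _ hΓ .none hA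
      split at h
      · rename_i b' B a' hb ha
        obtain ⟨hb, -⟩ := hN _ _ _ _ _ hA.left.cons_wf .none hb
        obtain ⟨a'', A''⟩ := a'
        obtain ⟨ha, ha'⟩ := hN _ _ _ _ _ hΓ (.some hA.left) ha
        cases ha' _ rfl
        split at h
        · rename_i B' hB
          obtain ⟨j, hj⟩ := hb.type
          rw [Tm.substL_single] at hB
          obtain ⟨l, hl, e⟩ := normTy_sound hN (hj.inst ha.left) hB
          cases hle : B'.le T with
          | false => rw [hle] at h; cases h
          | true =>
            rw [hle, cond_true] at h
            split at h
            · rename_i u _ hu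
              cases h
              obtain ⟨hu, hu'⟩ := hN _ _ _ _ _ hΓ (.some hT) hu
              cases hu' _ rfl
              refine ⟨hu.right, .eqTrans _ _ _ _ _ ?_ hu.eqv⟩
              rw [Tm.substL_single]
              exact Eqv.le (.eqConv _ _ _ _ _ _ (.beta _ _ _ _ _ hb.left ha.left) e) hle
            · cases h
        · cases h
      · cases h
    · cases h
  · split at h
    · split at h
      · rename_i r σ hr
        obtain ⟨hr, j, hty⟩ := hs _ _ _ _ _ hr
        cases hl : (r.lhs.close σ).beq s with
        | false => rw [hl] at h; cases h
        | true =>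
          cases hσ : checkSubst N Γ σ r.tel with
          | false => rw [hl, hσ] at h; cases h
          | true =>
            rw [hl, hσ, cond_true, cond_true] at h
            have hσ := checkSubst_sound hN hΓ hty.wf hσ
            split at h
            · rename_i T' hT'
              rw [Tm.close_eq] at hT'
              obtain ⟨i, hi, e⟩ := normTy_sound hN (hty.subst hΓ hσ) hT'
              cases hle : T'.le T with
              | false => rw [hle] at h; cases h
              | true =>
                rw [hle, cond_true] at h
                split at h
                · rename_i u _ hu
                  cases h
                  obtain ⟨hu, hu'⟩ := hN _ _ _ _ _ hΓ (.some hT) hu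
                  cases hu' _ rfl
                  refine ⟨hu.right, .eqTrans _ _ _ _ _ ?_ hu.eqv⟩
                  rw [← Tm.eq_of_beq hl, Tm.close_eq, Tm.close_eq]
                  exact Eqv.le (.eqConv _ _ _ _ _ _ (hr.subst hΓ hσ) e) hle
                · cases h
            · cases h
      · cases h
    · cases h

theorem reduce_sound (hN : N.Sound) (hs : strat.Sound) {Γ : Ctx} {t s T : Tm} {σ : List Tm}
    (h : Normalizes Γ t s (T.close σ)) :
    Normalizes Γ t (reduce strat N Γ s T σ) (T.close σ) := by
  unfold reduce
  cases mayContract s with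
  | false => exact h
  | true =>
    rw [cond_true]
    split
    · rename_i T' hT'
      cases hc : contract strat N Γ s T' with
      | none => exact h
      | some u =>
        obtain ⟨k, hk⟩ := h.type
        obtain ⟨i, hi, e⟩ := normTy_sound hN hk hT'
        obtain ⟨hu, hsu⟩ := contract_sound hN hs hk.wf hi hc
        have e' := Derivable.eqSymm _ _ _ _ e
        exact ⟨h.left, .conv _ _ _ _ _ hu e',
          .eqTrans _ _ _ _ _ h.eqv (.eqConv _ _ _ _ _ _ hsu e'), k, hk⟩
    · exact h

theorem finish_sound (hN : N.Sound) {Γ : Ctx} {E : Option Tm} {u t T : Tm} {σ : List Tm}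
    {r : Tm × Tm × List Tm} (h : Normalizes Γ u t (T.close σ)) (hE : Expects Γ E)
    (hr : finish N Γ E t T σ = some r) :
    Normalizes Γ u r.1 (r.2.1.close r.2.2) ∧ ∀ A, E = some A → r.2.1.close r.2.2 = A := by
  unfold finish at hr
  split at hr
  · cases hr
    exact ⟨h, fun _ h => nomatch h⟩
  · rename_i E
    obtain ⟨k, hk⟩ := hE _ rfl
    cases hle : (T.close σ).le E with
    | true =>
      rw [hle] at hr
      cases hr
      exact ⟨h.le hk hle, fun A hA => by cases hA; rfl⟩
    | false =>
      rw [hle, cond_false] at hr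
      split at hr
      · rename_i T' hT'
        cases hle : T'.le E with
        | false => rw [hle] at hr; cases hr
        | true =>
          rw [hle] at hr
          cases hr
          exact ⟨(h.normTy hN hT').le hk hle, fun A hA => by cases hA; rfl⟩
      · cases hr

theorem leNormal_sound (hN : N.Sound) {Γ : Ctx} {t t' T A : Tm} {k : ℕ}
    (h : Normalizes Γ t t' T) (hA : Typ Γ A (.univ k)) (hle : leNormal N Γ T A = true) :
    Normalizes Γ t t' A := by
  unfold leNormal at hle
  split at hle
  · rename_i T' A' hT' hA'
    obtain ⟨i, hi, e⟩ := normTy_sound hN hA hA'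
    exact ((h.normTy hN hT').le hi hle).conv hA (.eqSymm _ _ _ _ e)
  · cases hle

theorem asType_sound (hN : N.Sound) {Γ : Ctx} {r : Option (Tm × Tm × List Tm)} {t A : Tm} {i : ℕ}
    (h : ∀ t' T σ, r = some (t', T, σ) → Normalizes Γ t t' (T.close σ))
    (hr : asType N Γ r = some (A, i)) : Normalizes Γ t A (.univ i) := by
  unfold asType at hr
  split at hr
  · rename_i A' T σ
    split at hr
    · rename_i j hT
      cases hr
      exact (h _ _ _ rfl).normTy hN hT
    · cases hr
  · cases hr

theorem asPi_sound (hN : N.Sound) {Γ : Ctx} {t t' T A B : Tm} {σ τ : List Tm}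
    (h : Normalizes Γ t t' (T.close σ)) (hr : asPi N Γ T σ = some (A, B, τ)) :
    Normalizes Γ t t' ((Tm.pi A B).close τ) := by
  unfold asPi at hr
  split at hr
  · cases hr
    exact h
  · split at hr
    · rename_i hT
      cases hr
      exact h.normTy hN hT
    · cases hr

theorem ctxGet_sound {Γ : Ctx} {n : ℕ} {A : Tm} (h : ctxGet Γ n = some A) :
    Lookup Γ n (A.lift n.succ 0) := by
  rw [Tm.lift_zero_right]
  induction Γ generalizing n with
  | nil => cases h
  | cons B Γ ih =>
    cases n with
    | zero => cases h; exact .zero _ _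
    | succ n =>
      have := Lookup.succ _ _ _ B (ih h)
      rwa [Tm.wk, Tm.rename_rename] at this

theorem Lookup.typ {Γ : Ctx} {n : ℕ} {A : Tm} (hΓ : Wf Γ) (h : Lookup Γ n A) :
    ∃ k, Typ Γ A (.univ k) := by
  induction h with
  | zero Γ A =>
    obtain ⟨k, hk⟩ := hΓ.head
    exact ⟨k, hk.weaken hΓ⟩
  | succ Γ n A B _ ih =>
    obtain ⟨k, hk⟩ := ih hΓ.tail
    exact ⟨k, hk.weaken hΓ⟩

/-- The types of the constants with a code below `m`, at the allowed levels, are types. -/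
def ConstTypes (m : ℕ) : Prop :=
  ∀ c i j, Nat.blt (Const.code c) m = true → c.allows i j = true →
    ∃ k, Typ [] (c.type i j).closed (.univ k)

theorem ConstTypes.typeBelow (hC : ConstTypes m) {c : Const} {l : ℕ × ℕ} {T : Tm}
    (h : c.typeBelow m l = some T) :
    ∃ i j, T = (c.type i j).closed ∧ ∃ k, Typ [] T (.univ k) := by
  obtain ⟨i, j⟩ := l
  simp only [Const.typeBelow] at h
  cases h1 : Nat.blt c.code m <;> cases h2 : c.allows i j <;>
    simp only [h1, h2, cond_true, cond_false, reduceCtorEq, Option.some.injEq] at h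
  subst h
  exact ⟨i, j, rfl, hC c i j h1 h2⟩

theorem Typ.weaken_closed {t T : Tm} (h : Typ [] t T) (ht : t.closedAt 0 = true)
    (hT : T.closedAt 0 = true) {Γ : Ctx} (hΓ : Wf Γ) : Typ Γ t T := by
  have := h.subst (σ := Tm.var) hΓ (fun n A h => by cases h)
  rwa [Tm.subst_closed ht, Tm.subst_closed hT] at this

/-- Induction on the term; contraction is delegated to `N`, whose soundness is a hypothesis. The
levels guessed for a constant are harmless, since its type at any levels is correct and a bad guess
can only make the check fail. -/
theorem check_sound (hC : ConstTypes m) (hN : N.Sound) (hs : strat.Sound) (t : Tm) :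
    ∀ Γ E l r, Wf Γ → Expects Γ E → check m strat N t Γ E l = some r →
      Normalizes Γ t r.1 (r.2.1.close r.2.2) ∧ ∀ A, E = some A → r.2.1.close r.2.2 = A := by
  have self : ∀ {Γ t T k}, Typ Γ t T → Typ Γ T (.univ k) → Normalizes Γ t t (T.close []) :=
    fun h hT => ⟨h, h, .eqRefl _ _ _ h, _, hT⟩
  induction t with
  | var n =>
    intro Γ E l r hΓ hE h
    rw [check] at h
    split at h
    · rename_i A hA
      have hn := ctxGet_sound hA
      obtain ⟨k, hk⟩ := hn.typ hΓ
      exact finish_sound hN (self (.var _ _ _ hΓ hn) hk) hE h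
    · cases h
  | univ i =>
    intro Γ E l r hΓ hE h
    exact finish_sound hN (self (.univ _ _ hΓ) (.univ _ _ hΓ)) hE h
  | const c =>
    intro Γ E l r hΓ hE h
    rw [check] at h
    split at h
    · rename_i T hT
      obtain ⟨i, j, rfl, k, hk⟩ := hC.typeBelow hT
      exact finish_sound hN (self (.const _ _ _ _ hΓ)
        (hk.weaken_closed (c.type_closed _ _) rfl hΓ)) hE h
    · cases h
  | pi A B ihA ihB =>
    intro Γ E l r hΓ hE h
    rw [check] at h
    split at h
    · rename_i A' i hA
      have hA := asType_sound hN (fun t' T σ ht => (ihA _ _ _ _ hΓ .none ht).1) hA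
      split at h
      · rename_i B' j hB
        have hB := asType_sound hN
          (fun t' T σ ht => (ihB _ _ _ _ hA.right.cons_wf .none ht).1) hB
        have e := Eqv.conv_head hB.eqv hA.left hA.eqv
        refine finish_sound hN (σ := []) ⟨?_, ?_, ?_, _, .univ _ _ hΓ⟩ hE h
        · exact .pi _ _ _ _ (hA.left.cumul_le (Nat.le_max_left _ _))
            ((hB.left.conv_head hA.left hA.eqv).cumul_le (Nat.le_max_right _ _))
        · exact .pi _ _ _ _ (hA.right.cumul_le (Nat.le_max_left _ _))
            (hB.right.cumul_le (Nat.le_max_right _ _))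
        · exact .eqPi _ _ _ _ _ _ (hA.eqv.cumul_le (Nat.le_max_left _ _))
            (e.cumul_le (Nat.le_max_right _ _))
      · cases h
    · cases h
  | lam A b ihA ihb =>
    -- The body is checked under the normalized domain `A'`; the result is carried back to the
    -- domain `A` by conversion of the head of the context.
    have key : ∀ {Γ A' B b' i k}, Normalizes Γ A A' (.univ i) → Normalizes (A' :: Γ) b b' B →
        Typ (A' :: Γ) B (.univ k) → Normalizes Γ (.lam A b) (.lam A' b') (.pi A' B) := by
      intro Γ A' B b' i k hA hb hB
      have hpi : ∀ {C}, Typ Γ C (.univ i) → Eqv Γ C A' (.univ i) →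
          Typ Γ (.pi C B) (.univ (max i k)) := fun hC e =>
        .pi _ _ _ _ (hC.cumul_le (Nat.le_max_left _ _))
          ((hB.conv_head hC e).cumul_le (Nat.le_max_right _ _))
      have e : Eqv Γ (.pi A B) (.pi A' B) (.univ (max i k)) :=
        .eqPi _ _ _ _ _ _ (hA.eqv.cumul_le (Nat.le_max_left _ _))
          (.eqRefl _ _ _ ((hB.conv_head hA.left hA.eqv).cumul_le (Nat.le_max_right _ _)))
      refine ⟨.conv _ _ _ _ _ (.lam _ _ _ _ (hb.left.conv_head hA.left hA.eqv)) e,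
        .lam _ _ _ _ hb.right, .eqConv _ _ _ _ _ _ (.eqLam _ _ _ _ _ _ i hA.eqv
          (hb.eqv.conv_head hA.left hA.eqv)) e, _, hpi hA.right (.eqRefl _ _ _ hA.right)⟩
    intro Γ E l r hΓ hE h
    rw [check.eq_def] at h
    dsimp only at h
    split at h
    · split at h
      · rename_i A' i hA
        have hA := asType_sound hN (fun t' T σ ht => (ihA _ _ _ _ hΓ .none ht).1) hA
        split at h
        · rename_i b' B σ hb
          obtain ⟨hb, -⟩ := ihb _ _ _ _ hA.right.cons_wf .none hb
          split at h
          · rename_i B' hB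
            cases h
            have hb := hb.normTy hN hB
            obtain ⟨k, hk⟩ := hb.type
            exact ⟨key hA hb hk, fun _ h => nomatch h⟩
          · cases h
        · cases h
      · cases h
    · rename_i A₁ B₁
      obtain ⟨k, hk⟩ := hE _ rfl
      obtain ⟨j, hA₁, hB⟩ := hk.pi_inv
      -- The annotation of the λ-abstraction agrees with the expected domain either literally or
      -- after normalization. In the first case, inversion of the expected function type shows that
      -- the domain is a type.
      have hA : ∀ c, cond (A.beq A₁) true (match asType N Γ (check m strat N A Γ none []) with
            | some (A', _) => A'.beq A₁
            | none => false) = c → c = true → ∃ i, Normalizes Γ A A₁ (.univ i) := by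
        cases hAA : A.beq A₁ with
        | true =>
          intro _ _ _
          cases Tm.eq_of_beq hAA
          exact ⟨j, self hA₁ (.univ _ _ hΓ)⟩
        | false =>
          rw [cond_false]
          intro c hc h
          subst hc
          split at h
          · rename_i A' i hA
            cases Tm.eq_of_beq h
            exact ⟨i, asType_sound hN (fun t' T σ ht => (ihA _ _ _ _ hΓ .none ht).1) hA⟩
          · cases h
      generalize hc : cond (A.beq A₁) true _ = c at h
      cases c with
      | false => cases h
      | true =>
        obtain ⟨i, hA⟩ := hA _ hc rfl
        rw [cond_true] at h
        split at h
        · rename_i b' B σ hb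
          cases h
          obtain ⟨hb, hb'⟩ := ihb _ _ _ _ hA.right.cons_wf (.some hB) hb
          have hb' := hb' _ rfl
          dsimp only at hb hb'
          rw [hb'] at hb
          exact ⟨key hA hb hB, fun A hA => by cases hA; rfl⟩
        · cases h
    · cases h
  | app f a ihf iha =>
    intro Γ E l r hΓ hE h
    rw [check] at h
    split at h
    · rename_i f' T σ hf
      obtain ⟨hf, -⟩ := ihf _ _ _ _ hΓ .none hf
      split at h
      · rename_i A B τ hAB
        have hf := asPi_sound hN hf hAB
        rw [Tm.close_eq] at hf
        obtain ⟨k, hk⟩ := hf.type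
        obtain ⟨m, hA, hB⟩ := hk.pi_inv
        -- The computed type contains the normalized argument `a'`, while `app` gives the
        -- application to `a` the type instantiated with `a`; the two instances are equal by
        -- `Eqv.inst_arg`.
        have key : ∀ {a'}, Normalizes Γ a a' (A.subst (Tm.ofList τ)) →
            finish N Γ E (reduce strat N Γ (.app f' a') B (a' :: τ)) B (a' :: τ) = some r →
            Normalizes Γ (f.app a) r.1 (r.2.1.close r.2.2) ∧
              ∀ A, E = some A → r.2.1.close r.2.2 = A := by
          intro a' ha h
          refine finish_sound hN (reduce_sound hN hs ?_) hE h
          rw [Tm.close_eq, Tm.subst_cons]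
          have e' := Eqv.inst_arg hB ha.left ha.right ha.eqv
          exact ⟨.conv _ _ _ _ _ (.app _ _ _ _ _ hf.left ha.left) e',
            .app _ _ _ _ _ hf.right ha.right,
            .eqConv _ _ _ _ _ _ (.eqApp _ _ _ _ _ _ _ hf.eqv ha.eqv) e', _,
            hB.inst ha.right⟩
        rw [Tm.close_eq] at h
        cases hlam : a.isLam with
        | true =>
          rw [hlam, cond_true] at h
          split at h
          · rename_i A' hA'
            obtain ⟨i, hi, e⟩ := normTy_sound hN hA hA'
            split at h
            · rename_i a' _ _ ha
              obtain ⟨ha, ha'⟩ := iha _ _ _ _ hΓ (.some hi) ha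
              have ha' := ha' _ rfl
              dsimp only at ha ha'
              rw [ha'] at ha
              exact key (ha.conv hA (.eqSymm _ _ _ _ e)) h
            · cases h
          · cases h
        | false =>
          rw [hlam, cond_false] at h
          split at h
          · rename_i a' T' τ' ha
            obtain ⟨ha, -⟩ := iha _ _ _ _ hΓ .none ha
            dsimp only at ha
            cases hle : (T'.close τ').le (A.subst (Tm.ofList τ)) with
            | true =>
              rw [hle, cond_true, cond_true] at h
              exact key (ha.le hA hle) h
            | false =>
              rw [hle, cond_false, Bool.cond_eq_ite] at h
              split at h
              · rename_i hn
                exact key (leNormal_sound hN ha hA hn) h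
              · cases h
          · cases h
      · cases h
    · cases h

end

theorem normStep_sound {m : ℕ} {strat : Strategy} {N : Normalizer} (hC : ConstTypes m) (hN : N.Sound)
    (hs : strat.Sound) : (normStep m strat N).Sound := by
  intro Γ t E t' T hΓ hE h
  unfold normStep at h
  split at h
  · rename_i u U σ hc
    obtain ⟨hu, hu'⟩ := check_sound hC hN hs t _ _ _ _ hΓ hE hc
    split at h
    · cases h
      have hu' := hu' _ rfl
      dsimp only at hu hu'
      rw [hu'] at hu
      exact ⟨hu, fun A hA => by cases hA; rfl⟩
    · split at h
      · rename_i T' hT'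
        cases h
        exact ⟨hu.normTy hN hT', fun _ h => nomatch h⟩
      · cases h
  · cases h

theorem norm_sound {m : ℕ} {strat : Strategy} (hC : ConstTypes m) (hs : strat.Sound) (n : ℕ) :
    (norm m strat n).Sound := by
  induction n with
  | zero => intro _ _ _ _ _ _ _ h; cases h
  | succ n ih => exact normStep_sound hC ih hs

end HoTT

namespace HoTT

/-! ## The types of the constants -/

/-- Whether the checker accepts the closed term as a type. -/
def checkType (m : ℕ) (strat : Strategy) (T : Tm) : Bool :=
  match norm m strat 20 [] T none with
  | some (_, .univ _) => true
  | _ => false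

theorem checkType_sound {m : ℕ} {strat : Strategy} {T : Tm} (hC : ConstTypes m)
    (hs : strat.Sound) (h : checkType m strat T = true) : ∃ k, Typ [] T (.univ k) := by
  unfold checkType at h
  split at h
  · rename_i T' k hT
    exact ⟨k, (norm_sound hC hs 20 _ _ _ _ _ .ctxNil .none hT).1.left⟩
  · cases h

/-- Check the types of the constants with the codes from `m` to `m + n - 1`. -/
def checkTypes (strat : Strategy) (m : ℕ) : ℕ → Bool
  | 0 => true
  | n + 1 => cond (checkTypes strat m n)
      (let c := Const.decode (Nat.add m n)
      let ok := fun i j => cond (c.allows i j) (checkType (Nat.add m n) strat (c.type i j).closed) true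
      cond (ok 0 0) (cond (ok 0 1) (cond (ok 1 0) (ok 1 1) false) false) false) false

theorem Const.le_of_allows {c : Const} {i j : ℕ} (h : c.allows i j = true) : i ≤ 1 ∧ j ≤ 1 := by
  have key : ∀ b n, cond b (Nat.ble n 1) (Nat.beq n 1) = true → n ≤ 1 := by
    intro b n h
    cases b with
    | true => exact Nat.le_of_ble_eq_true h
    | false => exact (Nat.eq_of_beq_eq_true h).le
  simp only [allows, Bool.cond_false_right, Bool.and_eq_true] at h
  exact ⟨key _ _ h.1, key _ _ h.2⟩

/-- The type of the constant with code `m + n` is checked using only constants with smaller codes,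
so there is no circularity. Allowed levels are at most one, which leaves four cases for each
constant. -/
theorem checkTypes_sound {strat : Strategy} (hs : strat.Sound) {m n : ℕ} (hC : ConstTypes m)
    (h : checkTypes strat m n = true) : ConstTypes (m + n) := by
  induction n with
  | zero => exact hC
  | succ n ih =>
    simp only [checkTypes, Bool.cond_false_right, Bool.and_eq_true] at h
    obtain ⟨h, h00, h01, h10, h11⟩ := h
    have hC' := ih h
    intro c i j hc hij
    rw [Nat.blt_eq] at hc
    by_cases hlt : c.code < m + n
    · exact hC' c i j (Nat.blt_eq.mpr hlt) hij
    · have hc : c = Const.decode (m + n) := by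
        rw [← Const.decode_code c]; congr 1; omega
      subst hc
      obtain ⟨hi, hj⟩ := Const.le_of_allows hij
      have key : ∀ i j, (Const.decode (m + n)).allows i j = true →
          (bif (Const.decode (m.add n)).allows i j then
            checkType (m.add n) strat ((Const.decode (m.add n)).type i j).closed else true) = true →
          ∃ k, Typ [] ((Const.decode (m + n)).type i j).closed (.univ k) := by
        intro i j hij h
        rw [show (Const.decode (m.add n)).allows i j = true from hij, cond_true] at h
        exact checkType_sound hC' hs h
      interval_cases i <;> interval_cases j
      · exact key _ _ hij h00
      · exact key _ _ hij h01
      · exact key _ _ hij h10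
      · exact key _ _ hij h11

/-! ## Rules -/

/-- The strategy that uses no rules. -/
def noRules : Strategy := fun _ _ _ => none

theorem noRules_sound : noRules.Sound := fun _ _ _ _ _ h => nomatch h

theorem constTypes_zero : ConstTypes 0 := fun c _ _ h => by simp [Nat.blt, Nat.ble] at h

set_option maxRecDepth 10000 in
/-- The types of the constants whose types need no computation rules. -/
theorem constTypes_basic : ConstTypes 43 :=
  checkTypes_sound (n := 43) noRules_sound constTypes_zero (by decide +kernel)

/-- The leading λ-abstractions of a term as a context. -/
def Tm.lamTel : Tm → Ctx → Ctx
  | lam A b, Γ => lamTel b (A :: Γ)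
  | _, Γ => Γ

/-- The term under the leading λ-abstractions. -/
def Tm.lamBody : Tm → ℕ → Tm
  | lam _ b, n + 1 => lamBody b n
  | t, _ => t

/-- The type under the leading function types. -/
def Tm.piBody : Tm → ℕ → Tm
  | pi _ B, n + 1 => piBody B n
  | t, _ => t

/-- The rule with parameters that is given by an equality of closed functions. -/
def toRule (r : Exp × Exp × Exp) : Rule :=
  let Γ := r.1.closed.lamTel []
  { tel := Γ
    lhs := r.1.closed.lamBody Γ.length
    rhs := r.2.1.closed.lamBody Γ.length
    ty := r.2.2.closed.piBody Γ.length }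

/-- λ-abstraction over a context. -/
def lams : Ctx → Tm → Tm
  | [], t => t
  | A :: Γ, t => lams Γ (.lam A t)

/-- Function types over a context. -/
def pis : Ctx → Tm → Tm
  | [], t => t
  | A :: Γ, t => pis Γ (.pi A t)

theorem Tm.rename_up_inst (t : Tm) : (t.rename (upRen Nat.succ)).inst (var 0) = t := by
  rw [inst, subst_rename]
  conv_rhs => rw [← subst_var t]
  congr 1; funext n; cases n <;> rfl

/-- Weaken both functions, apply them to the variable `0` and use β on either side. The typings of
`b` and `c` are what β requires. -/
theorem Eqv.of_lam {Γ : Ctx} {A B b c : Tm} (h : Eqv Γ (.lam A b) (.lam A c) (.pi A B))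
    (hb : Typ (A :: Γ) b B) (hc : Typ (A :: Γ) c B) : Eqv (A :: Γ) b c B := by
  have hΓ := hb.wf
  have beta : ∀ {b}, Typ (A :: Γ) b B →
      Eqv (A :: Γ) (.app (Tm.lam A b).wk (.var 0)) b B := by
    intro b hb
    have hA : Typ (A :: Γ) (.var 0) A.wk := .var _ _ _ hΓ (.zero _ _)
    obtain ⟨k, hk⟩ := hA.wf.head
    have hW : Wf (A.wk :: A :: Γ) := (hk.weaken hΓ).cons_wf
    have hb' := hb.renames.2 _ _ hW ((IsRenaming.succ Γ A).up A)
    have := Derivable.beta _ _ _ _ _ hb' hA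
    rwa [Tm.rename_up_inst, Tm.rename_up_inst] at this
  have hw := h.renames.2 _ _ hΓ (.succ Γ A)
  have := Derivable.eqApp _ _ _ _ _ _ _ hw (.eqRefl _ _ _ (.var _ _ _ hΓ (.zero _ _)))
  rw [Tm.rename_up_inst] at this
  exact .eqTrans _ _ _ _ _ (.eqSymm _ _ _ _ (beta hb)) (.eqTrans _ _ _ _ _ this (beta hc))

theorem Eqv.of_lams {Γ : Ctx} {l r T : Tm} (h : Eqv [] (lams Γ l) (lams Γ r) (pis Γ T))
    (hl : Typ Γ l T) (hr : Typ Γ r T) : Eqv Γ l r T := by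
  induction Γ generalizing l r T with
  | nil => exact h
  | cons A Γ ih => exact .of_lam (ih h (.lam _ _ _ _ hl) (.lam _ _ _ _ hr)) hl hr

/-- Check a context. -/
def checkCtx (N : Normalizer) : Ctx → Bool
  | [] => true
  | A :: Γ => cond (checkCtx N Γ)
      (match N Γ A none with
        | some (_, .univ _) => true
        | _ => false)
      false

theorem checkCtx_sound {N : Normalizer} (hN : N.Sound) {Γ : Ctx} (h : checkCtx N Γ = true) :
    Wf Γ := by
  induction Γ with
  | nil => exact .ctxNil
  | cons A Γ ih =>
    simp only [checkCtx, Bool.cond_false_right, Bool.and_eq_true] at h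
    obtain ⟨h, hA⟩ := h
    split at hA
    · rename_i A' k hk
      exact (hN _ _ _ _ _ (ih h) .none hk).1.left.cons_wf
    · cases hA

/-- Check that the sides of a rule have the given type. -/
def checkSides (N : Normalizer) (r : Rule) : Bool :=
  cond (checkCtx N r.tel)
    (match N r.tel r.ty none with
      | some (T, .univ _) => cond (N r.tel r.lhs (some T)).isSome
          (N r.tel r.rhs (some T)).isSome false
      | _ => false)
    false

theorem checkSides_sound {N : Normalizer} (hN : N.Sound) {r : Rule} (h : checkSides N r = true) :
    Typ r.tel r.lhs r.ty ∧ Typ r.tel r.rhs r.ty ∧ ∃ k, Typ r.tel r.ty (.univ k) := by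
  simp only [checkSides, Bool.cond_false_right, Bool.and_eq_true] at h
  obtain ⟨hΓ, h⟩ := h
  have hΓ := checkCtx_sound hN hΓ
  split at h
  · rename_i T k hT
    obtain ⟨hT, -⟩ := hN _ _ _ _ _ hΓ .none hT
    simp only [Bool.and_eq_true] at h
    have side : ∀ {t}, (N r.tel t (some T)).isSome = true → Typ r.tel t r.ty := by
      intro t ht
      obtain ⟨⟨t', T'⟩, ht⟩ := Option.isSome_iff_exists.mp ht
      obtain ⟨h1, h2⟩ := hN _ _ _ _ _ hΓ (.some hT.right) ht
      cases h2 _ rfl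
      exact .conv _ _ _ _ _ h1.left (.eqSymm _ _ _ _ hT.eqv)
    exact ⟨side h.1, side h.2, k, hT.left⟩
  · cases h

/-- The rule `comp` equates closed functions of all parameters. Once both sides are typed over the
parameters, the λ-abstractions can be stripped, which gives a rule that can be instantiated. -/
theorem Comp.valid {N : Normalizer} (hN : N.Sound) (c : Comp) (i j : ℕ)
    (hl : lams (toRule (c.rule i j)).tel (toRule (c.rule i j)).lhs = (c.rule i j).1.closed)
    (hr : lams (toRule (c.rule i j)).tel (toRule (c.rule i j)).rhs = (c.rule i j).2.1.closed)
    (hT : pis (toRule (c.rule i j)).tel (toRule (c.rule i j)).ty = (c.rule i j).2.2.closed)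
    (h : checkSides N (toRule (c.rule i j)) = true) : (toRule (c.rule i j)).Valid := by
  obtain ⟨h1, h2, h3⟩ := checkSides_sound hN h
  refine ⟨.of_lams ?_ h1 h2, h3⟩
  rw [hl, hr, hT]
  exact .comp _ _ _ _ .ctxNil

/-- Whether both sides of a rule have the same normal form. -/
def checkJoin (N : Normalizer) (r : Rule) : Bool :=
  cond (checkCtx N r.tel)
    (match N r.tel r.ty none with
      | some (T, .univ _) => match N r.tel r.lhs (some T), N r.tel r.rhs (some T) with
        | some (l, _), some (r, _) => l.beq r
        | _, _ => false
      | _ => false)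
    false

theorem checkJoin_sound {N : Normalizer} (hN : N.Sound) {r : Rule} (h : checkJoin N r = true) :
    r.Valid := by
  simp only [checkJoin, Bool.cond_false_right, Bool.and_eq_true] at h
  obtain ⟨hΓ, h⟩ := h
  have hΓ := checkCtx_sound hN hΓ
  split at h
  · rename_i T k hT
    obtain ⟨hT, -⟩ := hN _ _ _ _ _ hΓ .none hT
    split at h
    · rename_i l _ r' _ hl hr
      obtain ⟨hl, hl'⟩ := hN _ _ _ _ _ hΓ (.some hT.right) hl
      obtain ⟨hr, hr'⟩ := hN _ _ _ _ _ hΓ (.some hT.right) hr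
      cases hl' _ rfl
      cases hr' _ rfl
      cases Tm.eq_of_beq h
      exact ⟨.eqConv _ _ _ _ _ _ (.eqTrans _ _ _ _ _ hl.eqv (.eqSymm _ _ _ _ hr.eqv))
        (.eqSymm _ _ _ _ hT.eqv), k, hT.left⟩
    · cases h
  · cases h

end HoTT

/-! ### Validation of the computation rules -/

namespace HoTT

/-- The computation rule, with values of its parameters, that applies to an eliminator or a
defined function. -/
def compRule : Const → List Tm → Option (Comp × List Tm)
  | .sigmaInd, [A, B, P, f, .app (.app _ a) b] => some (.sigma, [b, a, f, P, B, A])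
  | .unitInd, [P, c, _] => some (.unit, [c, P])
  | .sumInd, [A, B, P, f, g, .app (.app (.app (.const k) _) _) a] =>
    some (cond (Nat.beq k.code 12) .inl .inr, [a, g, f, P, B, A])
  | .natInd, [P, c, f, .app _ n] => some (.succ, [n, f, c, P])
  | .natInd, [P, c, f, _] => some (.zero, [f, c, P])
  | .listInd, [A, P, c, f, .app (.app _ a) x] => some (.cons, [x, a, f, c, P, A])
  | .listInd, [A, P, c, f, _] => some (.nil, [f, c, P, A])
  | .idInd, [A, x, P, d, _, _] => some (.refl, [d, P, x, A])
  | .truncInd, [A, P, h, f, .app _ a] => some (.trunc, [a, f, h, P, A])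
  | .defined .symm, l => some (.defined .symm, l.reverse)
  | .defined .concat, l => some (.defined .concat, l.reverse)
  | .defined .ap, l => some (.defined .ap, l.reverse)
  | .defined .transport, l => some (.defined .transport, l.reverse)
  | .defined .append, l => some (.defined .append, l.reverse)
  | .defined .bar, l => some (.defined .bar, l.reverse)
  | _, _ => none

/-- The computation rules, and the defining equations of functions. -/
def compRules : Strategy := fun Γ c l =>
  match compRule c l with
  | some (r, σ) => match c.levels Γ l with
    | (i, j) => cond (c.allows i j) (some (toRule (r.rule i j), σ)) none
  | none => none

/-- Check a computation rule. -/
def checkComp (N : Normalizer) (c : Comp) (i j : ℕ) : Bool :=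
  let r := toRule (c.rule i j)
  cond ((lams r.tel r.lhs).beq (c.rule i j).1.closed)
    (cond ((lams r.tel r.rhs).beq (c.rule i j).2.1.closed)
      (cond ((pis r.tel r.ty).beq (c.rule i j).2.2.closed) (checkSides N r) false) false) false

theorem checkComp_sound {N : Normalizer} (hN : N.Sound) {c : Comp} {i j : ℕ}
    (h : checkComp N c i j = true) : (toRule (c.rule i j)).Valid := by
  simp only [checkComp, Bool.cond_false_right, Bool.and_eq_true] at h
  exact Comp.valid hN c i j (Tm.eq_of_beq h.1) (Tm.eq_of_beq h.2.1) (Tm.eq_of_beq h.2.2.1) h.2.2.2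

/-- Check the computation rules of a constant at all levels that are allowed. -/
def checkComps (N : Normalizer) : List (Const × Comp) → Bool
  | [] => true
  | (c, r) :: l => cond (checkComps N l)
      (let ok := fun i j => cond (c.allows i j) (checkComp N r i j) true
      cond (ok 0 0) (cond (ok 0 1) (cond (ok 1 0) (ok 1 1) false) false) false) false

theorem checkComps_sound {N : Normalizer} (hN : N.Sound) {l : List (Const × Comp)}
    (h : checkComps N l = true) {c : Const} {r : Comp} (hc : (c, r) ∈ l) {i j : ℕ}
    (hij : c.allows i j = true) : (toRule (r.rule i j)).Valid := by
  induction l with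
  | nil => cases hc
  | cons a l ih =>
    simp only [checkComps, Bool.cond_false_right, Bool.and_eq_true] at h
    obtain ⟨h, h00, h01, h10, h11⟩ := h
    cases hc with
    | tail _ hc => exact ih h hc
    | head =>
      obtain ⟨hi, hj⟩ := Const.le_of_allows hij
      have key : ∀ i j, c.allows i j = true →
          (bif c.allows i j then checkComp N r i j else true) = true →
          (toRule (r.rule i j)).Valid := by
        intro i j hij h
        rw [hij, cond_true] at h
        exact checkComp_sound hN h
      interval_cases i <;> interval_cases j
      · exact key _ _ hij h00
      · exact key _ _ hij h01
      · exact key _ _ hij h10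
      · exact key _ _ hij h11

/-- The constants with computation rules. -/
def compList : List (Const × Comp) :=
  [(.sigmaInd, .sigma), (.unitInd, .unit), (.sumInd, .inl), (.sumInd, .inr), (.natInd, .zero),
    (.natInd, .succ), (.listInd, .nil), (.listInd, .cons), (.idInd, .refl), (.truncInd, .trunc),
    (.defined .symm, .defined .symm), (.defined .concat, .defined .concat),
    (.defined .ap, .defined .ap), (.defined .transport, .defined .transport),
    (.defined .append, .defined .append), (.defined .bar, .defined .bar)]

theorem norm_noRules_sound (n : ℕ) : (norm 43 noRules n).Sound :=
  norm_sound constTypes_basic noRules_sound n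

-- The sides of these rules receive their types by β alone, so no rule takes part in its own
-- validation.
set_option maxRecDepth 10000 in
theorem compList_valid : checkComps (norm 43 noRules 20) compList = true := by decide +kernel

theorem compRule_mem {c : Const} {l σ : List Tm} {r : Comp} (h : compRule c l = some (r, σ)) :
    (c, r) ∈ compList := by
  unfold compRule at h
  split at h <;> cases h <;> try simp [compList]
  cases Nat.beq _ 12 <;> simp

theorem compRules_sound : compRules.Sound := by
  intro Γ c l r σ h
  unfold compRules at h
  split at h
  · rename_i r' σ' hr
    split at h
    rename_i i j _
    cases hij : c.allows i j with
    | false => rw [hij] at h; cases h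
    | true =>
      rw [hij] at h
      cases h
      exact checkComps_sound (norm_noRules_sound 20) compList_valid (compRule_mem hr) hij
  · cases h

/-! ## Derived computation rules -/

/-- The computation rules of the defined functions. -/
inductive DerivedRule : Type
  | symmRefl | concatRefl | apRefl | transportRefl | appendNil | appendCons | barInl | barInr

/-- The sides and the type of a derived rule. -/
def DerivedRule.rule (i j : ℕ) : DerivedRule → Exp × Exp × Exp
  | symmRefl => Abs (U i) fun A => Abs A fun x =>
      (symm A x x (reflAt A x), reflAt A x, Id A x x)
  | concatRefl => Abs (U i) fun A => Abs A fun x => Abs A fun y => Abs (Id A x y) fun p =>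
      (concat A x y y p (reflAt A y), p, Id A x y)
  | apRefl => Abs (U i) fun A => Abs (U i) fun B => Abs (A ⇒ B) fun f => Abs A fun x =>
      (ap A B f x x (reflAt A x), reflAt B (f x), Id B (f x) (f x))
  | transportRefl => Abs (U i) fun A => Abs (A ⇒ U j) fun P => Abs A fun x => Abs (P x) fun u =>
      (transport A P x x (reflAt A x) u, u, P x)
  | appendNil => Abs (U i) fun A => Abs (LS A) fun y => (append A (nil A) y, y, LS A)
  | appendCons => Abs (U i) fun A => Abs (Signed A) fun a => Abs (LS A) fun x =>
      Abs (LS A) fun y => (append A (cons A a x) y, cons A a (append A x y), LS A)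
  | barInl => Abs (U i) fun A => Abs A fun a =>
      (bar A (K .inl A A a), K .inr A A a, Signed A)
  | barInr => Abs (U i) fun A => Abs A fun a =>
      (bar A (K .inr A A a), K .inl A A a, Signed A)

/-- The rule that applies to an eliminator or a defined function, as equality of closed
functions. -/
def ruleOf (i j : ℕ) : Const → List Tm → Option ((Exp × Exp × Exp) × List Tm)
  | .defined .symm, [A, x, _, _] => some (DerivedRule.symmRefl.rule i j, [x, A])
  | .defined .concat, [A, x, y, _, p, _] => some (DerivedRule.concatRefl.rule i j, [p, y, x, A])
  | .defined .ap, [A, B, f, x, _, _] => some (DerivedRule.apRefl.rule i j, [x, f, B, A])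
  | .defined .transport, [A, P, x, _, _, u] =>
    some (DerivedRule.transportRefl.rule i j, [u, x, P, A])
  | .defined .append, [A, .app (.app _ a) x, y] =>
    some (DerivedRule.appendCons.rule i j, [y, x, a, A])
  | .defined .append, [A, _, y] => some (DerivedRule.appendNil.rule i j, [y, A])
  | .defined .bar, [A, .app (.app (.app (.const k) _) _) a] =>
    some (cond (Nat.beq k.code 12) (DerivedRule.barInl.rule i j) (DerivedRule.barInr.rule i j),
      [a, A])
  | .defined _, _ => none
  | c, l => match compRule c l with
    | some (r, σ) => some (r.rule i j, σ)
    | none => none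

/-- The computation rules that do not concern `N`. -/
def rules : Strategy := fun Γ c l =>
  match c.levels Γ l with
  | (i, j) => cond (c.allows i j)
    (match ruleOf i j c l with
      | some (r, σ) => some (toRule r, σ)
      | none => none)
    none

/-- Check the rules, except for the one for `append` and `cons`, by normalization. -/
def checkDerived (N : Normalizer) : List (Const × DerivedRule) → Bool
  | [] => true
  | (c, r) :: l => cond (checkDerived N l)
      (let ok := fun i j => cond (c.allows i j) (checkJoin N (toRule (r.rule i j))) true
      cond (ok 0 0) (cond (ok 0 1) (cond (ok 1 0) (ok 1 1) false) false) false) false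

def derivedList : List (Const × DerivedRule) :=
  [(.defined .symm, .symmRefl), (.defined .concat, .concatRefl), (.defined .ap, .apRefl),
    (.defined .transport, .transportRefl), (.defined .append, .appendNil),
    (.defined .bar, .barInl), (.defined .bar, .barInr)]

set_option maxRecDepth 10000 in
theorem derivedList_valid : checkDerived (norm 43 compRules 20) derivedList = true := by
  decide +kernel

theorem checkDerived_sound {N : Normalizer} (hN : N.Sound) {l : List (Const × DerivedRule)}
    (h : checkDerived N l = true) {c : Const} {r : DerivedRule} (hc : (c, r) ∈ l) {i j : ℕ}
    (hij : c.allows i j = true) : (toRule (r.rule i j)).Valid := by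
  induction l with
  | nil => cases hc
  | cons a l ih =>
    simp only [checkDerived, Bool.cond_false_right, Bool.and_eq_true] at h
    obtain ⟨h, h00, h01, h10, h11⟩ := h
    cases hc with
    | tail _ hc => exact ih h hc
    | head =>
      obtain ⟨hi, hj⟩ := Const.le_of_allows hij
      have key : ∀ i j, c.allows i j = true →
          (bif c.allows i j then checkJoin N (toRule (r.rule i j)) else true) = true →
          (toRule (r.rule i j)).Valid := by
        intro i j hij h
        rw [hij, cond_true] at h
        exact checkJoin_sound hN h
      interval_cases i <;> interval_cases j
      · exact key _ _ hij h00
      · exact key _ _ hij h01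
      · exact key _ _ hij h10
      · exact key _ _ hij h11

theorem norm_compRules_sound (n : ℕ) : (norm 43 compRules n).Sound :=
  norm_sound constTypes_basic compRules_sound n

/-- The value of `append A x y` by its defining equation, in the context of `appendCons`. -/
def appendUnfolded : Tm :=
  (toRule ((Comp.defined .append).rule 1 1)).rhs.close [.var 0, .var 1, .var 3]

/-- Normalization does not join the two sides. On the left, `append` unfolds to `listInd` and leaves
a recursive call in unfolded form; on the right, `append x y` is stuck at a variable. The recursive
call is folded by using the defining equation backwards under `cons a`. -/
theorem appendCons_valid : (toRule (DerivedRule.appendCons.rule 1 1)).Valid := by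
  have hN := norm_compRules_sound 20
  let r := toRule (DerivedRule.appendCons.rule 1 1)
  let c : Tm := .app (.app (.const .cons) (.app (.app (.const .sum) (.var 3)) (.var 3))) (.var 2)
  -- The left side equals `cons a` of the unfolded `append x y`; this part is found by
  -- normalization.
  have h1 : ({ r with rhs := .app c appendUnfolded } : Rule).Valid :=
    checkJoin_sound (N := norm 43 compRules 20) hN (by decide +kernel)
  have h2 := checkSides_sound (N := norm 43 compRules 20) hN
    (r := ⟨r.tel, c, c, .pi r.ty (r.ty.lift 1 0)⟩) (by decide +kernel)
  -- The defining equation of `append` at the variables `x` and `y`, which the strategy does not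
  -- apply because `x` is not a constructor.
  have h3 : Eqv r.tel (.app (.app (.app (.const (.defined .append)) (.var 3)) (.var 1)) (.var 0))
      appendUnfolded r.ty := by
    have hv : (toRule ((Comp.defined .append).rule 1 1)).Valid :=
      checkComps_sound (norm_noRules_sound 20) compList_valid
        (c := .defined .append) (by simp [compList]) rfl
    have hσ : IsSubst (toRule ((Comp.defined .append).rule 1 1)).tel r.tel
        (Tm.ofList [.var 0, .var 1, .var 3]) :=
      checkSubst_sound (N := norm 43 compRules 20) hN h2.1.wf hv.1.wf (by decide +kernel)
    have := hv.1.subst h2.1.wf hσ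
    rwa [← Tm.close_eq, ← Tm.close_eq, ← Tm.close_eq] at this
  have h4 := Derivable.eqApp _ _ _ _ _ _ _ (.eqRefl _ _ _ h2.1) h3
  exact ⟨.eqTrans _ _ _ _ _ h1.1 (.eqSymm _ _ _ _ h4), h1.2⟩

theorem compRule_valid {c : Const} {l σ : List Tm} {r : Comp} (h : compRule c l = some (r, σ))
    {i j : ℕ} (hij : c.allows i j = true) : (toRule (r.rule i j)).Valid :=
  checkComps_sound (norm_noRules_sound 20) compList_valid (compRule_mem h) hij

theorem rules_sound : rules.Sound := by
  intro Γ c l r σ h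
  unfold rules at h
  split at h
  rename_i i j _
  cases hij : c.allows i j with
  | false => rw [hij] at h; cases h
  | true =>
    rw [hij, cond_true] at h
    split at h
    · rename_i r' σ' hr
      cases h
      have derived : ∀ {d : DerivedRule}, (c, d) ∈ derivedList →
          (toRule (d.rule i j)).Valid := fun hd =>
        checkDerived_sound (norm_compRules_sound 20) derivedList_valid hd hij
      unfold ruleOf at hr
      split at hr
      · cases hr; exact derived (by simp [derivedList])
      · cases hr; exact derived (by simp [derivedList])
      · cases hr; exact derived (by simp [derivedList])
      · cases hr; exact derived (by simp [derivedList])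
      · cases hr
        -- For `append` the only allowed levels are those at which the rule has been validated.
        have : i = 1 ∧ j = 1 := by
          simpa [Const.allows, Const.isFormer, Const.motive] using hij
        rw [this.1, this.2]
        exact appendCons_valid
      · cases hr; exact derived (by simp [derivedList])
      · simp only [Option.some.injEq, Prod.mk.injEq] at hr
        rw [← hr.1]
        cases Nat.beq _ 12
        · exact derived (d := .barInr) (by simp [derivedList])
        · exact derived (d := .barInl) (by simp [derivedList])
      · cases hr
      · split at hr
        · rename_i hc
          cases hr
          exact compRule_valid hc hij
        · cases hr
    · cases h

end HoTT

/-! ### The constructors and the induction principle of `N(A)` in the checker -/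

namespace HoTT

-- The paths composed in `sw` and `ov` fit together only because `append` computes, for instance
-- because `redex a y ++ z` is `redex a (y ++ z)`; hence these types are checked with the rules. The
-- bound `47` excludes `NIndTau` and univalence at positive levels, neither of which is needed.
set_option maxRecDepth 10000 in
theorem constTypes : ConstTypes 47 :=
  checkTypes_sound (n := 4) rules_sound constTypes_basic (by decide +kernel)

theorem norm_rules_sound (n : ℕ) : (norm 47 rules n).Sound :=
  norm_sound constTypes rules_sound n

set_option maxRecDepth 10000 in
theorem NInd_rule_valid : (toRule (Comp.eta.rule 1 1)).Valid :=
  checkComp_sound (norm_rules_sound 20) (by decide +kernel)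

/-- The computation rules. -/
def allRules : Strategy := fun Γ c l =>
  match c, l with
  | .NInd, [A, P, e, t, s, o, h, .app _ x] =>
    some (toRule (Comp.eta.rule 1 1), [x, h, o, s, t, e, P, A])
  | c, l => rules Γ c l

theorem allRules_sound : allRules.Sound := by
  intro Γ c l r σ h
  unfold allRules at h
  split at h
  · cases h; exact NInd_rule_valid
  · exact rules_sound _ _ _ _ _ h

/-- The normalizer with all rules. -/
def nf (n : ℕ) : Normalizer := norm 47 allRules n

theorem nf_sound (n : ℕ) : (nf n).Sound := norm_sound constTypes allRules_sound n

end HoTT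

namespace HoTT

/-! ## Theories -/

/-- A context all of whose entries are theorems. -/
def Theory (Γ : Ctx) : Prop := Wf Γ ∧ ∃ σ, IsSubst Γ [] (Tm.ofList σ)

theorem Theory.nil : Theory [] := ⟨.ctxNil, [], fun _ _ h => nomatch h⟩

/-- Check a proof of a statement. -/
def checkProof (Γ : Ctx) (D t : Tm) : Bool :=
  match nf 30 Γ D none with
  | some (D', .univ _) => (nf 30 Γ t (some D')).isSome
  | _ => false

theorem checkProof_sound {Γ : Ctx} {D t : Tm} (hΓ : Wf Γ) (h : checkProof Γ D t = true) :
    Typ Γ t D ∧ ∃ k, Typ Γ D (.univ k) := by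
  unfold checkProof at h
  split at h
  · rename_i D' k hD
    obtain ⟨hD, -⟩ := nf_sound 30 _ _ _ _ _ hΓ .none hD
    obtain ⟨⟨t', T⟩, ht⟩ := Option.isSome_iff_exists.mp h
    obtain ⟨h1, h2⟩ := nf_sound 30 _ _ _ _ _ hΓ (.some hD.right) ht
    cases h2 _ rfl
    exact ⟨.conv _ _ _ _ _ h1.left (.eqSymm _ _ _ _ hD.eqv), k, hD.left⟩
  · cases h

/-- The substitution replaces all entries by closed proofs, and the new proof is closed by applying
it. Inside later proofs the entry remains a variable, so its proof is never unfolded by the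
normalizer. -/
theorem Theory.cons {Γ : Ctx} {D t : Tm} (h : Theory Γ) (ht : checkProof Γ D t = true) :
    Theory (D :: Γ) := by
  obtain ⟨hΓ, σ, hσ⟩ := h
  obtain ⟨ht, k, hD⟩ := checkProof_sound hΓ ht
  exact ⟨hD.cons_wf, _, hσ.cons (ht.subst .ctxNil hσ)⟩

/-- The realizing substitution sends the variable `0` to a closed proof; its type is the statement
itself because a closed term is not affected by substitution. -/
theorem Theory.isTheorem {Γ : Ctx} {T : Exp} {n : ℕ} (h : Theory (T.toTm n :: Γ))
    (he : T.toTm n = T.closed) (hT : T.closed.closedAt 0 = true) : IsTheorem T := by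
  obtain ⟨hΓ, σ, hσ⟩ := he ▸ h
  have := hσ _ _ (.zero _ _)
  rw [Tm.wk, Tm.rename_closed hT, Tm.subst_closed hT] at this
  exact ⟨_, this⟩

theorem IsTheorem.raise (k : ℕ) {T T' : Exp} (h : IsTheorem T)
    (hT : T.closed.raise k = T'.closed) : IsTheorem T' := by
  obtain ⟨t, ht⟩ := h
  exact ⟨t.raise k, hT ▸ ht.raise k⟩

/-- A statement with a proof that may use earlier statements. -/
structure Entry : Type where
  /-- The statement. -/
  stmt : Exp
  /-- The proof. -/
  proof : Exp

/-- The statements in a list of entries as a context. -/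
def ctxOf : List Entry → Ctx
  | [] => []
  | e :: l => e.stmt.toTm l.length :: ctxOf l

/-- Check the first entry of a list. -/
def checkEntry (e : Entry) (l : List Entry) : Bool :=
  checkProof (ctxOf l) (e.stmt.toTm l.length) (e.proof.toTm l.length)

theorem Theory.entry {l : List Entry} (h : Theory (ctxOf l)) {e : Entry}
    (he : checkEntry e l = true) : Theory (ctxOf (e :: l)) := h.cons he

/-! ## Typed expressions -/

namespace Typed

/-- An expression that is meant to have the type `A`. -/
structure El (A : Exp) : Type where
  /-- The expression. -/
  val : Exp

instance {i : ℕ} : CoeOut (El (U i)) Exp := ⟨El.val⟩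

/-- A type as an element of a universe. -/
def ty {i : ℕ} (A : Exp) : El (U i) := ⟨A⟩

/-- An element of a type that is judgmentally equal to `A`. -/
def recast {A B : Exp} (a : El A) : El B := ⟨a.val⟩

/-- An earlier theorem, given by its position, applied to arguments. -/
def cite {A : Exp} (n : ℕ) (l : List Exp) : El A := ⟨l.foldl App (Exp.bound n)⟩

def Pi (A : Exp) (B : El A → Exp) : Exp := HoTT.Pi A fun x => B ⟨x⟩

abbrev Fn (A B : Exp) : Exp := Pi A fun _ => B

infixr:25 " ⇾ " => Fn

def lam {A : Exp} {B : El A → Exp} (b : (x : El A) → El (B x)) : El (Pi A B) :=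
  ⟨Lam A fun x => (b ⟨x⟩).val⟩

def app {A : Exp} {B : El A → Exp} (f : El (Pi A B)) (a : El A) : El (B a) := ⟨App f.val a.val⟩

instance {A : Exp} {B : El A → Exp} : CoeFun (El (Pi A B)) (fun _ => (a : El A) → El (B a)) :=
  ⟨app⟩

def Sig (A : Exp) (B : El A → Exp) : Exp := HoTT.Sig A fun x => B ⟨x⟩

abbrev Prod (A B : Exp) : Exp := Sig A fun _ => B

infixr:35 " ⊗ " => Prod

/-- A family of types as a function. -/
def fam {A : Exp} (B : El A → Exp) : Exp := Lam A fun x => B ⟨x⟩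

def pair {A : Exp} {B : El A → Exp} (a : El A) (b : El (B a)) : El (Sig A B) :=
  ⟨K .pair A (fam B) a.val b.val⟩

def sigInd {A : Exp} {B : El A → Exp} (P : El (Sig A B) → Exp) (w : El (Sig A B))
    (f : (a : El A) → (b : El (B a)) → El (P (pair a b))) : El (P w) :=
  ⟨K .sigmaInd A (fam B) (fam P) (lam fun a => lam fun b => f a b).val w.val⟩

def splitC {A : Exp} {B : El A → Exp} {C : Exp} (w : El (Sig A B))
    (f : (a : El A) → El (B a) → El C) : El C := sigInd (fun _ => C) w f

def fst {A : Exp} {B : El A → Exp} (w : El (Sig A B)) : El A := splitC w fun a _ => a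

def snd {A : Exp} {B : El A → Exp} (w : El (Sig A B)) : El (B (fst w)) :=
  sigInd (fun w => B (fst w)) w fun _ b => recast b

def EmptyT : Exp := K .empty

def absurd {C : Exp} (e : El EmptyT) : El C := ⟨K .emptyInd (fam fun _ : El EmptyT => C) e.val⟩

def UnitT : Exp := K .unit

def star : El UnitT := ⟨K .star⟩

def unitInd (P : El UnitT → Exp) (u : El UnitT) (c : El (P star)) : El (P u) :=
  ⟨K .unitInd (fam P) c.val u.val⟩

def SumT (A B : Exp) : Exp := K .sum A B

infixr:30 " ⊎ " => SumT

def inl {A B : Exp} (a : El A) : El (A ⊎ B) := ⟨K .inl A B a.val⟩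

def inr {A B : Exp} (b : El B) : El (A ⊎ B) := ⟨K .inr A B b.val⟩

def sumInd {A B : Exp} (P : El (A ⊎ B) → Exp) (w : El (A ⊎ B))
    (f : (a : El A) → El (P (inl a))) (g : (b : El B) → El (P (inr b))) : El (P w) :=
  ⟨K .sumInd A B (fam P) (lam f).val (lam g).val w.val⟩

def NatT : Exp := K .nat

def zero : El NatT := ⟨K .zero⟩

def succ (n : El NatT) : El NatT := ⟨K .succ n.val⟩

def natInd (P : El NatT → Exp) (n : El NatT) (c : El (P zero))
    (f : (n : El NatT) → El (P n) → El (P (succ n))) : El (P n) :=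
  ⟨K .natInd (fam P) c.val (lam fun n => lam fun h => f n h).val n.val⟩

def ListT (A : Exp) : Exp := K .list A

def nil {A : Exp} : El (ListT A) := ⟨K .nil A⟩

def cons {A : Exp} (a : El A) (x : El (ListT A)) : El (ListT A) := ⟨K .cons A a.val x.val⟩

def listInd {A : Exp} (P : El (ListT A) → Exp) (x : El (ListT A)) (c : El (P nil))
    (f : (a : El A) → (x : El (ListT A)) → El (P x) → El (P (cons a x))) : El (P x) :=
  ⟨K .listInd A (fam P) c.val (lam fun a => lam fun x => lam fun h => f a x h).val x.val⟩

def Id (A : Exp) (x y : El A) : Exp := HoTT.Id A x.val y.val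

def refl {A : Exp} {x : El A} : El (Id A x x) := ⟨reflAt A x.val⟩

def J {A : Exp} {x : El A} (P : (y : El A) → El (Id A x y) → Exp) {y : El A}
    (p : El (Id A x y)) (d : El (P x refl)) : El (P y p) :=
  -- The level given to `ty` is a phantom index of `El`; it does not occur in the term.
  ⟨K .idInd A x.val (lam fun y => lam fun p => ty (i := 0) (P y p)).val d.val y.val p.val⟩

def symm {A : Exp} {x y : El A} (p : El (Id A x y)) : El (Id A y x) :=
  ⟨HoTT.symm A x.val y.val p.val⟩

def concat {A : Exp} {x y z : El A} (p : El (Id A x y)) (q : El (Id A y z)) : El (Id A x z) :=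
  ⟨HoTT.concat A x.val y.val z.val p.val q.val⟩

infixr:60 " ⬝ " => concat

def ap {A B : Exp} (f : El A → El B) {x y : El A} (p : El (Id A x y)) : El (Id B (f x) (f y)) :=
  ⟨HoTT.ap A B (Lam A fun x => (f ⟨x⟩).val) x.val y.val p.val⟩

def transport {A : Exp} (P : El A → Exp) {x y : El A} (p : El (Id A x y)) (u : El (P x)) :
    El (P y) :=
  ⟨HoTT.transport A (fam P) x.val y.val p.val u.val⟩

abbrev isProp (A : Exp) : Exp := Pi A fun x => Pi A fun y => Id A x y

abbrev isSet (A : Exp) : Exp := Pi A fun x => Pi A fun y => isProp (Id A x y)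

abbrev isEquiv (A B : Exp) (f : El A → El B) : Exp :=
  (Sig (B ⇾ A) fun g => Pi B fun y => Id B (f (g y)) y) ⊗
    Sig (B ⇾ A) fun h => Pi A fun x => Id A (h (f x)) x

def Trunc (A : Exp) : Exp := K .trunc A

def mk {A : Exp} (a : El A) : El (Trunc A) := ⟨K .truncMk A a.val⟩

def truncEq {A : Exp} : El (isProp (Trunc A)) := ⟨K .truncEq A⟩

def untrunc {A C : Exp} (w : El (Trunc A)) (h : El (isProp C)) (f : El A → El C) : El C :=
  ⟨K .truncInd A (fam fun _ : El (Trunc A) => C) (Lam (Trunc A) fun _ => h.val) (lam f).val w.val⟩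

/-- A theorem with its proof. -/
def entry (stmt : Exp) (proof : El stmt) : Entry := ⟨stmt, proof.val⟩

end Typed

end HoTT

namespace HoTT.Typed

/-! A theorem `T` of the type theory is given by the list `T.library` that consists of `T` and the
theorems before it, the proof `T.theory` that this list is a theory, and the position `T.index` by
which later proofs cite it. A function named `T` applies the theorem with inferred arguments. -/

set_option linter.unusedVariables false
set_option maxRecDepth 10000

/-! ## Elimination rules without computation -/

/-- Cited as a variable, this eliminator never reduces, which keeps the normal forms of proofs
small. Where computation or a dependent motive matters, `sigInd` is used. -/
def split.library : List Entry := entry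
  (Pi (U 1) fun A => Pi (A ⇾ U 1) fun B => Pi (U 1) fun C => (Sig A fun x => B x) ⇾
    (Pi A fun x => B x ⇾ C) ⇾ C)
  (lam fun A => lam fun B => lam fun C => lam fun w => lam fun f =>
    splitC w fun x y => f x y) :: []

theorem split.theory : Theory (ctxOf split.library) :=
  Theory.entry (l := []) Theory.nil (by decide +kernel)

def split.index : ℕ := 0

def split {A : Exp} {B : El A → Exp} {C : Exp} (w : El (Sig A B))
    (f : (a : El A) → El (B a) → El C) : El C :=
  cite split.index [A, fam B, C, w.val, (lam fun a => lam fun b => f a b).val]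

def cases.library : List Entry := entry
  (Pi (U 1) fun A => Pi (U 1) fun B => Pi (U 1) fun C => A ⊎ B ⇾ (A ⇾ C) ⇾ (B ⇾ C) ⇾ C)
  (lam fun A => lam fun B => lam fun C => lam fun w => lam fun f => lam fun g =>
    sumInd (fun _ => C) w (fun a => f a) (fun b => g b)) :: split.library

theorem cases.theory : Theory (ctxOf cases.library) :=
  split.theory.entry (by decide +kernel)

def cases.index : ℕ := split.index + 1

def cases {A B C : Exp} (w : El (A ⊎ B)) (f : El A → El C) (g : El B → El C) : El C :=
  cite cases.index [A, B, C, w.val, (lam f).val, (lam g).val]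

/-! ## Paths -/

/-- `concat` is defined by induction on its second path: the right unit law is judgmental, while the
left one needs path induction. -/
def reflConcat.library : List Entry := entry
  (Pi (U 1) fun A => Pi A fun x => Pi A fun y => Pi (Id A x y) fun p =>
    Id (Id A x y) (refl ⬝ p) p)
  (lam fun A => lam fun x => lam fun y => lam fun p =>
    J (fun y p => Id (Id A x y) (refl ⬝ p) p) p (recast (refl (A := Id A x x) (x := refl)))) :: cases.library

theorem reflConcat.theory : Theory (ctxOf reflConcat.library) :=
  cases.theory.entry (by decide +kernel)

def reflConcat.index : ℕ := cases.index + 1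

def reflConcat {A : Exp} {x y : El A} (p : El (Id A x y)) : El (Id (Id A x y) (refl ⬝ p) p) :=
  cite reflConcat.index [A, x.val, y.val, p.val]

def symmConcat.library : List Entry := entry
  (Pi (U 1) fun A => Pi A fun x => Pi A fun y => Pi (Id A x y) fun p =>
    Id (Id A y y) (symm p ⬝ p) refl)
  (lam fun A => lam fun x => lam fun y => lam fun p =>
    J (fun y p => Id (Id A y y) (symm p ⬝ p) refl) p
      (recast (refl (A := Id A x x) (x := refl)))) :: reflConcat.library

theorem symmConcat.theory : Theory (ctxOf symmConcat.library) :=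
  reflConcat.theory.entry (by decide +kernel)

def symmConcat.index : ℕ := reflConcat.index + 1

def symmConcat {A : Exp} {x y : El A} (p : El (Id A x y)) :
    El (Id (Id A y y) (symm p ⬝ p) refl) :=
  cite symmConcat.index [A, x.val, y.val, p.val]

/-- A point `b` at which paths are determined by the values of a family of propositions. -/
def isPropIdAt.library : List Entry := entry
  (Pi (U 1) fun X => Pi X fun b => Pi (X ⇾ U 1) fun C => (Pi X fun m => isProp (C m)) ⇾ C b ⇾
    (Pi X fun m => C m ⇾ Id X b m) ⇾ Pi X fun m => isProp (Id X b m))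
  (lam fun X => lam fun b => lam fun C => lam fun hC => lam fun c => lam fun d => lam fun m =>
    lam fun p => lam fun q =>
    -- The correction by `symm (d b c)` makes `F` send the transport of `c` along `p` to `p`: for `p
    -- = refl` this is the law `symm q ⬝ q = refl`. Hence `b = m` is a retract of the proposition `C
    -- m`.
    let F : (m : El X) → El (C m) → El (Id X b m) := fun m c' => symm (d b c) ⬝ d m c'
    let key : (p : El (Id X b m)) →
        El (Id (Id X b m) (F m (transport (fun m => C m) p c)) p) := fun p =>
      J (fun m p => Id (Id X b m) (F m (transport (fun m => C m) p c)) p) p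
        (recast (symmConcat (d b c)))
    symm (key p) ⬝ ap (F m) (hC m (transport (fun m => C m) p c) (transport (fun m => C m) q c)) ⬝
      key q) :: symmConcat.library

theorem isPropIdAt.theory : Theory (ctxOf isPropIdAt.library) :=
  symmConcat.theory.entry (by decide +kernel)

def isPropIdAt.index : ℕ := symmConcat.index + 1

def isPropIdAt {X : Exp} {b : El X} {C : El X → Exp} (hC : El (Pi X fun m => isProp (C m)))
    (c : El (C b)) (d : El (Pi X fun m => C m ⇾ Id X b m)) :
    El (Pi X fun m => isProp (Id X b m)) :=
  cite isPropIdAt.index [X, b.val, fam C, hC.val, c.val, d.val]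

/-- A type is a set if it has a reflexive family of propositions that implies equality. -/
def setOfRel.library : List Entry := entry
  (Pi (U 1) fun X => Pi (X ⇾ X ⇾ U 1) fun R => (Pi X fun x => Pi X fun y => isProp (R x y)) ⇾
    (Pi X fun x => R x x) ⇾ (Pi X fun x => Pi X fun y => R x y ⇾ Id X x y) ⇾ isSet X)
  (lam fun X => lam fun R => lam fun hR => lam fun r => lam fun d => lam fun x =>
    isPropIdAt (C := fun y => R x y) (hR x) (r x) (d x)) :: isPropIdAt.library

theorem setOfRel.theory : Theory (ctxOf setOfRel.library) :=
  isPropIdAt.theory.entry (by decide +kernel)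

def setOfRel.index : ℕ := isPropIdAt.index + 1

def setOfRel {X : Exp} (R : El X → El X → Exp) (hR : (x y : El X) → El (isProp (R x y)))
    (r : (x : El X) → El (R x x)) (d : (x y : El X) → El (R x y) → El (Id X x y)) :
    El (isSet X) :=
  cite setOfRel.index [X, Lam X fun x => fam (R ⟨x⟩), (lam fun x => lam fun y => hR x y).val, (lam r).val,
    (lam fun x => lam fun y => lam fun h => d x y h).val]

/-- The constant relation `X` serves in `setOfRel`: it is a proposition, its element `x` proves
reflexivity, and any two points are equal anyway. -/
def propIsSet.library : List Entry := entry
  (Pi (U 1) fun X => isProp X ⇾ isSet X)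
  (lam fun X => lam fun h => setOfRel (fun _ _ => X) (fun _ _ => h) (fun x => x)
    (fun x y _ => h x y)) :: setOfRel.library

theorem propIsSet.theory : Theory (ctxOf propIsSet.library) :=
  setOfRel.theory.entry (by decide +kernel)

def propIsSet.index : ℕ := setOfRel.index + 1

def propIsSet {X : Exp} (h : El (isProp X)) : El (isSet X) := cite propIsSet.index [X, h.val]

/-- An equivalence has an inverse. -/
def equivInv.library : List Entry := entry
  (Pi (U 1) fun A => Pi (U 1) fun B => Pi (A ⇾ B) fun f => isEquiv A B (fun x => f x) ⇾ B ⇾ A)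
  (lam fun A => lam fun B => lam fun f => lam fun e =>
    split e fun r _ => split r fun g _ => g) :: propIsSet.library

theorem equivInv.theory : Theory (ctxOf equivInv.library) :=
  propIsSet.theory.entry (by decide +kernel)

def equivInv.index : ℕ := propIsSet.index + 1

def equivInv {A B : Exp} {f : El (A ⇾ B)} (e : El (isEquiv A B fun x => f x)) (b : El B) : El A :=
  cite equivInv.index [A, B, f.val, e.val, b.val]

/-- Function extensionality. -/
def fe.library : List Entry := entry
  (Pi (U 1) fun A => Pi (A ⇾ U 1) fun B => Pi (Pi A fun x => B x) fun f =>
    Pi (Pi A fun x => B x) fun g => (Pi A fun x => Id (B x) (f x) (g x)) ⇾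
      Id (Pi A fun x => B x) f g)
  (lam fun A => lam fun B => lam fun f => lam fun g => lam fun h =>
    equivInv (f := ⟨happly A B.val f.val g.val⟩) ⟨HoTT.K .funext A B.val f.val g.val⟩ h) :: equivInv.library

theorem fe.theory : Theory (ctxOf fe.library) :=
  equivInv.theory.entry (by decide +kernel)

def fe.index : ℕ := equivInv.index + 1

def fe {A : Exp} {B : El A → Exp} {f g : El (Pi A B)}
    (h : (x : El A) → El (Id (B x) (f x) (g x))) : El (Id (Pi A B) f g) :=
  cite fe.index [A, fam B, f.val, g.val, (lam h).val]

def isPropPi {A : Exp} {B : El A → Exp} (h : (x : El A) → El (isProp (B x))) :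
    El (isProp (Pi A B)) :=
  lam fun f => lam fun g => fe fun x => h x (f x) (g x)

/-- Equality of pairs whose second components are elements of propositions. -/
def pairEq.library : List Entry := entry
  (Pi (U 1) fun A => Pi (A ⇾ U 1) fun B => (Pi A fun x => isProp (B x)) ⇾ Pi A fun a =>
    Pi A fun a' => Id A a a' ⇾ Pi (B a) fun b => Pi (B a') fun b' =>
      Id (Sig A fun x => B x) (pair a b) (pair a' b'))
  (lam fun A => lam fun B => lam fun h => lam fun a => lam fun a' => lam fun p => lam fun b =>
    J (fun a' _ => Pi (B a') fun b' => Id (Sig A fun x => B x) (pair a b) (pair a' b')) p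
      (lam fun b' => ap (fun b => pair (B := fun x => B x) a b) (h a b b'))) :: fe.library

theorem pairEq.theory : Theory (ctxOf pairEq.library) :=
  fe.theory.entry (by decide +kernel)

def pairEq.index : ℕ := fe.index + 1

def pairEq {A : Exp} {B : El A → Exp} (h : El (Pi A fun x => isProp (B x))) {a a' : El A}
    (p : El (Id A a a')) (b : El (B a)) (b' : El (B a')) :
    El (Id (Sig A B) (pair a b) (pair a' b')) :=
  cite pairEq.index [A, fam B, h.val, a.val, a'.val, p.val, b.val, b'.val]

def isPropIsProp.library : List Entry := entry
  (Pi (U 1) fun A => isProp (isProp A))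
  (lam fun A => lam fun f => lam fun g => fe fun x => fe fun y =>
    propIsSet f x y (f x y) (g x y)) :: pairEq.library

theorem isPropIsProp.theory : Theory (ctxOf isPropIsProp.library) :=
  pairEq.theory.entry (by decide +kernel)

def isPropIsProp.index : ℕ := pairEq.index + 1

def isPropIsProp {A : Exp} : El (isProp (isProp A)) := cite isPropIsProp.index [A]

def isSetPi.library : List Entry := entry
  (Pi (U 1) fun A => Pi (A ⇾ U 1) fun B => (Pi A fun x => isSet (B x)) ⇾
    isSet (Pi A fun x => B x))
  (lam fun A => lam fun B => lam fun h =>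
    setOfRel (fun f g => Pi A fun x => Id (B x) (f x) (g x))
      (fun f g => isPropPi fun x => h x (f x) (g x)) (fun f => lam fun x => refl)
      (fun f g k => fe fun x => k x)) :: isPropIsProp.library

theorem isSetPi.theory : Theory (ctxOf isSetPi.library) :=
  isPropIsProp.theory.entry (by decide +kernel)

def isSetPi.index : ℕ := isPropIsProp.index + 1

def isSetPi {A : Exp} {B : El A → Exp} (h : El (Pi A fun x => isSet (B x))) :
    El (isSet (Pi A B)) :=
  cite isSetPi.index [A, fam B, h.val]

def equivType (X Y : Exp) : Exp := Sig (X ⇾ Y) fun f => isEquiv X Y fun x => f x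

/-- Equivalent propositions are equal. -/
def propExt.library : List Entry := entry
  (Pi (U 0) fun X => Pi (U 0) fun Y => isProp X ⇾ isProp Y ⇾ (X ⇾ Y) ⇾ (Y ⇾ X) ⇾ Id (U 0) X Y)
  (lam fun X => lam fun Y => lam fun hX => lam fun hY => lam fun f => lam fun g =>
    equivInv (B := equivType X Y) (f := ⟨idToEquiv 0 X Y⟩) ⟨HoTT.K (.univalence 0) X.val Y.val⟩
      (pair f (pair (pair g (lam fun y => hY (f (g y)) y))
        (pair g (lam fun x => hX (g (f x)) x))))) :: isSetPi.library

theorem propExt.theory : Theory (ctxOf propExt.library) :=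
  isSetPi.theory.entry (by decide +kernel)

def propExt.index : ℕ := isSetPi.index + 1

def propExt {X Y : Exp} (hX : El (isProp X)) (hY : El (isProp Y)) (f : El (X ⇾ Y))
    (g : El (Y ⇾ X)) : El (Id (U 0) (ty X) (ty Y)) :=
  cite propExt.index [X, Y, hX.val, hY.val, f.val, g.val]

/-- The type of propositions. -/
def HProp : Exp := Sig (U 0) fun X => isProp X

def isPropProd.library : List Entry := entry
  (Pi (U 1) fun A => Pi (U 1) fun B => isProp A ⇾ isProp B ⇾ isProp (A ⊗ B))
  (lam fun A => lam fun B => lam fun hA => lam fun hB => lam fun v => lam fun w =>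
    sigInd (fun v => Id (A ⊗ B) v w) v fun a b => sigInd (fun w => Id (A ⊗ B) (pair a b) w) w
      fun a' b' => pairEq (lam fun _ => hB) (hA a a') b b') :: propExt.library

theorem isPropProd.theory : Theory (ctxOf isPropProd.library) :=
  propExt.theory.entry (by decide +kernel)

def isPropProd.index : ℕ := propExt.index + 1

def isPropProd {A B : Exp} (hA : El (isProp A)) (hB : El (isProp B)) : El (isProp (A ⊗ B)) :=
  cite isPropProd.index [A, B, hA.val, hB.val]

/-- The type that an element of `HProp` denotes. -/
def withHolds.library : List Entry := entry
  (Pi (U 1) fun C => (Pi (HProp ⇾ U 0) fun T => (Pi HProp fun v => isProp (T v)) ⇾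
    (Pi (U 0) fun X => Pi (isProp X) fun h => X ⇾ T (pair X h)) ⇾
    (Pi (U 0) fun X => Pi (isProp X) fun h => T (pair X h) ⇾ X) ⇾ C) ⇾ C)
  -- The projection is passed to a continuation that sees only a variable `T` with its introduction
  -- and elimination. This form is used throughout to hide a definition from the normalizer; the
  -- target `C` is arbitrary, so nothing is lost.
  (lam fun C => lam fun k => k (lam fun v => fst v) (lam fun v => recast (snd v))
    (lam fun X => lam fun h => lam fun x => recast x)
    (lam fun X => lam fun h => lam fun x => recast x)) :: isPropProd.library

theorem withHolds.theory : Theory (ctxOf withHolds.library) :=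
  isPropProd.theory.entry (by decide +kernel)

def withHolds.index : ℕ := isPropProd.index + 1

def withHolds {C : Exp} (f : (T : El (HProp ⇾ U 0)) → ((v : El HProp) → El (isProp (T v))) →
    ((X : El (U 0)) → (h : El (isProp X)) → El X → El (T (pair X h))) →
    ((X : El (U 0)) → (h : El (isProp X)) → El (T (pair X h)) → El X) → El C) : El C :=
  cite withHolds.index [C, (lam fun T => lam fun h => lam fun f₁ => lam fun f₂ =>
    f T (fun v => h v) (fun X h x => f₁ X h x) (fun X h x => f₂ X h x) : El (Pi (HProp ⇾ U 0) fun T =>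
      (Pi HProp fun v => isProp (T v)) ⇾
    (Pi (U 0) fun X => Pi (isProp X) fun h => X ⇾ T (pair X h)) ⇾
    (Pi (U 0) fun X => Pi (isProp X) fun h => T (pair X h) ⇾ X) ⇾ C)).val]

/-- Mutual implication is a reflexive family of propositions on the type of propositions, and it
implies equality by `propExt`, the proof component being itself a proposition. -/
def isSetHProp.library : List Entry := entry
  (isSet HProp)
  (withHolds fun T hT intro elim => setOfRel (fun v w => (T v ⇾ T w) ⊗ (T w ⇾ T v))
    (fun v w => isPropProd (isPropPi fun _ => hT w) (isPropPi fun _ => hT v))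
    (fun v => pair (lam fun x => x) (lam fun x => x))
    (fun v w k => split k fun f g => (sigInd (fun v => (T v ⇾ T w) ⇾ (T w ⇾ T v) ⇾ Id HProp v w) v
      (fun X hX => sigInd (fun w => (T (pair X hX) ⇾ T w) ⇾ (T w ⇾ T (pair X hX)) ⇾
          Id HProp (pair X hX) w) w
        (fun Y hY => lam fun f => lam fun g =>
          pairEq (B := fun X : El (U 0) => isProp X) (lam fun _ => isPropIsProp)
            (propExt hX hY (lam fun x => elim Y hY (f (intro X hX x)))
              (lam fun y => elim X hX (g (intro Y hY y)))) hX hY))) f g)) :: withHolds.library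

theorem isSetHProp.theory : Theory (ctxOf isSetHProp.library) :=
  withHolds.theory.entry (by decide +kernel)

def isSetHProp.index : ℕ := withHolds.index + 1

def isSetHProp : El (isSet HProp) := cite isSetHProp.index []

/-! ## The type `N(A)` -/

def L (A : Exp) : Exp := ListT (A ⊎ A)

def N (A : Exp) : Exp := NA A

def bar {A : Exp} (a : El (A ⊎ A)) : El (A ⊎ A) := ⟨HoTT.bar A a.val⟩

def append {A : Exp} (x y : El (L A)) : El (L A) := ⟨HoTT.append A x.val y.val⟩

infixr:65 " ++' " => append

def redex {A : Exp} (a : El (A ⊎ A)) (y : El (L A)) : El (L A) := cons a (cons (bar a) y)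

def eta {A : Exp} (x : El (L A)) : El (N A) := ⟨HoTT.eta A x.val⟩

def apEta {A : Exp} {x y : El (L A)} (p : El (Id (L A) x y)) : El (Id (N A) (eta x) (eta y)) :=
  ⟨HoTT.ap (L A) (N A) (HoTT.K .eta A) x.val y.val p.val⟩

def tau {A : Exp} (x : El (L A)) (a : El (A ⊎ A)) (y : El (L A)) :
    El (Id (N A) (eta (x ++' redex a y)) (eta (x ++' y))) :=
  ⟨HoTT.K .tau A x.val a.val y.val⟩

def tr {A : Exp} (n m : El (N A)) : El (isSet (Id (N A) n m)) :=
  recast (A := isSet (Id (N A) n m)) ⟨HoTT.K .tr A n.val m.val⟩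

/-- Transport in a family that is given by a function. -/
def transportFun {A : Exp} {i : ℕ} (P : El (A ⇾ U i)) {x y : El A} (p : El (Id A x y))
    (u : El (P x)) : El (P y) :=
  ⟨HoTT.transport A P.val x.val y.val p.val u.val⟩

/-- A family of paths in sets. -/
def overSet.library : List Entry := entry
  (Pi (U 1) fun X => Pi (X ⇾ U 1) fun P => (Pi X fun n => isSet (P n)) ⇾ Pi X fun x => Pi X fun y =>
    Pi (Id X x y) fun p => Pi (Id X x y) fun q => Pi (Id _ p q) fun h => Pi (P x) fun u =>
    Pi (P y) fun v =>
    let Q := fun p => Id (P y) (transportFun P p u) v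
    Pi (Q p) fun r => Pi (Q q) fun s => Id (Q q) (transport Q h r) s)
  (lam fun X => lam fun P => lam fun hP => lam fun x => lam fun y => lam fun p => lam fun q =>
    lam fun h => lam fun u => lam fun v => lam fun r => lam fun s =>
      -- Both sides are paths between the same points of the set `P y`.
      hP y (transportFun P q u) v
        (transport (fun p => Id (P y) (transportFun P p u) v) h r) s) :: isSetHProp.library

theorem overSet.theory : Theory (ctxOf overSet.library) :=
  isSetHProp.theory.entry (by decide +kernel)

def overSet.index : ℕ := isSetHProp.index + 1

/-- The path over an equality of paths, for a family of sets. -/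
def overSet (A P hP e t : Exp) (p q : PathExp) (h : Exp) : Exp :=
  (cite overSet.index [NA A, P, hP, HoTT.eta A (p.src A), HoTT.eta A (p.tgt A), p.path A, q.path A, h,
    e (p.src A), e (p.tgt A), p.pathOver A P e t, q.pathOver A P e t] : El (U 0)).val

/-- Induction for families of sets. -/
def NIndSet.library : List Entry := entry
  (Pi (U 0) fun A => Pi (U 1) fun C => Pi (N A ⇾ U 1) fun P => (Pi (N A) fun n => isSet (P n)) ⇾
    Pi (Pi (L A) fun x => P (eta x)) fun e =>
    (Pi (L A) fun x => Pi (A ⊎ A) fun a => Pi (L A) fun y =>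
      Id (P (eta (x ++' y))) (transportFun P (tau x a y) (e (x ++' redex a y)))
        (e (x ++' y))) ⇾
    (Pi (Pi (N A) fun n => P n) fun f => (Pi (L A) fun x => Id (P (eta x)) (f (eta x)) (e x)) ⇾ C) ⇾
    C)
  (lam fun A => lam fun C => lam fun P => lam fun hP => lam fun e => lam fun t => lam fun k =>
    -- In a family of sets the methods for `sw` and `ov` are equations between paths in a set, hence
    -- automatic, and sets are 1-types. The values at `η(x)` are judgmental, so reflexivity suffices
    -- for the second component.
    k ⟨HoTT.K .NInd A P.val e.val t.val
        (Lam (LS A) fun x => Lam (Signed A) fun a => Lam (LS A) fun y => Lam (Signed A) fun b =>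
          Lam (LS A) fun z => overSet A P.val hP.val e.val t.val
            (swLeft A x a y b z) (swRight A x a y b z) (HoTT.K .sw A x a y b z))
        (Lam (LS A) fun x => Lam (Signed A) fun a => Lam (LS A) fun y =>
          overSet A P.val hP.val e.val t.val
            (ovLeft A x a y) (ovRight A x a y) (HoTT.K .ov A x a y))
        (lam fun n => lam fun u => lam fun v => propIsSet (hP n u v)).val⟩
      (lam fun x => recast (refl (x := e x)))) :: overSet.library

theorem NIndSet.theory : Theory (ctxOf NIndSet.library) :=
  overSet.theory.entry (by decide +kernel)

def NIndSet.index : ℕ := overSet.index + 1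

def nIndSet {A C : Exp} (P : El (N A) → Exp) (hP : (n : El (N A)) → El (isSet (P n)))
    (e : (x : El (L A)) → El (P (eta x)))
    (t : (x : El (L A)) → (a : El (A ⊎ A)) → (y : El (L A)) →
      El (Id (P (eta (x ++' y))) (transport P (tau x a y) (e (x ++' redex a y))) (e (x ++' y))))
    (k : (f : El (Pi (N A) P)) → (El (Pi (L A) fun x => Id (P (eta x)) (f (eta x)) (e x))) → El C) :
    El C :=
  cite NIndSet.index [A, C, fam P, (lam hP).val, (lam e).val,
    (lam fun x => lam fun a => lam fun y => t x a y).val, (lam fun f => lam fun h => k f h).val]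

/-- Propositions on lists that respect `tau` give propositions on `N(A)`. -/
def NRel.library : List Entry := entry
  (Pi (U 0) fun A => Pi (U 1) fun C => Pi (L A ⇾ U 0) fun e => (Pi (L A) fun x => isProp (e x)) ⇾
    (Pi (L A) fun x => Pi (A ⊎ A) fun a => Pi (L A) fun y => e (x ++' redex a y) ⇾ e (x ++' y)) ⇾
    (Pi (L A) fun x => Pi (A ⊎ A) fun a => Pi (L A) fun y => e (x ++' y) ⇾ e (x ++' redex a y)) ⇾
    (Pi (N A ⇾ U 0) fun D => (Pi (N A) fun n => isProp (D n)) ⇾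
      (Pi (L A) fun x => e x ⇾ D (eta x)) ⇾ (Pi (L A) fun x => D (eta x) ⇾ e x) ⇾ C) ⇾ C)
  (lam fun A => lam fun C => lam fun e => lam fun h => lam fun f => lam fun g => lam fun k =>
    withHolds fun T hT intro elim => nIndSet (fun _ => HProp) (fun _ => isSetHProp)
      (fun x => pair (e x) (h x))
      -- Transport in a constant family is trivial by path induction; what remains is the equality
      -- of two equivalent propositions.
      (fun x a y => J (fun _ p => Id HProp (transport (fun _ => HProp) p
          (pair (e (x ++' redex a y)) (h (x ++' redex a y)))) (pair (e (x ++' redex a y))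
            (h (x ++' redex a y)))) (tau x a y) (recast (refl (A := HProp)
              (x := pair (e (x ++' redex a y)) (h (x ++' redex a y))))) ⬝
        pairEq (B := fun X : El (U 0) => isProp X) (lam fun _ => isPropIsProp)
          (propExt (h _) (h _) (f x a y) (g x a y)) (h _) (h _))
      (fun s β => k (lam fun n => T (s n)) (lam fun n => recast (hT (s n)))
        (lam fun x => lam fun u =>
          recast (transport (fun v => T v) (symm (β x)) (intro (e x) (h x) u)))
        (lam fun x => lam fun u => elim (e x) (h x) (transport (fun v => T v) (β x) (recast u))))) :: NIndSet.library

theorem NRel.theory : Theory (ctxOf NRel.library) :=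
  NIndSet.theory.entry (by decide +kernel)

def NRel.index : ℕ := NIndSet.index + 1

def nRel {A C : Exp} (e : El (L A) → Exp) (h : (x : El (L A)) → El (isProp (e x)))
    (f g k : Exp) : El C :=
  cite NRel.index [A, C, fam e, (lam h).val, f, g, k]

/-- Transport of functions into equality types. -/
def transportArrow.library : List Entry := entry
  (Pi (U 1) fun X => Pi X fun b => Pi (X ⇾ U 1) fun C => Pi X fun m => Pi X fun m' =>
    Pi (Id X m m') fun p => Pi (C m ⇾ Id X m b) fun f => Pi (C m' ⇾ Id X m' b) fun g =>
    (Pi (C m) fun c => Pi (C m') fun c' => Id _ (f c) (p ⬝ g c')) ⇾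
    Id (C m' ⇾ Id X m' b) (transport (fun m => C m ⇾ Id X m b) p f) g)
  (lam fun X => lam fun b => lam fun C => lam fun m => lam fun m' => lam fun p => lam fun f =>
    J (fun m' p => Pi (C m' ⇾ Id X m' b) fun g =>
        (Pi (C m) fun c => Pi (C m') fun c' => Id _ (f c) (p ⬝ g c')) ⇾
        Id (C m' ⇾ Id X m' b) (transport (fun m => C m ⇾ Id X m b) p f) g) p
      -- For `p = refl` the transport disappears, and the hypothesis at a repeated argument `c`
      -- gives pointwise equality up to the left unit law.
      (recast <| lam fun g : El (C m ⇾ Id X m b) =>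
        lam fun h : El (Pi (C m) fun c => Pi (C m) fun c' => Id _ (f c) (refl ⬝ g c')) =>
        fe (f := f) (g := g) fun c => h c c ⬝ reflConcat (g c))) :: NRel.library

theorem transportArrow.theory : Theory (ctxOf transportArrow.library) :=
  NRel.theory.entry (by decide +kernel)

def transportArrow.index : ℕ := NRel.index + 1

/-- Paths to a point from the elements of a family on `N(A)`, from their values at lists. -/
def NDesc.library : List Entry := entry
  (Pi (U 0) fun A => Pi (N A) fun b => Pi (N A ⇾ U 0) fun C =>
    Pi (Pi (L A) fun y => C (eta y) ⇾ Id (N A) (eta y) b) fun d =>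
    (Pi (L A) fun x => Pi (A ⊎ A) fun a => Pi (L A) fun y => Pi (C (eta (x ++' redex a y))) fun c =>
      Pi (C (eta (x ++' y))) fun c' => Id _ (d _ c) (tau x a y ⬝ d _ c')) ⇾
    Pi (N A) fun m => C m ⇾ Id (N A) m b)
  (lam fun A => lam fun b => lam fun C => lam fun d => lam fun h =>
    -- By `tr` the paths from `m` to `b` form a set, so only the condition over `τ` has to be met.
    nIndSet (fun m => C m ⇾ Id (N A) m b) (fun m => isSetPi (lam fun _ => tr m b)) (fun y => d y)
      (fun x a y => cite transportArrow.index [N A, b.val, (lam fun m => C m).val,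
        (eta (x ++' redex a y)).val, (eta (x ++' y)).val, (tau x a y).val,
        (d (x ++' redex a y)).val, (d (x ++' y)).val, (h x a y).val])
      (fun f _ => f)) :: transportArrow.library

theorem NDesc.theory : Theory (ctxOf NDesc.library) :=
  transportArrow.theory.entry (by decide +kernel)

def NDesc.index : ℕ := transportArrow.index + 1

/-- A description of the paths from the points `eta y` to `eta x`. -/
def isPropIdEta.library : List Entry := entry
  (Pi (U 0) fun A => Pi (L A) fun x => Pi (L A ⇾ U 0) fun e => (Pi (L A) fun x => isProp (e x)) ⇾
    (Pi (L A) fun x => Pi (A ⊎ A) fun a => Pi (L A) fun y => e (x ++' redex a y) ⇾ e (x ++' y)) ⇾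
    (Pi (L A) fun x => Pi (A ⊎ A) fun a => Pi (L A) fun y => e (x ++' y) ⇾ e (x ++' redex a y)) ⇾
    Pi (Pi (L A) fun y => e y ⇾ Id (N A) (eta y) (eta x)) fun d =>
    (Pi (L A) fun x => Pi (A ⊎ A) fun a => Pi (L A) fun y => Pi (e (x ++' redex a y)) fun c =>
      Pi (e (x ++' y)) fun c' => Id _ (d _ c) (tau x a y ⬝ d _ c')) ⇾
    e x ⇾ Pi (N A) fun m => isProp (Id (N A) (eta x) m))
  (lam fun A => lam fun x => lam fun e => lam fun h => lam fun f => lam fun g => lam fun d =>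
    lam fun compat => lam fun r =>
    nRel (fun x => e x) (fun x => h x) f.val g.val
      (lam fun D => lam fun hD => lam fun i => lam fun j =>
        -- `D` is the extension of `e` to `N(A)`. The descriptions give paths towards `η(x)`, hence
        -- the inversion.
        isPropIdAt (C := fun m => D m) hD (i x r) (lam fun m => lam fun c =>
          symm (app (app (cite NDesc.index [A, (eta x).val, D.val, (lam fun y => lam fun c => d y (j y c)).val,
            (lam fun x => lam fun a => lam fun y => lam fun c => lam fun c' =>
              compat x a y (j _ c) (j _ c')).val] :
              El (Pi (N A) fun m => D m ⇾ Id (N A) m (eta x))) m) c)) :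
        El (Pi (N A ⇾ U 0) fun D => (Pi (N A) fun n => isProp (D n)) ⇾
          (Pi (L A) fun x => e x ⇾ D (eta x)) ⇾ (Pi (L A) fun x => D (eta x) ⇾ e x) ⇾
          Pi (N A) fun m => isProp (Id (N A) (eta x) m))).val) :: NDesc.library

theorem isPropIdEta.theory : Theory (ctxOf isPropIdEta.library) :=
  NDesc.theory.entry (by decide +kernel)

def isPropIdEta.index : ℕ := NDesc.index + 1

/-- To have only propositions as path types is itself a proposition, so in the induction on the
first endpoint all conditions except the one at `η(x)` are automatic. -/
def isSetN.library : List Entry := entry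
  (Pi (U 0) fun A => (Pi (L A) fun x => Pi (N A) fun m => isProp (Id (N A) (eta x) m)) ⇾
    isSet (N A))
  (lam fun A => lam fun h => nIndSet (fun n => Pi (N A) fun m => isProp (Id (N A) n m))
    (fun n => propIsSet (isPropPi fun _ => isPropIsProp)) (fun x => h x)
    (fun x a y => isPropPi (fun _ => isPropIsProp) _ _) (fun f _ => f)) :: isPropIdEta.library

theorem isSetN.theory : Theory (ctxOf isSetN.library) :=
  isPropIdEta.theory.entry (by decide +kernel)

def isSetN.index : ℕ := isPropIdEta.index + 1

/-! ## Abstract rewriting -/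

/-- Families of relations that are indexed by the number of steps. -/
def steps.library : List Entry := entry
  (Pi (U 0) fun X => Pi (X ⇾ U 0) fun Y => Pi (Pi X fun B => Y B ⇾ Y B ⇾ U 0) fun St =>
    Pi (U 1) fun C => (Pi (NatT ⇾ Pi X fun B => Y B ⇾ Y B ⇾ U 0) fun R =>
      (Pi X fun B => Pi (Y B) fun x => R zero B x x) ⇾
      (Pi X fun B => Pi (Y B) fun x => Pi (Y B) fun y => R zero B x y ⇾ Id (Y B) x y) ⇾
      (Pi NatT fun n => Pi X fun B => Pi (Y B) fun x => Pi (Y B) fun z =>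
        (Sig (Y B) fun y => St B x y ⊗ R n B y z) ⇾ R (succ n) B x z) ⇾
      (Pi NatT fun n => Pi X fun B => Pi (Y B) fun x => Pi (Y B) fun z =>
        R (succ n) B x z ⇾ (Sig (Y B) fun y => St B x y ⊗ R n B y z)) ⇾ C) ⇾ C)
  (lam fun X => lam fun Y => lam fun St => lam fun C => lam fun k =>
    -- The theory has no general inductive families; sequences of exactly `n` steps are defined by
    -- recursion on `n`, with equality for `n = 0`.
    k (lam fun n => lam fun B => natInd (fun _ => Y B ⇾ Y B ⇾ U 0) n
        (lam fun x => lam fun y => ty (Id (Y B) x y))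
        (fun _ r => lam fun x => lam fun z => ty (Sig (Y B) fun y => St B x y ⊗ r y z)))
      (lam fun B => lam fun x => recast (refl (x := x)))
      (lam fun B => lam fun x => lam fun y => lam fun p => recast p)
      (lam fun n => lam fun B => lam fun x => lam fun z => lam fun w => recast w)
      (lam fun n => lam fun B => lam fun x => lam fun z => lam fun w => recast w)) :: isSetN.library

theorem steps.theory : Theory (ctxOf steps.library) :=
  isSetN.theory.entry (by decide +kernel)

def steps.index : ℕ := isSetN.index + 1

/-- Induction on a sequence of steps. -/
abbrev StepInd (Y : Exp) (St R : El Y → El Y → Exp) : Exp :=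
  Pi (Y ⇾ Y ⇾ U 0) fun Q => (Pi Y fun x => Q x x) ⇾
    (Pi Y fun x => Pi Y fun y => Pi Y fun z => St x y ⇾ R y z ⇾ Q y z ⇾ Q x z) ⇾
    Pi Y fun x => Pi Y fun y => R x y ⇾ Q x y

/-- The reflexive and transitive closure of a family of relations. -/
def closure.library : List Entry := entry
  (Pi (U 0) fun X => Pi (X ⇾ U 0) fun Y => Pi (Pi X fun B => Y B ⇾ Y B ⇾ U 0) fun St =>
    Pi (U 1) fun C => (Pi (Pi X fun B => Y B ⇾ Y B ⇾ U 0) fun R =>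
      (Pi X fun B => Pi (Y B) fun x => R B x x) ⇾
      (Pi X fun B => Pi (Y B) fun x => Pi (Y B) fun y => Pi (Y B) fun z =>
        St B x y ⇾ R B y z ⇾ R B x z) ⇾
      (Pi X fun B => StepInd (Y B) (fun x y => St B x y) (fun x y => R B x y)) ⇾ C) ⇾ C)
  (lam fun X => lam fun Y => lam fun St => lam fun C => lam fun k =>
    cite steps.index [X.val, Y.val, St.val, C.val, (lam fun R => lam fun z₁ => lam fun z₂ => lam fun s₁ =>
      lam fun s₂ =>
      k (lam fun B => lam fun x => lam fun y => ty (Sig NatT fun n => R n B x y))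
        (lam fun B => lam fun x => recast <| pair (B := fun n => R n B x x) zero (z₁ B x))
        (lam fun B => lam fun x => lam fun y => lam fun z => lam fun s => lam fun r =>
          recast <| split (recast r : El (Sig NatT fun n => R n B y z)) fun n r =>
            pair (B := fun n => R n B x z) (succ n)
              (s₁ n B x z (pair (B := fun y => St B x y ⊗ R n B y z) y (pair s r))))
        (lam fun B => lam fun Q => lam fun q₀ => lam fun q₁ => lam fun x => lam fun y => lam fun r =>
          split (recast r : El (Sig NatT fun n => R n B x y)) fun n r =>
            app (app (app (natInd (fun n => Pi (Y B) fun x => Pi (Y B) fun y => R n B x y ⇾ Q x y) n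
              (lam fun x => lam fun y => lam fun r => transport (fun y => Q x y) (z₂ B x y r) (q₀ x))
              (fun n h => lam fun x => lam fun z => lam fun r => split (s₂ n B x z r) fun y w =>
                split w fun s r => q₁ x y z s
                  (recast (pair (B := fun n => R n B y z) n r)) (h y z r))) x) y) r) :
      El (Pi (NatT ⇾ Pi X fun B => Y B ⇾ Y B ⇾ U 0) fun R =>
      (Pi X fun B => Pi (Y B) fun x => R zero B x x) ⇾
      (Pi X fun B => Pi (Y B) fun x => Pi (Y B) fun y => R zero B x y ⇾ Id (Y B) x y) ⇾
      (Pi NatT fun n => Pi X fun B => Pi (Y B) fun x => Pi (Y B) fun z =>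
        (Sig (Y B) fun y => St B x y ⊗ R n B y z) ⇾ R (succ n) B x z) ⇾
      (Pi NatT fun n => Pi X fun B => Pi (Y B) fun x => Pi (Y B) fun z =>
        R (succ n) B x z ⇾ (Sig (Y B) fun y => St B x y ⊗ R n B y z)) ⇾ C)).val]) :: steps.library

theorem closure.theory : Theory (ctxOf closure.library) :=
  steps.theory.entry (by decide +kernel)

def closure.index : ℕ := steps.index + 1

/-- A reflexive relation that contains `St`, closed under steps, with an induction principle. -/
abbrev Closure (Y : Exp) (St R : El Y → El Y → Exp) (C : Exp) : Exp :=
  (Pi Y fun x => R x x) ⇾ (Pi Y fun x => Pi Y fun y => Pi Y fun z => St x y ⇾ R y z ⇾ R x z) ⇾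
    StepInd Y St R ⇾ C

def stepInd {Y : Exp} {St R : El Y → El Y → Exp} (ind : El (StepInd Y St R))
    (Q : El Y → El Y → Exp) (h₀ : (x : El Y) → El (Q x x))
    (h₁ : (x y z : El Y) → El (St x y) → El (R y z) → El (Q y z) → El (Q x z)) :
    El (Pi Y fun x => Pi Y fun y => R x y ⇾ Q x y) :=
  ⟨App (App (App ind.val (Lam Y fun x => fam fun y => Q ⟨x⟩ y)) (lam h₀).val)
    (lam fun x => lam fun y => lam fun z => lam fun s => lam fun r => lam fun q =>
      h₁ x y z s r q).val⟩

def trans.library : List Entry := entry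
  (Pi (U 0) fun Y => Pi (Y ⇾ Y ⇾ U 0) fun St => Pi (Y ⇾ Y ⇾ U 0) fun R =>
    Closure Y (fun x y => St x y) (fun x y => R x y) <|
    Pi Y fun x => Pi Y fun y => R x y ⇾ Pi Y fun z => R y z ⇾ R x z)
  (lam fun Y => lam fun St => lam fun R => lam fun rf => lam fun st => lam fun ind =>
    stepInd ind (fun x y => Pi Y fun z => R y z ⇾ R x z) (fun x => lam fun z => lam fun r => r)
      (fun x y z s r q => lam fun w => lam fun t => st x y w s (q w t))) :: closure.library

theorem trans.theory : Theory (ctxOf trans.library) :=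
  closure.theory.entry (by decide +kernel)

def trans.index : ℕ := closure.index + 1

/-- A sequence of steps is empty or has a first step. -/
def firstStep.library : List Entry := entry
  (Pi (U 0) fun Y => Pi (Y ⇾ Y ⇾ U 0) fun St => Pi (Y ⇾ Y ⇾ U 0) fun R =>
    Closure Y (fun x y => St x y) (fun x y => R x y) <|
    Pi Y fun x => Pi Y fun y => R x y ⇾ (Id Y x y ⊎ Sig Y fun z => St x z ⊗ R z y))
  (lam fun Y => lam fun St => lam fun R => lam fun rf => lam fun st => lam fun ind =>
    stepInd ind (fun x y => Id Y x y ⊎ Sig Y fun z => St x z ⊗ R z y) (fun x => inl refl)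
      (fun x y z s r q => inr (pair y (pair s r)))) :: trans.library

theorem firstStep.theory : Theory (ctxOf firstStep.library) :=
  trans.theory.entry (by decide +kernel)

def firstStep.index : ℕ := trans.index + 1

/-- At most one step. -/
abbrev StEq {Y : Exp} (St : El Y → El Y → Exp) (x y : El Y) : Exp := Id Y x y ⊎ St x y

abbrev Diamond (Y : Exp) (St : El Y → El Y → Exp) : Exp :=
  Pi Y fun x => Pi Y fun y => Pi Y fun z => St x y ⇾ St x z ⇾ Sig Y fun w => StEq St y w ⊗ StEq St z w

/-- A diamond whose sides have length at most one lets a single, possibly empty, step be pushed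
through a sequence by induction on the sequence. Allowing equality in the hypothesis on `x` and `z`
is what makes the induction go through. -/
def strip.library : List Entry := entry
  (Pi (U 0) fun Y => Pi (Y ⇾ Y ⇾ U 0) fun St => Pi (Y ⇾ Y ⇾ U 0) fun R =>
    Closure Y (fun x y => St x y) (fun x y => R x y) <| Diamond Y (fun x y => St x y) ⇾
    Pi Y fun x => Pi Y fun y => R x y ⇾ Pi Y fun z => StEq (fun x y => St x y) x z ⇾
      Sig Y fun w => StEq (fun x y => St x y) y w ⊗ R z w)
  (lam fun Y => lam fun St => lam fun R => lam fun rf => lam fun st => lam fun ind => lam fun dia =>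
    let E : El Y → El Y → Exp := StEq fun x y => St x y
    stepInd ind (fun x y => Pi Y fun z => E x z ⇾ Sig Y fun w => E y w ⊗ R z w)
      (fun x => lam fun z => lam fun s => pair z (pair s (rf z)))
      (fun x y z s r q => lam fun v => lam fun t =>
        cases t
          (fun p => split (q y (inl refl)) fun w h => split h fun a b =>
            pair w (pair a (transport (fun x => R x w) p (st x y w s b))))
          (fun t => split (dia x y v s t) fun w h => split h fun a b =>
            split (q w a) fun u h => split h fun c d =>
              pair u (pair c (cases b (fun p => transport (fun x => R x u) (symm p) d)
                (fun b => st v w u b d)))))) :: firstStep.library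

theorem strip.theory : Theory (ctxOf strip.library) :=
  firstStep.theory.entry (by decide +kernel)

def strip.index : ℕ := firstStep.index + 1

/-- Induction on the first sequence: `strip` moves its first step across the second sequence.
Termination is not needed, since the diamond property is stronger than local confluence. -/
def confluence.library : List Entry := entry
  (Pi (U 0) fun Y => Pi (Y ⇾ Y ⇾ U 0) fun St => Pi (Y ⇾ Y ⇾ U 0) fun R =>
    Closure Y (fun x y => St x y) (fun x y => R x y) <| Diamond Y (fun x y => St x y) ⇾
    Pi Y fun x => Pi Y fun y => R x y ⇾ Pi Y fun z => R x z ⇾ Sig Y fun w => R y w ⊗ R z w)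
  (lam fun Y => lam fun St => lam fun R => lam fun rf => lam fun st => lam fun ind => lam fun dia =>
    let E : El Y → El Y → Exp := StEq fun x y => St x y
    stepInd ind (fun x y => Pi Y fun z => R x z ⇾ Sig Y fun w => R y w ⊗ R z w)
      (fun x => lam fun z => lam fun r => pair z (pair r (rf z)))
      (fun x y z s r q => lam fun v => lam fun t =>
        split (cite strip.index [Y, St.val, R.val, rf.val, st.val, ind.val, dia.val, x.val, v.val, t.val,
            y.val, (inr s : El (E x y)).val] : El (Sig Y fun w => E v w ⊗ R y w)) fun w h =>
          split h fun a b => split (q w b) fun u h => split h fun c d =>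
            pair u (pair c (cases a (fun p => transport (fun x => R x u) (symm p) d)
              (fun a => st v w u a d))))) :: strip.library

theorem confluence.theory : Theory (ctxOf confluence.library) :=
  strip.theory.entry (by decide +kernel)

def confluence.index : ℕ := strip.index + 1

/-! ## Paths in `N(A)` and rewriting -/

def concatSymmConcat.library : List Entry := entry
  (Pi (U 1) fun A => Pi A fun x => Pi A fun y => Pi A fun z => Pi (Id A x y) fun p =>
    Pi (Id A x z) fun q => Id (Id A x z) (p ⬝ symm p ⬝ q) q)
  (lam fun A => lam fun x => lam fun y => lam fun z => lam fun p => lam fun q =>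
    J (fun y p => Id (Id A x z) (p ⬝ symm p ⬝ q) q) p
      (recast (reflConcat (refl ⬝ q) ⬝ reflConcat q))) :: confluence.library

theorem concatSymmConcat.theory : Theory (ctxOf concatSymmConcat.library) :=
  confluence.theory.entry (by decide +kernel)

def concatSymmConcat.index : ℕ := confluence.index + 1

def concatSymmConcat {A : Exp} {x y z : El A} (p : El (Id A x y)) (q : El (Id A x z)) :
    El (Id (Id A x z) (p ⬝ symm p ⬝ q) q) :=
  cite concatSymmConcat.index [A, x.val, y.val, z.val, p.val, q.val]

def cancelLeft.library : List Entry := entry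
  (Pi (U 1) fun A => Pi A fun x => Pi A fun y => Pi A fun z => Pi (Id A x y) fun p =>
    Pi (Id A y z) fun q => Pi (Id A y z) fun r => Id (Id A x z) (p ⬝ q) (p ⬝ r) ⇾
      Id (Id A y z) q r)
  (lam fun A => lam fun x => lam fun y => lam fun z => lam fun p =>
    J (fun y p => Pi (Id A y z) fun q => Pi (Id A y z) fun r => Id (Id A x z) (p ⬝ q) (p ⬝ r) ⇾
      Id (Id A y z) q r) p (lam fun q => lam fun r => lam fun h =>
        symm (reflConcat q) ⬝ h ⬝ reflConcat r)) :: concatSymmConcat.library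

theorem cancelLeft.theory : Theory (ctxOf cancelLeft.library) :=
  concatSymmConcat.theory.entry (by decide +kernel)

def cancelLeft.index : ℕ := concatSymmConcat.index + 1

def cancelLeft {A : Exp} {x y z : El A} (p : El (Id A x y)) {q r : El (Id A y z)}
    (h : El (Id (Id A x z) (p ⬝ q) (p ⬝ r))) : El (Id (Id A y z) q r) :=
  cite cancelLeft.index [A, x.val, y.val, z.val, p.val, q.val, r.val, h.val]

/-- Cancelling `k` shows that the loop `symm q ⬝ p` is trivial; composing with `q` on the left then
gives `p = q`. -/
def eqOfLoop.library : List Entry := entry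
  (Pi (U 1) fun A => Pi A fun x => Pi A fun y => Pi A fun z => Pi (Id A x y) fun k =>
    Pi (Id A z y) fun p => Pi (Id A z y) fun q => Id (Id A x y) k (k ⬝ symm q ⬝ p) ⇾
      Id (Id A z y) p q)
  (lam fun A => lam fun x => lam fun y => lam fun z => lam fun k => lam fun p => lam fun q =>
    lam fun h => symm (concatSymmConcat q p) ⬝
      recast (ap (fun o => q ⬝ o) (symm (cancelLeft k (q := refl) (r := symm q ⬝ p) (recast h))))) :: cancelLeft.library

theorem eqOfLoop.theory : Theory (ctxOf eqOfLoop.library) :=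
  cancelLeft.theory.entry (by decide +kernel)

def eqOfLoop.index : ℕ := cancelLeft.index + 1

/-- Paths from the image of a list to `B`. -/
abbrev To {A : Exp} (B : El (N A)) (v : El (L A)) : Exp := Id (N A) (eta v) B

/-- A family of relations between lists with paths to a point. -/
abbrev Rel (A : Exp) : Exp :=
  Pi (N A) fun B => Pi (L A) fun v => To B v ⇾ Pi (L A) fun w => To B w ⇾ U 0

/-- A relation that is given for all points `B` is preserved when both paths are prolonged by a path
out of `B`, by path induction. It is needed for loops, which path induction could not treat
directly. -/
def shift.library : List Entry := entry
  (Pi (U 0) fun A => Pi (Rel A) fun R => Pi (N A) fun B => Pi (L A) fun v => Pi (To B v) fun p =>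
    Pi (L A) fun w => Pi (To B w) fun q => Pi (N A) fun B' => Pi (Id (N A) B B') fun o =>
    R B v p w q ⇾ R B' v (p ⬝ o) w (q ⬝ o))
  (lam fun A => lam fun R => lam fun B => lam fun v => lam fun p => lam fun w => lam fun q =>
    lam fun B' => lam fun o => lam fun r =>
    J (fun B' o => R B' v (p ⬝ o) w (q ⬝ o)) o (recast r)) :: eqOfLoop.library

theorem shift.theory : Theory (ctxOf shift.library) :=
  eqOfLoop.theory.entry (by decide +kernel)

def shift.index : ℕ := eqOfLoop.index + 1

def shift {A : Exp} {R : El (Rel A)} {B B' : El (N A)} (o : El (Id (N A) B B')) {v w : El (L A)}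
    {p : El (To B v)} {q : El (To B w)} (r : El (R B v p w q)) :
    El (R B' v (p ⬝ o) w (q ⬝ o)) :=
  cite shift.index [A, R.val, B.val, v.val, p.val, w.val, q.val, B'.val, o.val, r.val]

abbrev Reflexive {A : Exp} (R : El (Rel A)) : Exp :=
  Pi (N A) fun B => Pi (L A) fun v => Pi (To B v) fun p => R B v p v p

abbrev Transitive {A : Exp} (R : El (Rel A)) : Exp :=
  Pi (N A) fun B => Pi (L A) fun u => Pi (To B u) fun k => Pi (L A) fun v => Pi (To B v) fun p =>
    R B u k v p ⇾ Pi (L A) fun w => Pi (To B w) fun q => R B v p w q ⇾ R B u k w q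

abbrev Confluent {A : Exp} (R : El (Rel A)) : Exp :=
  Pi (N A) fun B => Pi (L A) fun u => Pi (To B u) fun k => Pi (L A) fun v => Pi (To B v) fun p =>
    R B u k v p ⇾ Pi (L A) fun w => Pi (To B w) fun q => R B u k w q ⇾
    Sig (L A) fun z => Sig (To B z) fun l => R B v p z l ⊗ R B w q z l

abbrev HasSteps {A : Exp} (R : El (Rel A)) : Exp :=
  Pi (L A) fun x => Pi (A ⊎ A) fun a => Pi (L A) fun y => Pi (N A) fun B =>
    Pi (To B (x ++' y)) fun q => R B (x ++' redex a y) (tau x a y ⬝ q) (x ++' y) q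

/-- That a list contains a redex. -/
abbrev Reducible (A : Exp) (t : El (L A)) : Exp :=
  Sig (L A) fun x => Sig (A ⊎ A) fun a => Sig (L A) fun y => Id (L A) (x ++' redex a y) t

abbrev Reduces {A : Exp} (R : El (Rel A)) : Exp :=
  Pi (N A) fun B => Pi (L A) fun t => Pi (To B t) fun q => Pi (L A) fun w => Pi (To B w) fun k =>
    R B t q w k ⇾ ((Sig (Id (L A) t w) fun e => Id _ q (apEta e ⬝ k)) ⊎ Reducible A t)

/-- The reduction of a list to `t` induces a unique path. -/
abbrev Unique {A : Exp} (R : El (Rel A)) (t : El (L A)) : Exp :=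
  Pi (N A) fun B => Pi (L A) fun u => Pi (To B u) fun k => Pi (To B t) fun q =>
    Pi (To B t) fun q' => R B u k t q ⇾ R B u k t q' ⇾ Id _ q q'

/-- Contract a redex, along a given path. -/
def contractStep.library : List Entry := entry
  (Pi (U 0) fun A => Pi (Rel A) fun R => HasSteps R ⇾ Pi (L A) fun x => Pi (A ⊎ A) fun a =>
    Pi (L A) fun y => Pi (N A) fun B => Pi (To B (x ++' redex a y)) fun q =>
    R B (x ++' redex a y) q (x ++' y) (symm (tau x a y) ⬝ q))
  (lam fun A => lam fun R => lam fun st => lam fun x => lam fun a => lam fun y => lam fun B =>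
    lam fun q => transport (fun p => R B (x ++' redex a y) p (x ++' y) (symm (tau x a y) ⬝ q))
      (concatSymmConcat (tau x a y) q) (st x a y B (symm (tau x a y) ⬝ q))) :: shift.library

theorem contractStep.theory : Theory (ctxOf contractStep.library) :=
  shift.theory.entry (by decide +kernel)

def contractStep.index : ℕ := shift.index + 1

def contractStep {A : Exp} {R : El (Rel A)} (st : El (HasSteps R)) (x : El (L A)) (a : El (A ⊎ A))
    (y : El (L A)) {B : El (N A)} (q : El (To B (x ++' redex a y))) :
    El (R B (x ++' redex a y) q (x ++' y) (symm (tau x a y) ⬝ q)) :=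
  cite contractStep.index [A, R.val, st.val, x.val, a.val, y.val, B.val, q.val]

/-- Both reductions are continued by contracting the redex. Uniqueness for the shorter list
identifies the prolonged paths, which differ from `q` and `q'` by the same factor `symm (tau x a
y)`. -/
def uniqueRedex.library : List Entry := entry
  (Pi (U 0) fun A => Pi (Rel A) fun R => Transitive R ⇾ HasSteps R ⇾ Pi (L A) fun x =>
    Pi (A ⊎ A) fun a => Pi (L A) fun y => Unique R (x ++' y) ⇾ Unique R (x ++' redex a y))
  (lam fun A => lam fun R => lam fun tr => lam fun st => lam fun x => lam fun a => lam fun y =>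
    lam fun h => lam fun B => lam fun u => lam fun k => lam fun q => lam fun q' => lam fun r =>
    lam fun r' =>
    cancelLeft (symm (tau x a y)) (h B u k (symm (tau x a y) ⬝ q) (symm (tau x a y) ⬝ q')
      (tr B u k _ _ r _ _ (contractStep st x a y q))
      (tr B u k _ _ r' _ _ (contractStep st x a y q')))) :: contractStep.library

theorem uniqueRedex.theory : Theory (ctxOf uniqueRedex.library) :=
  contractStep.theory.entry (by decide +kernel)

def uniqueRedex.index : ℕ := contractStep.index + 1

/-- Well-founded induction on lists, for the contraction of redexes. -/
abbrev ListWf (A : Exp) : Exp :=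
  Pi (L A ⇾ U 0) fun P => (Pi (L A) fun t => (Pi (L A) fun x => Pi (A ⊎ A) fun a => Pi (L A) fun y =>
    Id (L A) (x ++' redex a y) t ⇾ P (x ++' y)) ⇾ P t) ⇾ Pi (L A) fun t => P t

/-- Paths that are induced by the same path of lists, up to equality. -/
def eqOfNoSteps.library : List Entry := entry
  (Pi (U 0) fun A => isSet (L A) ⇾ Pi (N A) fun B => Pi (L A) fun t => Pi (L A) fun w =>
    Pi (To B w) fun k => Pi (To B t) fun q => Pi (To B t) fun q' =>
    (Sig (Id (L A) t w) fun e => Id _ q (apEta e ⬝ k)) ⇾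
    (Sig (Id (L A) t w) fun e => Id _ q' (apEta e ⬝ k)) ⇾ Id _ q q')
  (lam fun A => lam fun hL => lam fun B => lam fun t => lam fun w => lam fun k => lam fun q =>
    lam fun q' => lam fun m => lam fun m' => split m fun e h => split m' fun e' h' =>
      h ⬝ ap (fun e => apEta e ⬝ k) (hL t w e e') ⬝ symm h') :: uniqueRedex.library

theorem eqOfNoSteps.theory : Theory (ctxOf eqOfNoSteps.library) :=
  uniqueRedex.theory.entry (by decide +kernel)

def eqOfNoSteps.index : ℕ := uniqueRedex.index + 1

/-- Well-founded induction on `t`. By confluence `(t, q)` and `(t, q')` have a common reduct `(w,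
l)`. If both reductions to it are empty, then `q` and `q'` are both `l` preceded by a path induced
by an equality of lists, and such equalities agree because lists form a set. Otherwise `t` has a
redex and `uniqueRedex` reduces the claim to the contracted list. -/
def unique.library : List Entry := entry
  (Pi (U 0) fun A => isSet (L A) ⇾ ListWf A ⇾ Pi (Rel A) fun R => Transitive R ⇾ HasSteps R ⇾
    Confluent R ⇾ Reduces R ⇾ Pi (L A) fun t => Unique R t)
  (lam fun A => lam fun hL => lam fun wf => lam fun R => lam fun tr => lam fun st => lam fun conf =>
    lam fun inv => ⟨App (App wf.val (fam fun t => Unique R t))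
      (lam fun t => lam fun ih : El (Pi (L A) fun x => Pi (A ⊎ A) fun a => Pi (L A) fun y =>
          Id (L A) (x ++' redex a y) t ⇾ Unique R (x ++' y)) =>
        (lam fun B => lam fun u => lam fun k => lam fun q => lam fun q' => lam fun r => lam fun r' =>
          let red : El (Reducible A t ⇾ Id _ q q') := lam fun m =>
            split m fun x m => split m fun a m => split m fun y e =>
            transport (fun t => Unique R t) e
              (cite uniqueRedex.index [A, R.val, tr.val, st.val, x.val, a.val, y.val, (ih x a y e).val]) B
              u k q q' r r'
          split (conf B u k _ _ r _ _ r') fun w h => split h fun l h => split h fun s s' =>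
            cases (inv B t q w l s)
              (fun p => cases (inv B t q' w l s')
                (fun p' => cite eqOfNoSteps.index [A, hL.val, B.val, t.val, w.val, l.val, q.val, q'.val,
                  p.val, p'.val])
                (fun m => red m))
              (fun m => red m) : El (Unique R t))).val⟩) :: eqOfNoSteps.library

theorem unique.theory : Theory (ctxOf unique.library) :=
  eqOfNoSteps.theory.entry (by decide +kernel)

def unique.index : ℕ := eqOfNoSteps.index + 1

/-- A common reduct of `x` and `y` that induces the path `p`. -/
abbrev Join {A : Exp} (R : El (Rel A)) (x y : El (L A)) (p : El (To (eta x) y)) : Exp :=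
  Sig (L A) fun s => Sig (To (eta x) s) fun k => R (eta x) x refl s k ⊗ R (eta x) y p s k

/-- Prolonging the second join by the loop `o` turns the path `p'` of `y` into `p`. Confluence at
`(y, p)` then gives a pair `(v, k)` below both joins. The pair `(x, refl ⬝ o)` reduces to `(v, k)`
through the prolonged second join and to `(v, k ⬝ o)` through the prolonged first one. By uniqueness
`k = k ⬝ o`, so the loop is trivial. -/
def joinEq.library : List Entry := entry
  (Pi (U 0) fun A => Pi (Rel A) fun R => Transitive R ⇾ Confluent R ⇾
    (Pi (L A) fun t => Unique R t) ⇾ Pi (L A) fun x => Pi (L A) fun y =>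
    Pi (To (eta x) y) fun p => Pi (To (eta x) y) fun p' =>
    Join R x y p ⇾ Join R x y p' ⇾ Id _ p p')
  (lam fun A => lam fun R => lam fun tr => lam fun conf => lam fun uniq => lam fun x =>
    lam fun y => lam fun p => lam fun p' => lam fun j => lam fun j' =>
    let B : El (N A) := eta x
    -- Chosen so that `p' ⬝ o` equals `p`.
    let o : El (Id (N A) B B) := symm p' ⬝ p
    split j fun s h => split h fun l h => split h fun r₁ r₂ =>
    split j' fun s' h' => split h' fun l' h' => split h' fun r₁' r₂' =>
    split (conf B y p s l r₂ s' (l' ⬝ o)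
        (transport (fun z => R B y z s' (l' ⬝ o)) (concatSymmConcat p' p)
          (shift o r₂'))) fun v h => split h fun k h => split h fun c d =>
      cite eqOfLoop.index [N A, (eta v).val, B.val, (eta y).val, k.val, p.val, p'.val,
        (uniq v B x (refl ⬝ o) k (k ⬝ o) (tr B _ _ _ _ (shift o r₁') _ _ d)
          (shift o (tr B _ _ _ _ r₁ _ _ c))).val]) :: unique.library

theorem joinEq.theory : Theory (ctxOf joinEq.library) :=
  unique.theory.entry (by decide +kernel)

def joinEq.index : ℕ := unique.index + 1

def joinSource.library : List Entry := entry
  (Pi (U 0) fun A => Pi (Rel A) fun R => Transitive R ⇾ HasSteps R ⇾ Pi (L A) fun x₀ =>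
    Pi (L A) fun x => Pi (A ⊎ A) fun a => Pi (L A) fun y =>
    Pi (To (eta x₀) (x ++' y)) fun p => Join R x₀ (x ++' y) p ⇾
    Join R x₀ (x ++' redex a y) (tau x a y ⬝ p))
  (lam fun A => lam fun R => lam fun tr => lam fun st => lam fun x₀ => lam fun x => lam fun a =>
    lam fun y => lam fun p => lam fun j => split j fun s h => split h fun l h => split h fun r₁ r₂ =>
      pair s (pair l (pair r₁ (tr _ _ _ _ _ (st x a y _ p) _ _ r₂)))) :: joinEq.library

theorem joinSource.theory : Theory (ctxOf joinSource.library) :=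
  joinEq.theory.entry (by decide +kernel)

def joinSource.index : ℕ := joinEq.index + 1

/-- The reduction of `x a ā y` in the join need not begin with the given redex, so confluence is
needed. In the opposite direction, `joinSource`, the contraction is simply put in front. -/
def joinTarget.library : List Entry := entry
  (Pi (U 0) fun A => Pi (Rel A) fun R => Transitive R ⇾ HasSteps R ⇾ Confluent R ⇾
    Pi (L A) fun x₀ => Pi (L A) fun x => Pi (A ⊎ A) fun a => Pi (L A) fun y =>
    Pi (To (eta x₀) (x ++' redex a y)) fun p => Join R x₀ (x ++' redex a y) p ⇾
    Join R x₀ (x ++' y) (symm (tau x a y) ⬝ p))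
  (lam fun A => lam fun R => lam fun tr => lam fun st => lam fun conf => lam fun x₀ =>
    lam fun x => lam fun a => lam fun y => lam fun p => lam fun j =>
    split j fun s h => split h fun l h => split h fun r₁ r₂ =>
    split (conf _ _ _ _ _ r₂ _ _ (contractStep st x a y p)) fun w h => split h fun k h =>
      split h fun c d => pair w (pair k (pair (tr _ _ _ _ _ r₁ _ _ c) d))) :: joinSource.library

theorem joinTarget.theory : Theory (ctxOf joinTarget.library) :=
  joinSource.theory.entry (by decide +kernel)

def joinTarget.index : ℕ := joinSource.index + 1

/-- The elements of sets that satisfy a predicate with at most one solution. -/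
def withSolutions.library : List Entry := entry
  (Pi (U 0) fun I => Pi (I ⇾ U 0) fun T => Pi (Pi I fun y => T y ⇾ U 0) fun Q =>
    (Pi I fun y => isSet (T y)) ⇾
    (Pi I fun y => Pi (T y) fun p => Pi (T y) fun p' => Q y p ⇾ Q y p' ⇾ Id (T y) p p') ⇾
    Pi (U 1) fun C => (Pi (I ⇾ U 0) fun E => (Pi I fun y => isProp (E y)) ⇾
      Pi (Pi I fun y => E y ⇾ T y) fun d => (Pi I fun y => Pi (T y) fun p => Q y p ⇾ E y) ⇾
      (Pi I fun y => Pi (E y) fun c => Trunc (Q y (d y c))) ⇾ C) ⇾ C)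
  (lam fun I => lam fun T => lam fun Q => lam fun hT => lam fun hQ => lam fun C => lam fun k =>
    -- A solution is unique, but the witness of `Q` need not be; it is truncated so that `E y`
    -- becomes a proposition. The truncation can be eliminated into equalities of solutions because
    -- `T y` is a set.
    let E : El I → Exp := fun y => Sig (T y) fun p => Trunc (Q y p)
    k (lam fun y => ty (E y))
      (recast (lam fun y => lam fun c => lam fun c' =>
        sigInd (fun c => Id (E y) c c') c fun p t => sigInd (fun c' => Id (E y) (pair p t) c') c'
          fun p' t' => pairEq (B := fun p => Trunc (Q y p)) (lam fun _ => truncEq)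
            (untrunc t (hT y p p') fun j => untrunc t' (hT y p p') fun j' => hQ y p p' j j') t t'))
      (lam fun y => lam fun c => fst (recast c : El (E y)))
      (lam fun y => lam fun p => lam fun j => recast (pair (B := fun p => Trunc (Q y p)) p (mk j)))
      (lam fun y => lam fun c => recast (snd (recast c : El (E y))))) :: joinTarget.library

theorem withSolutions.theory : Theory (ctxOf withSolutions.library) :=
  joinTarget.theory.entry (by decide +kernel)

def withSolutions.index : ℕ := joinTarget.index + 1

def withSolutions {I C : Exp} (T : El I → Exp) (Q : (y : El I) → El (T y) → Exp)
    (hT : El (Pi I fun y => isSet (T y)))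
    (hQ : El (Pi I fun y => Pi (T y) fun p => Pi (T y) fun p' => Q y p ⇾ Q y p' ⇾ Id (T y) p p'))
    (k : (E : El (I ⇾ U 0)) → El (Pi I fun y => isProp (E y)) → (d : El (Pi I fun y => E y ⇾ T y)) →
      ((y : El I) → (p : El (T y)) → El (Q y p) → El (E y)) →
      ((y : El I) → (c : El (E y)) → El (Trunc (Q y (d y c)))) → El C) : El C :=
  cite withSolutions.index [I, fam T, Lam I fun y => fam fun p => Q ⟨y⟩ p, hT.val, hQ.val, C,
    (lam fun E => lam fun h => lam fun d => lam fun i => lam fun t =>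
      k E h d (fun y p q => i y p q) (fun y c => t y c) :
      El (Pi (I ⇾ U 0) fun E => (Pi I fun y => isProp (E y)) ⇾
        Pi (Pi I fun y => E y ⇾ T y) fun d => (Pi I fun y => Pi (T y) fun p => Q y p ⇾ E y) ⇾
        (Pi I fun y => Pi (E y) fun c => Trunc (Q y (d y c))) ⇾ C)).val]

/-- The paths from `η(y)` to `η(x)` that come from a join have at most one element by `joinEq`. They
are preserved by expansion and contraction of redexes, and the empty join makes them inhabited at
`x`, which is all that `isPropIdEta` requires. -/
def isPropIdOfConfluent.library : List Entry := entry
  (Pi (U 0) fun A => Pi (Rel A) fun R => Reflexive R ⇾ Transitive R ⇾ HasSteps R ⇾ Confluent R ⇾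
    (Pi (L A) fun t => Unique R t) ⇾ Pi (L A) fun x => Pi (N A) fun m => isProp (Id (N A) (eta x) m))
  (lam fun A => lam fun R => lam fun rf => lam fun tr' => lam fun st => lam fun conf =>
    lam fun uniq => lam fun x => withSolutions (fun y => To (eta x) y) (fun y p => Join R x y p)
      (lam fun y => tr (eta y) (eta x)) (cite joinEq.index [A, R.val, tr'.val, conf.val, uniq.val, x.val])
      fun E hE d i t => cite isPropIdEta.index [A, x.val, E.val, hE.val,
        (lam fun z => lam fun a => lam fun y => lam fun c => untrunc (t (z ++' redex a y) c) (hE _)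
          fun j => i _ _ (cite joinTarget.index [A, R.val, tr'.val, st.val, conf.val, x.val, z.val, a.val,
            y.val, (d _ c).val, j.val] :
            El (Join R x (z ++' y) (symm (tau z a y) ⬝ d (z ++' redex a y) c)))).val,
        (lam fun z => lam fun a => lam fun y => lam fun c => untrunc (t (z ++' y) c) (hE _)
          fun j => i _ _ (cite joinSource.index [A, R.val, tr'.val, st.val, x.val, z.val, a.val,
            y.val, (d _ c).val, j.val] :
            El (Join R x (z ++' redex a y) (tau z a y ⬝ d (z ++' y) c)))).val,
        d.val,
        (lam fun z => lam fun a => lam fun y => lam fun c => lam fun c' =>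
          -- An equation between paths in the 1-type `N(A)` is a proposition, so the two joins may
          -- be extracted from their truncations.
          let h : El (isProp (Id (To (eta x) (z ++' redex a y)) (d _ c) (tau z a y ⬝ d _ c'))) :=
            tr (eta (z ++' redex a y)) (eta x) (d _ c) (tau z a y ⬝ d _ c')
          untrunc (t (z ++' redex a y) c) h fun j => untrunc (t (z ++' y) c') h fun j' =>
          cite joinEq.index [A, R.val, tr'.val, conf.val, uniq.val, x.val, (z ++' redex a y).val,
            (d _ c).val, (tau z a y ⬝ d _ c').val, j.val,
            (cite joinSource.index [A, R.val, tr'.val, st.val, x.val, z.val, a.val, y.val, (d _ c').val,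
              j'.val] : El (Join R x (z ++' redex a y) (tau z a y ⬝ d (z ++' y) c'))).val]).val,
        (i x refl (pair x (pair refl (pair (rf _ _ _) (rf _ _ _))))).val]) :: withSolutions.library

theorem isPropIdOfConfluent.theory : Theory (ctxOf isPropIdOfConfluent.library) :=
  withSolutions.theory.entry (by decide +kernel)

def isPropIdOfConfluent.index : ℕ := withSolutions.index + 1

/-! ## The rewriting relation -/

/-- Equality of lists with paths to a point. -/
abbrev SamePath {A : Exp} {B : El (N A)} (v : El (L A)) (p : El (To B v)) (w : El (L A))
    (q : El (To B w)) : Exp :=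
  Sig (Id (L A) v w) fun e => Id _ p (apEta e ⬝ q)

/-- Lists with paths to a point. -/
abbrev Points (A : Exp) (C : Exp) : Exp :=
  Pi (N A ⇾ U 0) fun Y => Pi (Pi (N A) fun B => Pi (L A) fun v => To B v ⇾ Y B) fun mk =>
    (Pi (N A) fun B => Pi (Y B ⇾ U 0) fun P =>
      (Pi (L A) fun v => Pi (To B v) fun p => P (mk B v p)) ⇾ Pi (Y B) fun y => P y) ⇾
    (Pi (N A) fun B => Pi (L A) fun v => Pi (To B v) fun p => Pi (L A) fun w => Pi (To B w) fun q =>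
      Id (Y B) (mk B v p) (mk B w q) ⇾ SamePath v p w q) ⇾
    (Pi (N A) fun B => Pi (L A) fun v => Pi (To B v) fun p => Pi (L A) fun w => Pi (To B w) fun q =>
      SamePath v p w q ⇾ Id (Y B) (mk B v p) (mk B w q)) ⇾ C

/-- By path induction the first pair is fixed, and the target has to be a type computed from a
variable pair `y`; hence it is defined by elimination of `y` into `U 0`. -/
def samePath.library : List Entry := entry
  (Pi (U 0) fun A => Pi (N A) fun B => Pi (L A) fun v => Pi (To B v) fun p =>
    Pi (Sig (L A) fun v => To B v) fun y => Id (Sig (L A) fun v => To B v) (pair v p) y ⇾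
      (sigInd (fun _ => U 0) y fun w q => ty (SamePath v p w q) : El (U 0)))
  (lam fun A => lam fun B => lam fun v => lam fun p => lam fun y => lam fun h =>
    J (fun y _ => (sigInd (fun _ => U 0) y fun w q => ty (SamePath v p w q) : El (U 0))) h
      (recast (pair (B := fun e => Id _ p (apEta e ⬝ p)) refl (recast (symm (reflConcat p)))))) :: isPropIdOfConfluent.library

theorem samePath.theory : Theory (ctxOf samePath.library) :=
  isPropIdOfConfluent.theory.entry (by decide +kernel)

def samePath.index : ℕ := isPropIdOfConfluent.index + 1

def pathPair.library : List Entry := entry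
  (Pi (U 0) fun A => Pi (N A) fun B => Pi (L A) fun v => Pi (L A) fun w => Pi (Id (L A) v w) fun e =>
    Pi (To B v) fun p => Pi (To B w) fun q => Id _ p (apEta e ⬝ q) ⇾
      Id (Sig (L A) fun v => To B v) (pair v p) (pair w q))
  (lam fun A => lam fun B => lam fun v => lam fun w => lam fun e => lam fun p =>
    J (fun w e => Pi (To B w) fun q => Id _ p (apEta e ⬝ q) ⇾
      Id (Sig (L A) fun v => To B v) (pair v p) (pair w q)) e
      (lam fun q => lam fun h => ap (fun p => pair (B := fun v => To B v) v p)
        (recast h ⬝ reflConcat q))) :: samePath.library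

theorem pathPair.theory : Theory (ctxOf pathPair.library) :=
  samePath.theory.entry (by decide +kernel)

def pathPair.index : ℕ := samePath.index + 1

def points.library : List Entry := entry
  (Pi (U 0) fun A => Pi (U 1) fun C => Points A C ⇾ C)
  (lam fun A => lam fun C => lam fun k =>
    let Y := fun B => Sig (L A) fun v => To B v
    app (app (app (app (app k (lam fun B => ty (Y B)))
      (lam fun B => lam fun v => lam fun p => recast (pair (B := fun v => To B v) v p)))
      (lam fun B => lam fun P => lam fun h => lam fun y =>
        recast (sigInd (A := L A) (B := fun v => To B v) (fun y => P (recast y)) (recast y) fun v p =>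
          recast (h v p))))
      (lam fun B => lam fun v => lam fun p => lam fun w => lam fun q => lam fun h =>
        cite samePath.index [A, B.val, v.val, p.val, (pair (B := fun v => To B v) w q).val, h.val]))
      (lam fun B => lam fun v => lam fun p => lam fun w => lam fun q => lam fun h =>
        split h fun e h => cite pathPair.index [A, B.val, v.val, w.val, e.val, p.val, q.val, h.val])) :: pathPair.library

theorem points.theory : Theory (ctxOf points.library) :=
  pathPair.theory.entry (by decide +kernel)

def points.index : ℕ := pathPair.index + 1

/-- The contraction of a single redex. -/
abbrev Step (A : Exp) (Y : El (N A ⇾ U 0))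
    (mk : El (Pi (N A) fun B => Pi (L A) fun v => To B v ⇾ Y B)) (B : El (N A))
    (u v : El (Y B)) : Exp :=
  Sig (L A) fun x => Sig (A ⊎ A) fun a => Sig (L A) fun y => Sig (To B (x ++' y)) fun q =>
    Id (Y B) u (mk B (x ++' redex a y) (tau x a y ⬝ q)) ⊗ Id (Y B) v (mk B (x ++' y) q)

/-- Hides the definition of a step behind its introduction and its inversion, so that it stays
opaque in the closure and in the diamond argument. -/
def withStep.library : List Entry := entry
  (Pi (U 0) fun A => Pi (N A ⇾ U 0) fun Y =>
    Pi (Pi (N A) fun B => Pi (L A) fun v => To B v ⇾ Y B) fun mk =>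
    Pi (U 1) fun C => (Pi (Pi (N A) fun B => Y B ⇾ Y B ⇾ U 0) fun St =>
      (Pi (L A) fun x => Pi (A ⊎ A) fun a => Pi (L A) fun y => Pi (N A) fun B =>
        Pi (To B (x ++' y)) fun q =>
          St B (mk B (x ++' redex a y) (tau x a y ⬝ q)) (mk B (x ++' y) q)) ⇾
      (Pi (N A) fun B => Pi (Y B) fun u => Pi (Y B) fun v => St B u v ⇾ Step A Y mk B u v) ⇾ C) ⇾ C)
  (lam fun A => lam fun Y => lam fun mk => lam fun C => lam fun k =>
    k (lam fun B => lam fun u => lam fun v => ty (Step A Y mk B u v))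
      (lam fun x => lam fun a => lam fun y => lam fun B => lam fun q =>
        recast (pair x (pair a (pair y (pair q (pair refl refl)))) :
          El (Step A Y mk B (mk B (x ++' redex a y) (tau x a y ⬝ q)) (mk B (x ++' y) q))))
      (lam fun B => lam fun u => lam fun v => lam fun s => recast s)) :: points.library

theorem withStep.theory : Theory (ctxOf withStep.library) :=
  points.theory.entry (by decide +kernel)

def withStep.index : ℕ := points.index + 1

/-- Two contractions of the same list are equal, or have a common contraction. -/
abbrev LocalDiamond (A : Exp) : Exp :=
  Pi (Rel A) fun S => HasSteps S ⇾ Pi (N A) fun B =>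
    Pi (L A) fun x => Pi (A ⊎ A) fun a => Pi (L A) fun y => Pi (To B (x ++' y)) fun q =>
    Pi (L A) fun x' => Pi (A ⊎ A) fun a' => Pi (L A) fun y' => Pi (To B (x' ++' y')) fun q' =>
    SamePath (x ++' redex a y) (tau x a y ⬝ q) (x' ++' redex a' y') (tau x' a' y' ⬝ q') ⇾
    (SamePath (x ++' y) q (x' ++' y') q' ⊎
      Sig (L A) fun w => Sig (To B w) fun l => S B (x ++' y) q w l ⊗ S B (x' ++' y') q' w l)

/-- The local diamond speaks of explicit lists with paths. Inversion presents the two steps in that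
form, and the result is transported back along the equalities with the abstract points. -/
def diamond.library : List Entry := entry
  (Pi (U 0) fun A => LocalDiamond A ⇾ Pi (N A ⇾ U 0) fun Y =>
    Pi (Pi (N A) fun B => Pi (L A) fun v => To B v ⇾ Y B) fun mk =>
    (Pi (N A) fun B => Pi (L A) fun v => Pi (To B v) fun p => Pi (L A) fun w => Pi (To B w) fun q =>
      Id (Y B) (mk B v p) (mk B w q) ⇾ SamePath v p w q) ⇾
    (Pi (N A) fun B => Pi (L A) fun v => Pi (To B v) fun p => Pi (L A) fun w => Pi (To B w) fun q =>
      SamePath v p w q ⇾ Id (Y B) (mk B v p) (mk B w q)) ⇾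
    Pi (Pi (N A) fun B => Y B ⇾ Y B ⇾ U 0) fun St =>
    (Pi (L A) fun x => Pi (A ⊎ A) fun a => Pi (L A) fun y => Pi (N A) fun B =>
        Pi (To B (x ++' y)) fun q =>
          St B (mk B (x ++' redex a y) (tau x a y ⬝ q)) (mk B (x ++' y) q)) ⇾
    (Pi (N A) fun B => Pi (Y B) fun u => Pi (Y B) fun v => St B u v ⇾ Step A Y mk B u v) ⇾
    Pi (N A) fun B => Diamond (Y B) (fun u v => St B u v))
  (lam fun A => lam fun dia => lam fun Y => lam fun mk => lam fun inv => lam fun path =>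
    lam fun St => lam fun st => lam fun elim => lam fun B => lam fun u => lam fun v => lam fun v' =>
    lam fun s => lam fun s' =>
    let E : El (Y B) → El (Y B) → Exp := StEq fun u v => St B u v
    -- `LocalDiamond` is stated for every relation that contains the steps, so that it can be proved
    -- without the type `Y`; here it is applied to the steps themselves.
    let S : El (Rel A) := lam fun B => lam fun v => lam fun p => lam fun w => lam fun q =>
      ty (St B (mk B v p) (mk B w q))
    split (elim B u v s) fun x h => split h fun a h => split h fun y h => split h fun q h =>
    split h fun e₁ e₂ =>
    split (elim B u v' s') fun x' h => split h fun a' h => split h fun y' h => split h fun q' h =>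
    split h fun e₁' e₂' =>
    cases (recast (dia S (recast st) B x a y q x' a' y' q'
        (inv _ _ _ _ _ (symm e₁ ⬝ e₁'))) : El (SamePath (x ++' y) q (x' ++' y') q' ⊎
        Sig (L A) fun w => Sig (To B w) fun l =>
          St B (mk B (x ++' y) q) (mk B w l) ⊗ St B (mk B (x' ++' y') q') (mk B w l)))
      -- If the two contractions agree, no further step is needed on either side.
      (fun h => pair (B := fun w => E v w ⊗ E v' w) v'
        (pair (inl (e₂ ⬝ path _ _ _ _ _ h ⬝ symm e₂')) (inl refl)))
      (fun h => split h fun w h => split h fun l h => split h fun r r' =>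
        pair (B := fun w => E v w ⊗ E v' w) (mk B w l)
          (pair (inr (transport (fun v => St B v (mk B w l)) (symm e₂) r))
            (inr (transport (fun v => St B v (mk B w l)) (symm e₂') r'))))) :: withStep.library

theorem diamond.theory : Theory (ctxOf diamond.library) :=
  withStep.theory.entry (by decide +kernel)

def diamond.index : ℕ := withStep.index + 1

/-- The relation generated by contractions. -/
def rewriting.library : List Entry := entry
  (Pi (U 0) fun A => LocalDiamond A ⇾ Pi (U 1) fun C => (Pi (Rel A) fun R => Reflexive R ⇾
    Transitive R ⇾ HasSteps R ⇾ Confluent R ⇾ Reduces R ⇾ C) ⇾ C)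
  (lam fun A => lam fun dia => lam fun C => lam fun k =>
    cite points.index [A.val, C.val, (lam fun Y => lam fun mk => lam fun ind => lam fun inv =>
      lam fun path => cite withStep.index [A.val, Y.val, mk.val, C.val, (lam fun St => lam fun st =>
        lam fun elim => cite closure.index [N A, Y.val, St.val, C.val,
          (lam fun R => lam fun rf => lam fun add => lam fun si =>
            let dm : El (Pi (N A) fun B => Diamond (Y B) (fun u v => St B u v)) :=
              cite diamond.index [A.val, dia.val, Y.val, mk.val, inv.val, path.val, St.val, st.val, elim.val]
            let R' : El (Rel A) := lam fun B => lam fun v => lam fun p => lam fun w => lam fun q =>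
              ty (R B (mk B v p) (mk B w q))
            k R' (lam fun B => lam fun v => lam fun p => recast (rf B (mk B v p)))
              (lam fun B => lam fun u => lam fun k => lam fun v => lam fun p => lam fun r =>
                lam fun w => lam fun q => lam fun r' => cite trans.index [Y B, App St.val B.val,
                  App R.val B.val, App rf.val B.val, App add.val B.val, App si.val B.val,
                  (mk B u k).val, (mk B v p).val, r.val, (mk B w q).val, r'.val])
              (lam fun x => lam fun a => lam fun y => lam fun B => lam fun q =>
                recast (add B _ _ _ (st x a y B q) (rf B (mk B (x ++' y) q))))
              (lam fun B => lam fun u => lam fun k => lam fun v => lam fun p => lam fun r =>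
                lam fun w => lam fun q => lam fun r' =>
                let G := Sig (L A) fun z => Sig (To B z) fun l =>
                  R B (mk B v p) (mk B z l) ⊗ R B (mk B w q) (mk B z l)
                let h : El (Sig (Y B) fun z => R B (mk B v p) z ⊗ R B (mk B w q) z) :=
                  cite confluence.index [Y B, App St.val B.val,
                  App R.val B.val, App rf.val B.val, App add.val B.val, App si.val B.val,
                  App dm.val B.val,
                  (mk B u k).val, (mk B v p).val, r.val, (mk B w q).val, r'.val]
                -- Confluence yields an abstract point `z`; the induction principle of `Y B`
                -- replaces it by a list with a path.
                recast (split h fun z h => split h fun c d =>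
                  (⟨HoTT.App (HoTT.App (HoTT.App (HoTT.App (HoTT.App (HoTT.App ind.val B.val)
                    (fam fun z => R B (mk B v p) z ⇾ R B (mk B w q) z ⇾ G))
                    (lam fun z => lam fun l => lam fun c => lam fun d =>
                      pair z (pair l (pair c d)) : El (Pi (L A) fun z => Pi (To B z) fun l =>
                        R B (mk B v p) (mk B z l) ⇾ R B (mk B w q) (mk B z l) ⇾ G)).val) z.val) c.val)
                    d.val⟩ : El G)))
              (lam fun B => lam fun t => lam fun q => lam fun w => lam fun l => lam fun r =>
                let h : El (Id (Y B) (mk B t q) (mk B w l) ⊎ Sig (Y B) fun z =>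
                    St B (mk B t q) z ⊗ R B z (mk B w l)) :=
                  cite firstStep.index [Y B, App St.val B.val,
                  App R.val B.val, App rf.val B.val, App add.val B.val, App si.val B.val,
                  (mk B t q).val, (mk B w l).val, r.val]
                cases h (fun e => inl (inv _ _ _ _ _ e))
                  (fun h => split h fun z h => split h fun s _ => split (elim _ _ _ s) fun x h =>
                    split h fun a h => split h fun y h => split h fun q' h => split h fun e _ =>
                    split (inv _ _ _ _ _ e) fun e _ => inr (pair x (pair a (pair y (symm e)))))) :
            El (Pi (Pi (N A) fun B => Y B ⇾ Y B ⇾ U 0) fun R =>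
              (Pi (N A) fun B => Pi (Y B) fun x => R B x x) ⇾
              (Pi (N A) fun B => Pi (Y B) fun x => Pi (Y B) fun y => Pi (Y B) fun z =>
                St B x y ⇾ R B y z ⇾ R B x z) ⇾
              (Pi (N A) fun B => StepInd (Y B) (fun x y => St B x y) (fun x y => R B x y)) ⇾ C)).val] :
        El (Pi (Pi (N A) fun B => Y B ⇾ Y B ⇾ U 0) fun St =>
          (Pi (L A) fun x => Pi (A ⊎ A) fun a => Pi (L A) fun y => Pi (N A) fun B =>
            Pi (To B (x ++' y)) fun q =>
              St B (mk B (x ++' redex a y) (tau x a y ⬝ q)) (mk B (x ++' y) q)) ⇾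
          (Pi (N A) fun B => Pi (Y B) fun u => Pi (Y B) fun v => St B u v ⇾ Step A Y mk B u v) ⇾
            C)).val] : El (Points A C)).val]) :: diamond.library

theorem rewriting.theory : Theory (ctxOf rewriting.library) :=
  diamond.theory.entry (by decide +kernel)

def rewriting.index : ℕ := diamond.index + 1

/-! ## Sums, lists and natural numbers -/

def isPropEmpty.library : List Entry := entry
  (isProp EmptyT)
  (lam fun p => lam fun q => absurd p) :: rewriting.library

theorem isPropEmpty.theory : Theory (ctxOf isPropEmpty.library) :=
  rewriting.theory.entry (by decide +kernel)

def isPropEmpty.index : ℕ := rewriting.index + 1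

def isPropEmpty : El (isProp EmptyT) := cite isPropEmpty.index []

def isPropUnit.library : List Entry := entry
  (isProp UnitT)
  (lam fun p => lam fun q => unitInd (fun p => Id UnitT p q) p
    (unitInd (fun q => Id UnitT star q) q refl)) :: isPropEmpty.library

theorem isPropUnit.theory : Theory (ctxOf isPropUnit.library) :=
  isPropEmpty.theory.entry (by decide +kernel)

def isPropUnit.index : ℕ := isPropEmpty.index + 1

def isPropUnit : El (isProp UnitT) := cite isPropUnit.index []

/-- A family of propositions on a sum. -/
def sumFamily.library : List Entry := entry
  (Pi (U 0) fun A => Pi (U 0) fun B => Pi (A ⇾ U 0) fun P => Pi (B ⇾ U 0) fun Q =>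
    (Pi A fun a => isProp (P a)) ⇾ (Pi B fun b => isProp (Q b)) ⇾
    Pi (U 1) fun C => (Pi (A ⊎ B ⇾ U 0) fun F => (Pi (A ⊎ B) fun w => isProp (F w)) ⇾
      (Pi A fun a => P a ⇾ F (inl a)) ⇾ (Pi B fun b => Q b ⇾ F (inr b)) ⇾
      (Pi A fun a => F (inl a) ⇾ P a) ⇾ (Pi B fun b => F (inr b) ⇾ Q b) ⇾ C) ⇾ C)
  (lam fun A => lam fun B => lam fun P => lam fun Q => lam fun hP => lam fun hQ => lam fun C =>
    lam fun k =>
    let F : El (A ⊎ B) → El (U 0) := fun w => sumInd (fun _ => U 0) w (fun a => P a) (fun b => Q b)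
    k (lam F)
      (recast (lam fun w => sumInd (fun w => isProp (F w)) w (fun a => recast (hP a))
        (fun b => recast (hQ b))))
      (lam fun a => lam fun p => recast p) (lam fun b => lam fun p => recast p)
      (lam fun a => lam fun p => recast p) (lam fun b => lam fun p => recast p)) :: isPropUnit.library

theorem sumFamily.theory : Theory (ctxOf sumFamily.library) :=
  isPropUnit.theory.entry (by decide +kernel)

def sumFamily.index : ℕ := isPropUnit.index + 1

def sumFamily {A B C : Exp} (P : El A → Exp) (Q : El B → Exp) (hP : (a : El A) → El (isProp (P a)))
    (hQ : (b : El B) → El (isProp (Q b)))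
    (k : (F : El (A ⊎ B ⇾ U 0)) → El (Pi (A ⊎ B) fun w => isProp (F w)) →
      ((a : El A) → El (P a) → El (F (inl a))) → ((b : El B) → El (Q b) → El (F (inr b))) →
      ((a : El A) → El (F (inl a)) → El (P a)) → ((b : El B) → El (F (inr b)) → El (Q b)) → El C) :
    El C :=
  cite sumFamily.index [A, B, fam P, fam Q, (lam hP).val, (lam hQ).val, C,
    (lam fun F => lam fun h => lam fun i => lam fun i' => lam fun j => lam fun j' =>
      k F h (fun a p => i a p) (fun b p => i' b p) (fun a p => j a p) (fun b p => j' b p) :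
      El (Pi (A ⊎ B ⇾ U 0) fun F => (Pi (A ⊎ B) fun w => isProp (F w)) ⇾
        (Pi A fun a => P a ⇾ F (inl a)) ⇾ (Pi B fun b => Q b ⇾ F (inr b)) ⇾
        (Pi A fun a => F (inl a) ⇾ P a) ⇾ (Pi B fun b => F (inr b) ⇾ Q b) ⇾ C)).val]

/-- The sum of two sets is a set. -/
def isSetSum.library : List Entry := entry
  (Pi (U 0) fun A => isSet A ⇾ isSet (A ⊎ A))
  (lam fun A => lam fun h => lam fun v => sumInd (fun v => Pi (A ⊎ A) fun w => isProp (Id _ v w)) v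
    -- The family is equality with `a` on the left summand and empty on the right one. It describes
    -- the paths out of `inl a` in the sense of `isPropIdAt`.
    (fun a => sumFamily (fun b => Id A a b) (fun _ => EmptyT) (fun b => h a b) (fun _ => isPropEmpty)
      fun F hF i _ j j' => isPropIdAt (C := fun w => F w) hF (i a refl)
        (lam fun w => sumInd (fun w => F w ⇾ Id (A ⊎ A) (inl a) w) w
          (fun b => lam fun p => ap (fun a => inl a) (j b p)) (fun b => lam fun p => absurd (j' b p))))
    (fun a => sumFamily (fun _ => EmptyT) (fun b => Id A a b) (fun _ => isPropEmpty) (fun b => h a b)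
      fun F hF _ i j j' => isPropIdAt (C := fun w => F w) hF (i a refl)
        (lam fun w => sumInd (fun w => F w ⇾ Id (A ⊎ A) (inr a) w) w
          (fun b => lam fun p => absurd (j b p))
          (fun b => lam fun p => ap (fun a => inr a) (j' b p))))) :: sumFamily.library

theorem isSetSum.theory : Theory (ctxOf isSetSum.library) :=
  sumFamily.theory.entry (by decide +kernel)

def isSetSum.index : ℕ := sumFamily.index + 1

/-- A family of propositions on lists. -/
def listFamily.library : List Entry := entry
  (Pi (U 0) fun A => Pi (U 0) fun P => Pi (A ⇾ ListT A ⇾ U 0) fun Q =>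
    isProp P ⇾ (Pi A fun a => Pi (ListT A) fun x => isProp (Q a x)) ⇾
    Pi (U 1) fun C => (Pi (ListT A ⇾ U 0) fun F => (Pi (ListT A) fun x => isProp (F x)) ⇾
      (P ⇾ F nil) ⇾ (Pi A fun a => Pi (ListT A) fun x => Q a x ⇾ F (cons a x)) ⇾
      (F nil ⇾ P) ⇾ (Pi A fun a => Pi (ListT A) fun x => F (cons a x) ⇾ Q a x) ⇾ C) ⇾ C)
  (lam fun A => lam fun P => lam fun Q => lam fun hP => lam fun hQ => lam fun C => lam fun k =>
    let F : El (ListT A) → El (U 0) := fun x => listInd (fun _ => U 0) x P (fun a x _ => Q a x)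
    k (lam F)
      (recast (lam fun x => listInd (fun x => isProp (F x)) x (recast hP)
        (fun a x _ => recast (hQ a x))))
      (lam fun p => recast p) (lam fun a => lam fun x => lam fun p => recast p)
      (lam fun p => recast p) (lam fun a => lam fun x => lam fun p => recast p)) :: isSetSum.library

theorem listFamily.theory : Theory (ctxOf listFamily.library) :=
  isSetSum.theory.entry (by decide +kernel)

def listFamily.index : ℕ := isSetSum.index + 1

def listFamily {A P C : Exp} (Q : El A → El (ListT A) → Exp) (hP : El (isProp P))
    (hQ : (a : El A) → (x : El (ListT A)) → El (isProp (Q a x)))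
    (k : (F : El (ListT A ⇾ U 0)) → El (Pi (ListT A) fun x => isProp (F x)) →
      (El P → El (F nil)) → ((a : El A) → (x : El (ListT A)) → El (Q a x) → El (F (cons a x))) →
      (El (F nil) → El P) → ((a : El A) → (x : El (ListT A)) → El (F (cons a x)) → El (Q a x)) →
      El C) : El C :=
  cite listFamily.index [A, P, Lam A fun a => fam fun x => Q ⟨a⟩ x, hP.val,
    (lam fun a => lam fun x => hQ a x).val, C,
    (lam fun F => lam fun h => lam fun i => lam fun i' => lam fun j => lam fun j' =>
      k F h (fun p => i p) (fun a x p => i' a x p) (fun p => j p) (fun a x p => j' a x p) :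
      El (Pi (ListT A ⇾ U 0) fun F => (Pi (ListT A) fun x => isProp (F x)) ⇾
        (P ⇾ F nil) ⇾ (Pi A fun a => Pi (ListT A) fun x => Q a x ⇾ F (cons a x)) ⇾
        (F nil ⇾ P) ⇾ (Pi A fun a => Pi (ListT A) fun x => F (cons a x) ⇾ Q a x) ⇾ C)).val]

def consEq.library : List Entry := entry
  (Pi (U 0) fun A => Pi A fun a => Pi A fun b => Id A a b ⇾ Pi (ListT A) fun x =>
    Pi (ListT A) fun y => Id (ListT A) x y ⇾ Id (ListT A) (cons a x) (cons b y))
  (lam fun A => lam fun a => lam fun b => lam fun p => lam fun x => lam fun y => lam fun q =>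
    ap (fun a => cons a x) p ⬝ ap (fun x => cons b x) q) :: listFamily.library

theorem consEq.theory : Theory (ctxOf consEq.library) :=
  listFamily.theory.entry (by decide +kernel)

def consEq.index : ℕ := listFamily.index + 1

def consEq {A : Exp} {a b : El A} (p : El (Id A a b)) {x y : El (ListT A)}
    (q : El (Id (ListT A) x y)) : El (Id (ListT A) (cons a x) (cons b y)) :=
  cite consEq.index [A, a.val, b.val, p.val, x.val, y.val, q.val]

/-- Lists of elements of a set are a set. -/
def isSetList.library : List Entry := entry
  (Pi (U 0) fun A => isSet A ⇾ isSet (ListT A))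
  (lam fun A => lam fun h => lam fun x =>
    listInd (fun x => Pi (ListT A) fun y => isProp (Id (ListT A) x y)) x
      (listFamily (P := UnitT) (fun _ _ => EmptyT) isPropUnit (fun _ _ => isPropEmpty)
        fun F hF i _ _ j => isPropIdAt (C := fun x => F x) hF (i star)
          (lam fun y => listInd (fun y => F y ⇾ Id (ListT A) nil y) y (lam fun _ => refl)
            (fun b y _ => lam fun p => absurd (j b y p))))
      (fun a x ih => listFamily (P := EmptyT) (fun b y => Id A a b ⊗ Id (ListT A) x y) isPropEmpty
        (fun b y => isPropProd (h a b) (ih y))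
        fun F hF _ i j j' => isPropIdAt (C := fun x => F x) hF (i a x (pair refl refl))
          (lam fun y => listInd (fun y => F y ⇾ Id (ListT A) (cons a x) y) y
            (lam fun p => absurd (j p))
            (fun b y _ => lam fun p => split (j' b y p) fun p q => consEq p q)))) :: consEq.library

theorem isSetList.theory : Theory (ctxOf isSetList.library) :=
  consEq.theory.entry (by decide +kernel)

def isSetList.index : ℕ := consEq.index + 1

/-- Equal lists have equal heads and tails. -/
def consInj.library : List Entry := entry
  (Pi (U 0) fun A => Pi A fun a => Pi A fun b => Pi (ListT A) fun x => Pi (ListT A) fun y =>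
    Id (ListT A) (cons a x) (cons b y) ⇾ Id A a b ⊗ Id (ListT A) x y)
  (lam fun A => lam fun a => lam fun b => lam fun x => lam fun y => lam fun p =>
    -- Head and tail are functions on all lists; their values at the empty list, `a` and `nil`, do
    -- not matter.
    pair (recast (ap (fun z => listInd (fun _ => A) z a (fun h _ _ => h)) p))
      (recast (ap (fun z => listInd (fun _ => ListT A) z nil (fun _ t _ => t)) p))) :: isSetList.library

theorem consInj.theory : Theory (ctxOf consInj.library) :=
  isSetList.theory.entry (by decide +kernel)

def consInj.index : ℕ := isSetList.index + 1

def consInj {A C : Exp} {a b : El A} {x y : El (ListT A)}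
    (p : El (Id (ListT A) (cons a x) (cons b y)))
    (f : El (Id A a b) → El (Id (ListT A) x y) → El C) : El C :=
  split (cite consInj.index [A, a.val, b.val, x.val, y.val, p.val] : El (Id A a b ⊗ Id (ListT A) x y)) f

def succNeZero.library : List Entry := entry
  (Pi NatT fun n => Id NatT (succ n) zero ⇾ EmptyT)
  -- Transport in a family that is the unit type at successors and empty at `zero`.
  (lam fun n => lam fun p => recast (transport (fun n => natInd (fun _ => U 0) n (ty EmptyT)
    (fun _ _ => ty UnitT)) p (recast star))) :: consInj.library

theorem succNeZero.theory : Theory (ctxOf succNeZero.library) :=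
  consInj.theory.entry (by decide +kernel)

def succNeZero.index : ℕ := consInj.index + 1

def succInj.library : List Entry := entry
  (Pi NatT fun n => Pi NatT fun m => Id NatT (succ n) (succ m) ⇾ Id NatT n m)
  (lam fun n => lam fun m => lam fun p =>
    recast (ap (fun k => natInd (fun _ => NatT) k zero (fun n _ => n)) p)) :: succNeZero.library

theorem succInj.theory : Theory (ctxOf succInj.library) :=
  succNeZero.theory.entry (by decide +kernel)

def succInj.index : ℕ := succNeZero.index + 1

def succInj {n m : El NatT} (p : El (Id NatT (succ n) (succ m))) : El (Id NatT n m) :=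
  cite succInj.index [n.val, m.val, p.val]

/-! ## Redexes in lists -/

/-- The length is the measure for well-founded induction; the equation, by induction on `x`, says
that a contraction lowers it by exactly two. -/
def withLength.library : List Entry := entry
  (Pi (U 0) fun A => Pi (U 1) fun C => (Pi (L A ⇾ NatT) fun len =>
    (Pi (L A) fun x => Pi (A ⊎ A) fun a => Pi (L A) fun y =>
      Id NatT (succ (succ (len (x ++' y)))) (len (x ++' redex a y))) ⇾ C) ⇾ C)
  (lam fun A => lam fun C => lam fun k =>
    let len : El (L A) → El NatT := fun x => listInd (fun _ => NatT) x zero fun _ _ n => succ n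
    k (lam len) (lam fun x => lam fun a => lam fun y => recast (listInd (fun x =>
      Id NatT (succ (succ (len (x ++' y)))) (len (x ++' redex a y))) x (recast (refl (A := NatT)
        (x := succ (succ (len y))))) fun _ _ p => recast (ap (fun n => succ n) p)))) :: succInj.library

theorem withLength.theory : Theory (ctxOf withLength.library) :=
  succInj.theory.entry (by decide +kernel)

def withLength.index : ℕ := succInj.index + 1

/-- Since a contraction lowers the length by two, ordinary induction on `n` carries the claim for
the lengths `n` and `n + 1` together. At lengths `0` and `1` there is no redex. -/
def listWf.library : List Entry := entry
  (Pi (U 0) fun A => ListWf A)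
  (lam fun A => lam fun P => lam fun step => cite withLength.index [A.val,
    Pi (L A) fun t => P t, (lam fun len => lam fun h =>
    let Q : El NatT → Exp := fun n => (Pi (L A) fun t => Id NatT (len t) n ⇾ P t) ⊗
      (Pi (L A) fun t => Id NatT (len t) (succ n) ⇾ P t)
    let all : El (Pi NatT fun n => Q n) := lam fun n => natInd Q n
      (pair
        (lam fun t => lam fun p => step t (lam fun x => lam fun a => lam fun y => lam fun e =>
          absurd (cite succNeZero.index [(succ (len (x ++' y))).val,
            (h x a y ⬝ ap (fun t => len t) e ⬝ p).val])))
        (lam fun t => lam fun p => step t (lam fun x => lam fun a => lam fun y => lam fun e =>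
          absurd (cite succNeZero.index [(len (x ++' y)).val,
            (succInj (h x a y ⬝ ap (fun t => len t) e ⬝ p)).val]))))
      (fun n ih => split ih fun f g => pair g
        (lam fun t => lam fun p => step t (lam fun x => lam fun a => lam fun y => lam fun e =>
          f (x ++' y) (succInj (succInj (h x a y ⬝ ap (fun t => len t) e ⬝ p))))))
    lam fun t => split (all (len t)) fun f _ => f t refl :
    El (Pi (L A ⇾ NatT) fun len =>
      (Pi (L A) fun x => Pi (A ⊎ A) fun a => Pi (L A) fun y =>
        Id NatT (succ (succ (len (x ++' y)))) (len (x ++' redex a y))) ⇾ Pi (L A) fun t => P t)).val]) :: withLength.library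

theorem listWf.theory : Theory (ctxOf listWf.library) :=
  withLength.theory.entry (by decide +kernel)

def listWf.index : ℕ := withLength.index + 1

def appendNil.library : List Entry := entry
  (Pi (U 0) fun A => Pi (L A) fun x => Id (L A) (x ++' nil) x)
  (lam fun A => lam fun x => listInd (fun x => Id (L A) (x ++' nil) x) x (recast (refl (A := L A)
    (x := nil))) fun a x p => recast (ap (fun x => cons a x) p)) :: listWf.library

theorem appendNil.theory : Theory (ctxOf appendNil.library) :=
  listWf.theory.entry (by decide +kernel)

def appendNil.index : ℕ := listWf.index + 1

/-- One of two beginnings of a list extends the other. -/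
def beginnings.library : List Entry := entry
  (Pi (U 0) fun A => Pi (L A) fun u => Pi (L A) fun u' => Pi (L A) fun v => Pi (L A) fun v' =>
    Id (L A) (u ++' v) (u' ++' v') ⇾
    ((Sig (L A) fun m => Id (L A) (u ++' m) u' ⊗ Id (L A) v (m ++' v')) ⊎
      (Sig (L A) fun m => Id (L A) (u' ++' m) u ⊗ Id (L A) v' (m ++' v))))
  (lam fun A => lam fun u =>
    let G (u u' v v' : El (L A)) : Exp :=
      (Sig (L A) fun m => Id (L A) (u ++' m) u' ⊗ Id (L A) v (m ++' v')) ⊎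
      (Sig (L A) fun m => Id (L A) (u' ++' m) u ⊗ Id (L A) v' (m ++' v))
    let H (u u' : El (L A)) : Exp := Pi (L A) fun v => Pi (L A) fun v' =>
      Id (L A) (u ++' v) (u' ++' v') ⇾ G u u' v v'
    listInd (fun u => Pi (L A) fun u' => H u u') u
      (lam fun u' => lam fun v => lam fun v' => lam fun p =>
        inl (pair u' (pair (recast (refl (x := u'))) (recast p))))
      (fun a u ih => lam fun u' => listInd (fun u' => H (cons a u) u') u'
        (lam fun v => lam fun v' => lam fun p =>
          inr (pair (cons a u) (pair (recast (refl (x := cons a u))) (recast (symm p)))))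
        (fun b u' _ => lam fun v => lam fun v' => lam fun p =>
          consInj (recast p : El (Id (L A) (cons a (u ++' v)) (cons b (u' ++' v')))) fun e p =>
          cases (ih u' v v' p)
            (fun h => split h fun m h => split h fun p q =>
              inl (pair m (pair (recast (consEq e p)) q)))
            (fun h => split h fun m h => split h fun p q =>
              inr (pair m (pair (recast (consEq (symm e) p)) q)))))) :: appendNil.library

theorem beginnings.theory : Theory (ctxOf beginnings.library) :=
  appendNil.theory.entry (by decide +kernel)

def beginnings.index : ℕ := appendNil.index + 1

/-- The relative position of two redexes. -/
abbrev Overlap {A : Exp} (a : El (A ⊎ A)) (y m : El (L A)) (a' : El (A ⊎ A)) (y' : El (L A)) :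
    Exp :=
  (Id (L A) nil m ⊗ Id (A ⊎ A) a a' ⊗ Id (L A) y y') ⊎
  (Id (L A) (cons a nil) m ⊗ Id (A ⊎ A) (bar a) a' ⊗ Id (L A) (cons a y') y) ⊎
  Sig (L A) fun m' => Id (L A) (redex a m') m ⊗ Id (L A) (m' ++' redex a' y') y

def barBar {A : Exp} (a : El (A ⊎ A)) : El (Id (A ⊎ A) (bar (bar a)) a) := ⟨HoTT.barBar A a.val⟩

/-- Only the first two letters of `m` matter. If `m` is empty, the redexes coincide; if it has one
letter, they share the letter `ā = a'`; otherwise the second redex lies inside `y`. -/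
def overlap.library : List Entry := entry
  (Pi (U 0) fun A => Pi (A ⊎ A) fun a => Pi (L A) fun y => Pi (A ⊎ A) fun a' => Pi (L A) fun y' =>
    Pi (L A) fun m => Id (L A) (redex a y) (m ++' redex a' y') ⇾ Overlap a y m a' y')
  (lam fun A => lam fun a => lam fun y => lam fun a' => lam fun y' => lam fun m =>
    listInd (fun m => Id (L A) (redex a y) (m ++' redex a' y') ⇾ Overlap a y m a' y') m
      (lam fun p => consInj (recast p : El (Id (L A) (redex a y) (redex a' y'))) fun e p =>
        consInj p fun _ p => inl (pair refl (pair e p)))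
      (fun b m _ => listInd (fun m =>
          Id (L A) (redex a y) (cons b m ++' redex a' y') ⇾ Overlap a y (cons b m) a' y') m
        (lam fun p => consInj (recast p : El (Id (L A) (redex a y) (cons b (redex a' y')))) fun e p =>
          -- Here `y` begins with the inverse of `a'`, and this is `a` because `a'` is `ā` and the
          -- change of sign is an involution.
          consInj p fun e' p => inr (inl (pair (consEq e refl) (pair e'
            (consEq (symm (barBar a) ⬝ ap (fun a => bar a) e') refl ⬝ symm p)))))
        (fun c m _ => lam fun p =>
          consInj (recast p :
            El (Id (L A) (redex a y) (cons b (cons c (m ++' redex a' y'))))) fun e p =>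
          consInj p fun e' p => inr (inr (pair m (pair (consEq e (consEq e' refl)) (symm p))))))) :: beginnings.library

theorem overlap.theory : Theory (ctxOf overlap.library) :=
  beginnings.theory.entry (by decide +kernel)

def overlap.index : ℕ := beginnings.index + 1

/-! ## The constructors `sw` and `ov` -/

def apConcat.library : List Entry := entry
  (Pi (U 0) fun A => Pi (L A) fun x => Pi (L A) fun y => Pi (L A) fun z => Pi (N A) fun B =>
    Pi (Id (L A) x y) fun e => Pi (Id (L A) y z) fun e' => Pi (To B z) fun r =>
      Id (To B x) (apEta e ⬝ apEta e' ⬝ r) (apEta (e ⬝ e') ⬝ r))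
  (lam fun A => lam fun x => lam fun y => lam fun z => lam fun B => lam fun e => lam fun e' =>
    J (fun z e' => Pi (To B z) fun r => Id (To B x) (apEta e ⬝ apEta e' ⬝ r)
      (apEta (e ⬝ e') ⬝ r)) e' (lam fun r => recast (ap (fun r => apEta e ⬝ r) (reflConcat r)))) :: overlap.library

theorem apConcat.theory : Theory (ctxOf apConcat.library) :=
  overlap.theory.entry (by decide +kernel)

def apConcat.index : ℕ := overlap.index + 1

def ovPath {A : Exp} (x : El (L A)) (a : El (A ⊎ A)) (y : El (L A))
    {e : El (Id (L A) (x ++' redex a (cons a y)) (x ++' redex a (cons (bar (bar a)) y)))}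
    {e' : El (Id (L A) (x ++' redex a (cons (bar (bar a)) y)) ((x ++' cons a nil) ++' redex (bar a) y))}
    {l : El (Id (L A) ((x ++' cons a nil) ++' y) (x ++' cons a y))} :
    El (Id _ (tau x a (cons a y))
      (apEta e ⬝ apEta e' ⬝ tau (x ++' cons a nil) (bar a) y ⬝ apEta l)) :=
  ⟨HoTT.K .ov A x.val a.val y.val⟩

def assoc {A : Exp} (x y z : El (L A)) : El (Id (L A) ((x ++' y) ++' z) (x ++' (y ++' z))) :=
  ⟨HoTT.assoc A x.val y.val z.val⟩

/-- The equalities of lists in the constructor are hidden in a pair type. As lists form a set, it is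
irrelevant which ones occur, and later arguments need not mention associativity. -/
def ov.library : List Entry := entry
  (Pi (U 0) fun A => Pi (L A) fun x => Pi (A ⊎ A) fun a => Pi (L A) fun y =>
    Sig (Id (L A) (x ++' redex a (cons a y)) ((x ++' cons a nil) ++' redex (bar a) y)) fun e =>
    Sig (Id (L A) ((x ++' cons a nil) ++' y) (x ++' cons a y)) fun l =>
      Id _ (tau x a (cons a y)) (apEta e ⬝ tau (x ++' cons a nil) (bar a) y ⬝ apEta l))
  (lam fun A => lam fun x => lam fun a => lam fun y =>
    let s : El (L A) := cons a nil
    let e : El (Id (L A) (x ++' redex a (cons a y)) (x ++' redex a (cons (bar (bar a)) y))) :=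
      ap (fun b => x ++' redex a (cons b y)) (symm (barBar a))
    let e' : El (Id (L A) (x ++' redex a (cons (bar (bar a)) y)) ((x ++' s) ++' redex (bar a) y)) :=
      recast (symm (assoc x s (redex (bar a) y)))
    let l : El (Id (L A) ((x ++' s) ++' y) (x ++' cons a y)) := recast (assoc x s y)
    pair (e ⬝ e') (pair l (ovPath x a y (e := e) (e' := e') (l := l) ⬝
      cite apConcat.index [A.val, (x ++' redex a (cons a y)).val,
        (x ++' redex a (cons (bar (bar a)) y)).val, ((x ++' s) ++' redex (bar a) y).val,
        (eta (x ++' cons a y)).val, e.val, e'.val,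
        (tau (x ++' s) (bar a) y ⬝ apEta l).val]))) :: apConcat.library

theorem ov.theory : Theory (ctxOf ov.library) :=
  apConcat.theory.entry (by decide +kernel)

def ov.index : ℕ := apConcat.index + 1

/-- Paths of lists, as in the constructor `sw`. -/
abbrev Sw {A : Exp} (x : El (L A)) (a : El (A ⊎ A)) (y : El (L A)) (b : El (A ⊎ A)) (z : El (L A)) :
    Exp :=
  Sig (Id (L A) (x ++' (y ++' redex b z)) ((x ++' y) ++' redex b z)) fun l₀ =>
  Sig (Id (L A) (x ++' redex a (y ++' redex b z)) ((x ++' redex a y) ++' redex b z)) fun l₁ =>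
  Sig (Id (L A) ((x ++' redex a y) ++' z) (x ++' redex a (y ++' z))) fun l₂ =>
  Sig (Id (L A) (x ++' (y ++' z)) ((x ++' y) ++' z)) fun l₃ =>
    Id _ (tau x a (y ++' redex b z) ⬝ apEta l₀ ⬝ tau (x ++' y) b z)
      (apEta l₁ ⬝ tau (x ++' redex a y) b z ⬝ apEta l₂ ⬝ tau x a (y ++' z) ⬝ apEta l₃)

/-- As for `ov`, the four instances of associativity are replaced by unspecified equalities of
lists. -/
def sw.library : List Entry := entry
  (Pi (U 0) fun A => Pi (L A) fun x => Pi (A ⊎ A) fun a => Pi (L A) fun y => Pi (A ⊎ A) fun b =>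
    Pi (L A) fun z => Sw x a y b z)
  (lam fun A => lam fun x => lam fun a => lam fun y => lam fun b => lam fun z =>
    pair (symm (assoc x y (redex b z))) (pair (recast (symm (assoc x (redex a y) (redex b z))))
      (pair (recast (assoc x (redex a y) z)) (pair (symm (assoc x y z))
        ⟨HoTT.K .sw A x.val a.val y.val b.val z.val⟩)))) :: ov.library

theorem sw.theory : Theory (ctxOf sw.library) :=
  ov.theory.entry (by decide +kernel)

def sw.index : ℕ := ov.index + 1

/-! ## Contractions of the same list -/

/-- After path induction on `q`, insert the equation for `t` and cancel `l` and `s` on the left. -/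
def ovAlgebra.library : List Entry := entry
  (Pi (U 0) fun X => Pi X fun x => Pi X fun y => Pi X fun u => Pi X fun v => Pi X fun b =>
    Pi (Id X x y) fun t => Pi (Id X x u) fun l => Pi (Id X u v) fun s => Pi (Id X v y) fun k =>
    Id _ t (l ⬝ s ⬝ k) ⇾ Pi (Id X y b) fun q => Pi (Id X v b) fun r => Id _ (t ⬝ q) (l ⬝ s ⬝ r) ⇾
      Id _ r (k ⬝ q))
  (lam fun X => lam fun x => lam fun y => lam fun u => lam fun v => lam fun b => lam fun t =>
    lam fun l => lam fun s => lam fun k => lam fun h => lam fun q =>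
    J (fun b q => Pi (Id X v b) fun r => Id _ (t ⬝ q) (l ⬝ s ⬝ r) ⇾ Id _ r (k ⬝ q)) q
      (lam fun r => lam fun h' => recast (cancelLeft s (cancelLeft l (symm (recast h' : El (Id _ t (l ⬝ s ⬝ r))) ⬝ h))))) :: sw.library

theorem ovAlgebra.theory : Theory (ctxOf ovAlgebra.library) :=
  sw.theory.entry (by decide +kernel)

def ovAlgebra.index : ℕ := sw.index + 1

/-- Path induction on `r` removes it from all composites; then `t ⬝ q` is rewritten by the square
`h`, and `l₁` and `s'` are cancelled. -/
def swAlgebra.library : List Entry := entry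
  (Pi (U 0) fun X => Pi X fun x₀ => Pi X fun x₁ => Pi X fun x₂ => Pi X fun x₃ => Pi X fun x₄ =>
    Pi X fun x₅ => Pi X fun x₆ => Pi X fun x₇ => Pi X fun b =>
    Pi (Id X x₀ x₁) fun t => Pi (Id X x₁ x₂) fun l₀ => Pi (Id X x₂ x₃) fun s =>
    Pi (Id X x₀ x₄) fun l₁ => Pi (Id X x₄ x₅) fun s' => Pi (Id X x₅ x₆) fun l₂ =>
    Pi (Id X x₆ x₇) fun t' => Pi (Id X x₇ x₃) fun l₃ =>
    Id _ (t ⬝ l₀ ⬝ s) (l₁ ⬝ s' ⬝ l₂ ⬝ t' ⬝ l₃) ⇾ Pi (Id X x₃ b) fun r => Pi (Id X x₁ b) fun q =>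
    Pi (Id X x₅ b) fun q' => Id _ q (l₀ ⬝ s ⬝ r) ⇾ Id _ (t ⬝ q) (l₁ ⬝ s' ⬝ q') ⇾
      Id _ q' (l₂ ⬝ t' ⬝ l₃ ⬝ r))
  (lam fun X => lam fun x₀ => lam fun x₁ => lam fun x₂ => lam fun x₃ => lam fun x₄ => lam fun x₅ =>
    lam fun x₆ => lam fun x₇ => lam fun b => lam fun t => lam fun l₀ => lam fun s => lam fun l₁ =>
    lam fun s' => lam fun l₂ => lam fun t' => lam fun l₃ => lam fun h => lam fun r =>
    J (fun b r => Pi (Id X x₁ b) fun q => Pi (Id X x₅ b) fun q' => Id _ q (l₀ ⬝ s ⬝ r) ⇾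
        Id _ (t ⬝ q) (l₁ ⬝ s' ⬝ q') ⇾ Id _ q' (l₂ ⬝ t' ⬝ l₃ ⬝ r)) r
      (recast (lam fun q => lam fun q' => lam fun hq => lam fun h' =>
        cancelLeft s' (cancelLeft l₁ (symm h' ⬝ ap (fun q => t ⬝ q) hq ⬝ h)) :
        El (Pi (Id X x₁ x₃) fun q => Pi (Id X x₅ x₃) fun q' => Id _ q (l₀ ⬝ s) ⇾
        Id _ (t ⬝ q) (l₁ ⬝ s' ⬝ q') ⇾ Id _ q' (l₂ ⬝ t' ⬝ l₃))))) :: ovAlgebra.library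

theorem swAlgebra.theory : Theory (ctxOf swAlgebra.library) :=
  ovAlgebra.theory.entry (by decide +kernel)

def swAlgebra.index : ℕ := ovAlgebra.index + 1

/-- Two paths along which lists are equal. -/
def changePath.library : List Entry := entry
  (Pi (U 0) fun A => isSet (L A) ⇾ Pi (N A) fun B => Pi (L A) fun v => Pi (L A) fun w =>
    Pi (To B w) fun q => Pi (Id (L A) v w) fun e => Pi (Id (L A) v w) fun e' =>
      Id (To B v) (apEta e ⬝ q) (apEta e' ⬝ q))
  (lam fun A => lam fun hL => lam fun B => lam fun v => lam fun w => lam fun q => lam fun e =>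
    lam fun e' => ap (fun e => apEta e ⬝ q) (hL v w e e')) :: swAlgebra.library

theorem changePath.theory : Theory (ctxOf changePath.library) :=
  swAlgebra.theory.entry (by decide +kernel)

def changePath.index : ℕ := swAlgebra.index + 1

def changePath {A : Exp} (hL : El (isSet (L A))) {B : El (N A)} {v w : El (L A)} (q : El (To B w))
    (e e' : El (Id (L A) v w)) : El (Id (To B v) (apEta e ⬝ q) (apEta e' ⬝ q)) :=
  cite changePath.index [A, hL.val, B.val, v.val, w.val, q.val, e.val, e'.val]

def samePathSymm.library : List Entry := entry
  (Pi (U 0) fun A => Pi (N A) fun B => Pi (L A) fun v => Pi (L A) fun w => Pi (Id (L A) v w) fun e =>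
    Pi (To B v) fun p => Pi (To B w) fun q => Id _ p (apEta e ⬝ q) ⇾ SamePath w q v p)
  (lam fun A => lam fun B => lam fun v => lam fun w => lam fun e => lam fun p =>
    J (fun w e => Pi (To B w) fun q => Id _ p (apEta e ⬝ q) ⇾ SamePath w q v p) e
      (lam fun q => lam fun h => pair refl (recast (symm (reflConcat q) ⬝ symm (recast h) ⬝
        symm (reflConcat p))))) :: changePath.library

theorem samePathSymm.theory : Theory (ctxOf samePathSymm.library) :=
  changePath.theory.entry (by decide +kernel)

def samePathSymm.index : ℕ := changePath.index + 1

def samePathSymm {A : Exp} {B : El (N A)} {v w : El (L A)} {p : El (To B v)} {q : El (To B w)}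
    (e : El (Id (L A) v w)) (h : El (Id _ p (apEta e ⬝ q))) : El (SamePath w q v p) :=
  cite samePathSymm.index [A, B.val, v.val, w.val, e.val, p.val, q.val, h.val]

/-- A redex, contracted twice. -/
def diamondSame.library : List Entry := entry
  (Pi (U 0) fun A => isSet (L A) ⇾ Pi (N A) fun B => Pi (L A) fun x => Pi (A ⊎ A) fun a =>
    Pi (L A) fun y => Pi (To B (x ++' y)) fun q => Pi (L A) fun x' => Id _ x x' ⇾
    Pi (A ⊎ A) fun a' => Id _ a a' ⇾ Pi (L A) fun y' => Id _ y y' ⇾ Pi (To B (x' ++' y')) fun q' =>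
    Pi (Id _ (x ++' redex a y) (x' ++' redex a' y')) fun e =>
    Id _ (tau x a y ⬝ q) (apEta e ⬝ tau x' a' y' ⬝ q') ⇾ SamePath (x ++' y) q (x' ++' y') q')
  (lam fun A => lam fun hL => lam fun B => lam fun x => lam fun a => lam fun y => lam fun q =>
    lam fun x' => lam fun p => lam fun a' => lam fun p' => lam fun y' => lam fun p'' =>
    -- The equalities of the data of the two redexes are eliminated by transporting the whole
    -- statement, in which the path `q'` and the equality `e` are still quantified.
    let G (x' : El (L A)) (a' : El (A ⊎ A)) (y' : El (L A)) : Exp := Pi (To B (x' ++' y')) fun q' =>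
      Pi (Id _ (x ++' redex a y) (x' ++' redex a' y')) fun e =>
      Id _ (tau x a y ⬝ q) (apEta e ⬝ tau x' a' y' ⬝ q') ⇾ SamePath (x ++' y) q (x' ++' y') q'
    transport (fun x' => G x' a' y') p (transport (fun a' => G x a' y') p'
      (transport (fun y' => G x a y') p'' (lam fun q' => lam fun e => lam fun h =>
        -- The list equality `e` is now a loop and may be replaced by `refl`; cancelling `τ` leaves
        -- `q = q'`.
        pair refl (recast (cancelLeft (tau x a y) (h ⬝ changePath hL (tau x a y ⬝ q') e refl ⬝
          recast (reflConcat (tau x a y ⬝ q'))) ⬝ symm (reflConcat q'))))))) :: samePathSymm.library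

theorem diamondSame.theory : Theory (ctxOf diamondSame.library) :=
  samePathSymm.theory.entry (by decide +kernel)

def diamondSame.index : ℕ := samePathSymm.index + 1

/-- Redexes with a common element. -/
def diamondOv.library : List Entry := entry
  (Pi (U 0) fun A => isSet (L A) ⇾ Pi (N A) fun B => Pi (L A) fun x => Pi (A ⊎ A) fun a =>
    Pi (L A) fun y' => Pi (L A) fun x' => Id _ (x ++' cons a nil) x' ⇾
    Pi (A ⊎ A) fun a' => Id _ (bar a) a' ⇾ Pi (L A) fun y => Id _ (cons a y') y ⇾
    Pi (To B (x ++' y)) fun q => Pi (To B (x' ++' y')) fun q' =>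
    Pi (Id _ (x ++' redex a y) (x' ++' redex a' y')) fun e =>
    Id _ (tau x a y ⬝ q) (apEta e ⬝ tau x' a' y' ⬝ q') ⇾ SamePath (x ++' y) q (x' ++' y') q')
  (lam fun A => lam fun hL => lam fun B => lam fun x => lam fun a => lam fun y' =>
    lam fun x' => lam fun p => lam fun a' => lam fun p' => lam fun y => lam fun p'' =>
    let G (x' : El (L A)) (a' : El (A ⊎ A)) (y : El (L A)) : Exp := Pi (To B (x ++' y)) fun q =>
      Pi (To B (x' ++' y')) fun q' =>
      Pi (Id _ (x ++' redex a y) (x' ++' redex a' y')) fun e =>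
      Id _ (tau x a y ⬝ q) (apEta e ⬝ tau x' a' y' ⬝ q') ⇾ SamePath (x ++' y) q (x' ++' y') q'
    let s : El (L A) := cons a nil
    transport (fun x' => G x' a' y) p (transport (fun a' => G (x ++' s) a' y) p'
      (transport (fun y => G (x ++' s) (bar a) y) p'' (lam fun q => lam fun q' => lam fun e =>
        lam fun h =>
        split (cite ov.index [A.val, x.val, a.val, y'.val] :
          El (Sig (Id (L A) (x ++' redex a (cons a y')) ((x ++' s) ++' redex (bar a) y')) fun e =>
            Sig (Id (L A) ((x ++' s) ++' y') (x ++' cons a y')) fun l =>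
            Id _ (tau x a (cons a y')) (apEta e ⬝ tau (x ++' s) (bar a) y' ⬝ apEta l)))
        -- The given equality of lists is replaced by the one in `ov`. The algebra then expresses
        -- `q'` by `q` in the direction opposite to `SamePath`, hence the inversion.
        fun e' r => split r fun l r => samePathSymm l (cite ovAlgebra.index [N A,
          (eta (x ++' redex a (cons a y'))).val, (eta (x ++' cons a y')).val,
          (eta ((x ++' s) ++' redex (bar a) y')).val, (eta ((x ++' s) ++' y')).val, B.val,
          (tau x a (cons a y')).val, (apEta e').val, (tau (x ++' s) (bar a) y').val, (apEta l).val,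
          r.val, q.val, q'.val,
          (h ⬝ changePath hL (tau (x ++' s) (bar a) y' ⬝ q') e e').val]))))) :: diamondSame.library

theorem diamondOv.theory : Theory (ctxOf diamondOv.library) :=
  diamondSame.theory.entry (by decide +kernel)

def diamondOv.index : ℕ := diamondSame.index + 1

/-- A contraction of a list that is equal to a list with a redex. -/
def stepFrom.library : List Entry := entry
  (Pi (U 0) fun A => Pi (Rel A) fun S => HasSteps S ⇾ Pi (N A) fun B => Pi (L A) fun x =>
    Pi (A ⊎ A) fun a => Pi (L A) fun y => Pi (To B (x ++' y)) fun q => Pi (L A) fun t =>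
    Pi (Id _ t (x ++' redex a y)) fun e => Pi (To B t) fun p =>
      Id _ p (apEta e ⬝ tau x a y ⬝ q) ⇾ S B t p (x ++' y) q)
  (lam fun A => lam fun S => lam fun st => lam fun B => lam fun x => lam fun a => lam fun y =>
    lam fun q => lam fun t => lam fun e => lam fun p => lam fun h =>
    split (samePathSymm e h) fun e' h' =>
      app (app (J (fun t e' => Pi (To B t) fun p => Id _ (tau x a y ⬝ q) (apEta e' ⬝ p) ⇾
        S B t p (x ++' y) q) e' (lam fun p => lam fun h =>
          transport (fun p => S B (x ++' redex a y) p (x ++' y) q) (h ⬝ recast (reflConcat p))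
            (st x a y B q))) p) h') :: diamondOv.library

theorem stepFrom.theory : Theory (ctxOf stepFrom.library) :=
  diamondOv.theory.entry (by decide +kernel)

def stepFrom.index : ℕ := diamondOv.index + 1

/-- A contraction to a list that is equal to the contracted list. -/
def stepTo.library : List Entry := entry
  (Pi (U 0) fun A => Pi (Rel A) fun S => Pi (N A) fun B => Pi (L A) fun t => Pi (To B t) fun p =>
    Pi (L A) fun v => Pi (L A) fun w => Pi (Id (L A) v w) fun e => Pi (To B w) fun q =>
      S B t p v (apEta e ⬝ q) ⇾ S B t p w q)
  (lam fun A => lam fun S => lam fun B => lam fun t => lam fun p => lam fun v => lam fun w =>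
    lam fun e => J (fun w e => Pi (To B w) fun q => S B t p v (apEta e ⬝ q) ⇾ S B t p w q) e
      (lam fun q => lam fun s => transport (fun q => S B t p v q) (recast (reflConcat q)) s)) :: stepFrom.library

theorem stepTo.theory : Theory (ctxOf stepTo.library) :=
  stepFrom.theory.entry (by decide +kernel)

def stepTo.index : ℕ := stepFrom.index + 1

/-- A common contraction. -/
abbrev Joins {A : Exp} (S : El (Rel A)) (B : El (N A)) (x y : El (L A)) (q : El (To B (x ++' y)))
    (x' y' : El (L A)) (q' : El (To B (x' ++' y'))) : Exp :=
  Sig (L A) fun w => Sig (To B w) fun l => S B (x ++' y) q w l ⊗ S B (x' ++' y') q' w l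

/-- Redexes without a common element. -/
def diamondSw.library : List Entry := entry
  (Pi (U 0) fun A => isSet (L A) ⇾ Pi (Rel A) fun S => HasSteps S ⇾ Pi (N A) fun B =>
    Pi (L A) fun x => Pi (A ⊎ A) fun a => Pi (L A) fun m => Pi (A ⊎ A) fun b => Pi (L A) fun z =>
    Pi (L A) fun x' => Id _ (x ++' redex a m) x' ⇾ Pi (L A) fun y => Id _ (m ++' redex b z) y ⇾
    Pi (To B (x ++' y)) fun q => Pi (To B (x' ++' z)) fun q' =>
    Pi (Id _ (x ++' redex a y) (x' ++' redex b z)) fun e =>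
    Id _ (tau x a y ⬝ q) (apEta e ⬝ tau x' b z ⬝ q') ⇾ Joins S B x y q x' z q')
  (lam fun A => lam fun hL => lam fun S => lam fun st => lam fun B => lam fun x => lam fun a =>
    lam fun m => lam fun b => lam fun z => lam fun x' => lam fun p => lam fun y => lam fun p' =>
    let G (x' y : El (L A)) : Exp := Pi (To B (x ++' y)) fun q => Pi (To B (x' ++' z)) fun q' =>
      Pi (Id _ (x ++' redex a y) (x' ++' redex b z)) fun e =>
      Id _ (tau x a y ⬝ q) (apEta e ⬝ tau x' b z ⬝ q') ⇾ Joins S B x y q x' z q'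
    transport (fun x' => G x' y) p (transport (fun y => G (x ++' redex a m) y) p'
      (lam fun q => lam fun q' => lam fun e => lam fun h =>
        split (cite sw.index [A.val, x.val, a.val, m.val, b.val, z.val] : El (Sw x a m b z)) fun l₀ k =>
        split k fun l₁ k => split k fun l₂ k => split k fun l₃ k =>
        -- Both redexes are removed. The path `r` is obtained from `q` by going back along the
        -- contraction of `b`, so that the first contraction reaches `(w, r)` by definition; that
        -- the second one reaches it too is the content of `sw`.
        let w : El (L A) := (x ++' m) ++' z
        let t : El (To (eta w) ((x ++' m) ++' redex b z)) := tau (x ++' m) b z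
        let r : El (To B w) := symm t ⬝ symm (apEta l₀) ⬝ q
        let hq : El (Id _ q (apEta l₀ ⬝ t ⬝ r)) :=
          symm (concatSymmConcat (apEta l₀) q) ⬝ ap (fun q => apEta l₀ ⬝ q)
            (symm (concatSymmConcat t (symm (apEta l₀) ⬝ q)))
        let s' : El (Id _ (eta ((x ++' redex a m) ++' redex b z)) (eta ((x ++' redex a m) ++' z))) :=
          tau (x ++' redex a m) b z
        pair w (pair r (pair
          (cite stepFrom.index [A.val, S.val, st.val, B.val, (x ++' m).val, b.val, z.val, r.val,
            (x ++' (m ++' redex b z)).val, l₀.val, q.val, hq.val])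
          (cite stepTo.index [A.val, S.val, B.val, ((x ++' redex a m) ++' z).val, q'.val,
            (x ++' (m ++' z)).val, w.val, l₃.val, r.val,
            (cite stepFrom.index [A.val, S.val, st.val, B.val, x.val, a.val, (m ++' z).val,
              (apEta l₃ ⬝ r).val, ((x ++' redex a m) ++' z).val, l₂.val, q'.val,
              (cite swAlgebra.index [N A, (eta (x ++' redex a (m ++' redex b z))).val,
                (eta (x ++' (m ++' redex b z))).val, (eta ((x ++' m) ++' redex b z)).val,
                (eta w).val, (eta ((x ++' redex a m) ++' redex b z)).val,
                (eta ((x ++' redex a m) ++' z)).val, (eta (x ++' redex a (m ++' z))).val,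
                (eta (x ++' (m ++' z))).val, B.val, (tau x a (m ++' redex b z)).val,
                (apEta l₀).val, t.val, (apEta l₁).val, s'.val, (apEta l₂).val,
                (tau x a (m ++' z)).val, (apEta l₃).val, k.val, r.val, q.val, q'.val, hq.val,
                (h ⬝ changePath hL (s' ⬝ q') e l₁).val] : El (U 0)).val] : El (U 0)).val])))))) :: stepTo.library

theorem diamondSw.theory : Theory (ctxOf diamondSw.library) :=
  stepTo.theory.entry (by decide +kernel)

def diamondSw.index : ℕ := stepTo.index + 1

/-- Contractions of two redexes, the first of which does not begin after the second. -/
def halfDiamond.library : List Entry := entry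
  (Pi (U 0) fun A => isSet (L A) ⇾ Pi (Rel A) fun S => HasSteps S ⇾ Pi (N A) fun B =>
    Pi (L A) fun x => Pi (A ⊎ A) fun a => Pi (L A) fun y => Pi (To B (x ++' y)) fun q =>
    Pi (L A) fun x' => Pi (A ⊎ A) fun a' => Pi (L A) fun y' => Pi (To B (x' ++' y')) fun q' =>
    SamePath (x ++' redex a y) (tau x a y ⬝ q) (x' ++' redex a' y') (tau x' a' y' ⬝ q') ⇾
    (Sig (L A) fun m => Id _ (x ++' m) x' ⊗ Id _ (redex a y) (m ++' redex a' y')) ⇾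
    (SamePath (x ++' y) q (x' ++' y') q' ⊎ Joins S B x y q x' y' q'))
  (lam fun A => lam fun hL => lam fun S => lam fun st => lam fun B => lam fun x => lam fun a =>
    lam fun y => lam fun q => lam fun x' => lam fun a' => lam fun y' => lam fun q' => lam fun h =>
    lam fun k => split h fun e h => split k fun m k => split k fun o k =>
    -- Coinciding redexes use cancellation, overlapping ones `ov`, and disjoint ones `sw`; only the
    -- last case needs a further contraction.
    cases (cite overlap.index [A.val, a.val, y.val, a'.val, y'.val, m.val, k.val] :
        El (Overlap a y m a' y'))
      (fun k => split k fun p k => split k fun p' p'' => inl (cite diamondSame.index [A.val, hL.val, B.val,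
        x.val, a.val, y.val, q.val, x'.val, ((cite appendNil.index [A.val, x.val] :
          El (Id _ (x ++' nil) x)) |> symm |> fun c => (c ⬝ ap (fun m => x ++' m) p ⬝ o)).val,
        a'.val, p'.val, y'.val, p''.val, q'.val, e.val, h.val]))
      (fun k => cases k
        (fun k => split k fun p k => split k fun p' p'' => inl (cite diamondOv.index [A.val, hL.val, B.val,
          x.val, a.val, y'.val, x'.val, (ap (fun m => x ++' m) p ⬝ o).val,
          a'.val, p'.val, y.val, p''.val, q.val, q'.val, e.val, h.val]))
        (fun k => split k fun m' k => split k fun p p' => inr (cite diamondSw.index [A.val, hL.val, S.val,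
          st.val, B.val, x.val, a.val, m'.val, a'.val, y'.val, x'.val,
          (ap (fun m => x ++' m) p ⬝ o).val, y.val, p'.val, q.val, q'.val, e.val, h.val])))) :: diamondSw.library

theorem halfDiamond.theory : Theory (ctxOf halfDiamond.library) :=
  diamondSw.theory.entry (by decide +kernel)

def halfDiamond.index : ℕ := diamondSw.index + 1

/-- One of the two lists in front of the redexes begins with the other. By symmetry of `SamePath`
and of common reducts, the redexes may be exchanged so that `halfDiamond` applies. -/
def localDiamond.library : List Entry := entry
  (Pi (U 0) fun A => isSet (L A) ⇾ LocalDiamond A)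
  (lam fun A => lam fun hL => lam fun S => lam fun st => lam fun B => lam fun x => lam fun a =>
    lam fun y => lam fun q => lam fun x' => lam fun a' => lam fun y' => lam fun q' => lam fun h =>
    split h fun e h => cases (cite beginnings.index [A.val, x.val, x'.val, (redex a y).val,
        (redex a' y').val, e.val] :
        El ((Sig (L A) fun m => Id _ (x ++' m) x' ⊗ Id _ (redex a y) (m ++' redex a' y')) ⊎
          (Sig (L A) fun m => Id _ (x' ++' m) x ⊗ Id _ (redex a' y') (m ++' redex a y))))
      (fun k => cite halfDiamond.index [A.val, hL.val, S.val, st.val, B.val, x.val, a.val, y.val, q.val,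
        x'.val, a'.val, y'.val, q'.val,
        (pair e h : El (SamePath (x ++' redex a y) (tau x a y ⬝ q) (x' ++' redex a' y')
          (tau x' a' y' ⬝ q'))).val, k.val])
      (fun k => cases (cite halfDiamond.index [A.val, hL.val, S.val, st.val, B.val, x'.val, a'.val, y'.val,
          q'.val, x.val, a.val, y.val, q.val, (samePathSymm e h).val, k.val] :
          El (SamePath (x' ++' y') q' (x ++' y) q ⊎ Joins S B x' y' q' x y q))
        (fun j => split j fun e h => inl (samePathSymm e h))
        (fun j => split j fun w j => split j fun l j => split j fun s s' =>
          inr (pair w (pair l (pair s' s)))))) :: halfDiamond.library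

theorem localDiamond.theory : Theory (ctxOf localDiamond.library) :=
  halfDiamond.theory.entry (by decide +kernel)

def localDiamond.index : ℕ := halfDiamond.index + 1

/-- If `A` is a set, then `N(A)` is a set. -/
def isSetNOfIsSet.library : List Entry := entry
  (Pi (U 0) fun A => isSet A ⇾ isSet (N A))
  (lam fun A => lam fun h =>
    -- The hypothesis on `A` enters only here, through the set of lists.
    let hL : El (isSet (L A)) := cite isSetList.index [A ⊎ A, (cite isSetSum.index [A.val, h.val] : El (U 0)).val]
    cite rewriting.index [A.val, (cite localDiamond.index [A.val, hL.val] : El (U 0)).val, isSet (N A),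
      (lam fun R => lam fun rf => lam fun tr => lam fun st => lam fun conf => lam fun inv =>
        cite isSetN.index [A.val, (cite isPropIdOfConfluent.index [A.val, R.val, rf.val, tr.val, st.val, conf.val,
          (cite unique.index [A.val, hL.val, (cite listWf.index [A.val] : El (U 0)).val, R.val, tr.val, st.val,
            conf.val, inv.val] : El (U 0)).val] : El (U 0)).val] :
        El (Pi (Rel A) fun R => Reflexive R ⇾ Transitive R ⇾ HasSteps R ⇾ Confluent R ⇾
          Reduces R ⇾ isSet (N A))).val]) :: localDiamond.library

theorem isSetNOfIsSet.theory : Theory (ctxOf isSetNOfIsSet.library) :=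
  localDiamond.theory.entry (by decide +kernel)

def isSetNOfIsSet.index : ℕ := localDiamond.index + 1

end HoTT.Typed

theorem mainTheorem4 (i : ℕ) :
    HoTT.IsTheorem
      (HoTT.Pi (HoTT.U i) fun A => HoTT.Arrow (HoTT.isSet A) (HoTT.isSet (HoTT.NA A))) := by
  -- The theory contains the statement for `U 0`; raising all levels by `i` gives it for the
  -- universe `0 + i`.
  refine HoTT.IsTheorem.raise i (T := HoTT.Pi (HoTT.U 0) fun A =>
    HoTT.Arrow (HoTT.isSet A) (HoTT.isSet (HoTT.NA A)))
    (HoTT.Theory.isTheorem (n := HoTT.Typed.isSetNOfIsSet.index)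
      (Γ := HoTT.ctxOf HoTT.Typed.localDiamond.library) HoTT.Typed.isSetNOfIsSet.theory rfl rfl) ?_
  change HoTT.Tm.pi (.univ (0 + i)) _ = HoTT.Tm.pi (.univ i) _
  rw [Nat.zero_add]
  rfl
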